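/- Let $M$ be a smooth $4$-manifold with a smooth pseudo-Riemannian metric $g$ of signature $(2,2)$, Levi-Civita connection $\nabla$ and Ricci tensor $\rho$. Let $f\in\mathcal C^\infty(M)$ and $\mu\in\mathbb R$ be such that $(M,g,f,\mu)$ is a generalized quasi-Einstein manifold, that is, $$\operatorname{Hes}_f+\rho-\mu\,df\otimes df=\lambda\,g\quad\text{for some }\lambda\in\mathcal C^\infty(M).$$ Suppose that $(M,g)$ is half conformally flat, that is, for some orientation of $M$ the Weyl tensor, as an operator on $2$-forms, vanishes on the anti-self-dual $2$-forms ($(M,g)$ is self-dual) or on the self-dual $2$-forms ($(M,g)$ is anti-self-dual). Suppose also that $\mu\neq-\frac12$ and that, at every point of $M$, $\nabla f\neq0$ and $g(\nabla f,\nabla f)=0$. Then $(M,g)$ is a Walker manifold: there is a smooth distribution $\mathfrak D\subset TM$ of rank $2$ that is null ($g(X,Y)=0$ for all $X,Y\in\mathfrak D$) and parallel ($\nabla_XY\in\mathfrak D$ for every vector field $X$ and every local section $Y$ of $\mathfrak D$). Moreover $\mathfrak D$ can be chosen such that: 1. near every point of $M$ there is a smooth vector field $U$ with $\mathfrak D=\operatorname{span}\{\nabla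 f,U\}$; 2. near every point of $M$ there are local coordinates $(x^1,x^2,x_{1'},x_{2'})$ and smooth functions $a_{ij}=a_{ji}$ of these coordinates ($i,j\in\{1,2\}$) such that $$g=2\,dx^i\circ dx_{i'}+a_{ij}\,dx^i\circ dx^j\quad\text{and}\quad\mathfrak D=\operatorname{span}\{\partial_{x_{1'}},\partial_{x_{2'}}\},$$ with summation over repeated indices, where $\circ$ is the symmetric product $\alpha\circ\beta=\frac12(\alpha\otimes\beta+\beta\otimes\alpha)$. -/

import Mathlib

open scoped Manifold ContDiff

noncomputable section

/-! ### Coordinate tensor calculus on open subsets of `ℝ⁴`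

The argument `G` is the matrix of components of a metric in a coordinate system, as a function of
the coordinates.  All indices run over `Fin 4`. -/

/-- The model space `ℝ⁴`. -/
abbrev R4 : Type := EuclideanSpace ℝ (Fin 4)

/-- The partial derivative `∂_i u` at `x`. -/
def partialD (i : Fin 4) (u : R4 → ℝ) (x : R4) : ℝ :=
  fderiv ℝ u x (EuclideanSpace.single i 1)

/-- The Christoffel symbol `Γ_{ij}^k = ½ G^{kl} (∂_i G_{jl} + ∂_j G_{il} - ∂_l G_{ij})` of the
Levi-Civita connection. -/
def christoffel (G : R4 → Matrix (Fin 4) (Fin 4) ℝ) (i j k : Fin 4) (x : R4) : ℝ :=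
  (1 / 2) * ∑ l, (G x)⁻¹ k l *
    (partialD i (fun y => G y j l) x + partialD j (fun y => G y i l) x
      - partialD l (fun y => G y i j) x)

/-- The components `R_{ijk}^l` of the curvature operator
`𝓡(X, Y) Z = ∇_{[X, Y]} Z - [∇_X, ∇_Y] Z`, that is `𝓡(∂_i, ∂_j) ∂_k = ∑ l, R_{ijk}^l ∂_l`. -/
def curvatureOp (G : R4 → Matrix (Fin 4) (Fin 4) ℝ) (i j k l : Fin 4) (x : R4) : ℝ :=
  -(partialD i (christoffel G j k l) x - partialD j (christoffel G i k l) x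
    + ∑ m, (christoffel G j k m x * christoffel G i m l x
      - christoffel G i k m x * christoffel G j m l x))

/-- The components `R(∂_i, ∂_j, ∂_k, ∂_l) = g(𝓡(∂_i, ∂_j) ∂_k, ∂_l)` of the curvature tensor. -/
def curvature (G : R4 → Matrix (Fin 4) (Fin 4) ℝ) (i j k l : Fin 4) (x : R4) : ℝ :=
  ∑ m, curvatureOp G i j k m x * G x m l

/-- The components of the Ricci tensor `ρ(X, Y) = Tr (Z ↦ 𝓡(X, Z) Y)`. -/
def ricci (G : R4 → Matrix (Fin 4) (Fin 4) ℝ) (i j : Fin 4) (x : R4) : ℝ :=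
  ∑ k, curvatureOp G i k j k x

/-- The scalar curvature `τ = G^{ij} ρ_{ij}`. -/
def scalarCurvature (G : R4 → Matrix (Fin 4) (Fin 4) ℝ) (x : R4) : ℝ :=
  ∑ i, ∑ j, (G x)⁻¹ i j * ricci G i j x

/-- The components `W(∂_i, ∂_j, ∂_k, ∂_l)` of the Weyl tensor in dimension `n = 4`, where
`1 / ((n - 1) (n - 2)) = 1 / 6` and `1 / (n - 2) = 1 / 2`. -/
def weyl (G : R4 → Matrix (Fin 4) (Fin 4) ℝ) (i j k l : Fin 4) (x : R4) : ℝ :=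
  curvature G i j k l x
    + scalarCurvature G x / 6 * (G x i k * G x j l - G x i l * G x j k)
    + (1 / 2) * (ricci G i l x * G x j k - ricci G i k x * G x j l
      + ricci G j k x * G x i l - ricci G j l x * G x i k)

/-- The components `∂_i ∂_j F - Γ_{ij}^k ∂_k F` of the Hessian of a function `F`. -/
def hessian (G : R4 → Matrix (Fin 4) (Fin 4) ℝ) (F : R4 → ℝ) (i j : Fin 4) (x : R4) : ℝ :=
  partialD i (partialD j F) x - ∑ k, christoffel G i j k x * partialD k F x

/-- The components `θ^{ij} = g^{ik} g^{jl} θ_{kl}` obtained by raising both indices of `θ`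
by means of the metric matrix `g`. -/
def raise (g θ : Matrix (Fin 4) (Fin 4) ℝ) : Matrix (Fin 4) (Fin 4) ℝ :=
  fun i j => ∑ k, ∑ l, g⁻¹ i k * g⁻¹ j l * θ k l

/-- The Levi-Civita permutation symbol. -/
def permSymbol (i j k l : Fin 4) : ℝ :=
  Matrix.det (Matrix.of fun a b : Fin 4 => if ![i, j, k, l] a = b then (1 : ℝ) else 0)

/-- The Hodge star on two-forms: `(⋆θ)_{ij} = ½ vol_{ijkl} θ^{kl}`, where
`vol_{ijkl} = s √|det g| ε_{ijkl}` and `s = ±1` records whether the coordinate frame is positively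
or negatively oriented. -/
def hodgeStar (s : ℝ) (g θ : Matrix (Fin 4) (Fin 4) ℝ) : Matrix (Fin 4) (Fin 4) ℝ :=
  fun i j => (1 / 2) * ∑ k, ∑ l, s * √|g.det| * permSymbol i j k l * raise g θ k l

/-- The Weyl tensor as an operator on two-forms: `(Wθ)_{ij} = ½ W_{ijkl} θ^{kl}`. -/
def weylOp (G : R4 → Matrix (Fin 4) (Fin 4) ℝ) (x : R4) (θ : Matrix (Fin 4) (Fin 4) ℝ) :
    Matrix (Fin 4) (Fin 4) ℝ :=
  fun i j => (1 / 2) * ∑ k, ∑ l, weyl G i j k l x * raise (G x) θ k l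

/-! ### Smooth 4-manifolds: charts, vector fields, orientations, metrics -/

section Manifold

variable {M : Type*} [TopologicalSpace M] [ChartedSpace R4 M]

/-- `φ` is a smooth coordinate system on an open subset of `M`. -/
def IsCoord (φ : OpenPartialHomeomorph M R4) : Prop :=
  φ ∈ IsManifold.maximalAtlas (𝓡 4) ∞ M

/-- The coordinate vector `∂_i` of `φ` at the point with coordinates `x`. -/
def coordVec (φ : OpenPartialHomeomorph M R4) (x : R4) (i : Fin 4) :
    TangentSpace (𝓡 4) (φ.symm x) :=
  mfderiv (𝓡 4) (𝓡 4) φ.symm x (EuclideanSpace.single i (1 : ℝ) : R4)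

/-- The `k`-th component of the vector field `Y` in the coordinates `φ`, as a function of the
coordinates. -/
def vecComp (φ : OpenPartialHomeomorph M R4) (Y : ∀ p : M, TangentSpace (𝓡 4) p) (k : Fin 4)
    (x : R4) : ℝ :=
  (show R4 from mfderiv (𝓡 4) (𝓡 4) φ (φ.symm x) (Y (φ.symm x))) k

/-- The vector field `Y` is smooth on `O`. -/
def IsSmoothVectorFieldOn [IsManifold (𝓡 4) ∞ M] (Y : ∀ p : M, TangentSpace (𝓡 4) p)
    (O : Set M) : Prop :=
  ContMDiffOn (𝓡 4) ((𝓡 4).prod 𝓘(ℝ, R4)) ∞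
    (fun p => (Bundle.TotalSpace.mk' R4 p (Y p) : TangentBundle (𝓡 4) M)) O

/-- `D` is a smooth distribution of rank two on `M`. -/
def IsSmoothPlaneDistribution [IsManifold (𝓡 4) ∞ M]
    (D : ∀ p : M, Submodule ℝ (TangentSpace (𝓡 4) p)) : Prop :=
  (∀ p, Module.finrank ℝ (D p) = 2) ∧
  ∀ p : M, ∃ O : Set M, IsOpen O ∧ p ∈ O ∧ ∃ X Y : ∀ q : M, TangentSpace (𝓡 4) q,
    IsSmoothVectorFieldOn X O ∧ IsSmoothVectorFieldOn Y O ∧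
    ∀ q ∈ O, D q = Submodule.span ℝ {X q, Y q}

/-- The Jacobian determinant of the coordinate change `ψ ∘ φ⁻¹`. -/
def jacobianDet (φ ψ : OpenPartialHomeomorph M R4) (x : R4) : ℝ :=
  (fderiv ℝ (fun y => ψ (φ.symm y)) x).det

variable (M) in
/-- An orientation of `M`, given by an oriented atlas. -/
structure OrientedAtlas where
  charts : Set (OpenPartialHomeomorph M R4)
  isCoord : ∀ φ ∈ charts, IsCoord φ
  cover : ∀ p : M, ∃ φ ∈ charts, p ∈ φ.source
  jacobianDet_pos : ∀ φ ∈ charts, ∀ ψ ∈ charts, ∀ p ∈ φ.source ∩ ψ.source,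
    0 < jacobianDet φ ψ (φ p)

variable (M) in
/-- A smooth pseudo-Riemannian metric on `M`. -/
structure PseudoRiemannianMetric [IsManifold (𝓡 4) ∞ M] where
  val : ∀ p : M, TangentSpace (𝓡 4) p →L[ℝ] TangentSpace (𝓡 4) p →L[ℝ] ℝ
  symm : ∀ p v w, val p v w = val p w v
  nondegenerate : ∀ p v, (∀ w, val p v w = 0) → v = 0
  contMDiff : ContMDiff (𝓡 4) ((𝓡 4).prod 𝓘(ℝ, R4 →L[ℝ] R4 →L[ℝ] ℝ)) ∞
    (fun p => Bundle.TotalSpace.mk' (R4 →L[ℝ] R4 →L[ℝ] ℝ)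
      (E := fun p : M => TangentSpace (𝓡 4) p →L[ℝ] TangentSpace (𝓡 4) p →L[ℝ] ℝ) p (val p))

namespace PseudoRiemannianMetric

variable [IsManifold (𝓡 4) ∞ M] (g : PseudoRiemannianMetric M)

/-- `g` has signature `(2, 2)`: every tangent space has a basis that is orthonormal with signs
`-, -, +, +`. -/
def HasSignatureTwoTwo : Prop :=
  ∀ p : M, ∃ b : Module.Basis (Fin 4) ℝ (TangentSpace (𝓡 4) p),
    ∀ i j, g.val p (b i) (b j) = Matrix.diagonal ![(-1 : ℝ), -1, 1, 1] i j

/-- The matrix of components `g(∂_i, ∂_j)` in the coordinates `φ`. -/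
def comp (φ : OpenPartialHomeomorph M R4) (x : R4) : Matrix (Fin 4) (Fin 4) ℝ :=
  Matrix.of fun i j => g.val (φ.symm x) (coordVec φ x i) (coordVec φ x j)

/-- By nondegeneracy every covector at `p` is of the form `g(v, ·)`. -/
theorem exists_val_eq (p : M) (α : TangentSpace (𝓡 4) p →L[ℝ] ℝ) :
    ∃ v : TangentSpace (𝓡 4) p, g.val p v = α := by
  have : FiniteDimensional ℝ (TangentSpace (𝓡 4) p) := inferInstanceAs (FiniteDimensional ℝ R4)
  let B : TangentSpace (𝓡 4) p →ₗ[ℝ] Module.Dual ℝ (TangentSpace (𝓡 4) p) :=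
    { toFun := fun v => (g.val p v : TangentSpace (𝓡 4) p →ₗ[ℝ] ℝ)
      map_add' := fun v w => by ext; simp
      map_smul' := fun c v => by ext; simp }
  have hinj : Function.Injective B := by
    refine (injective_iff_map_eq_zero B).2 fun v hv => g.nondegenerate p v fun w => ?_
    exact LinearMap.congr_fun hv w
  have hsurj : Function.Surjective B :=
    (LinearMap.injective_iff_surjective_of_finrank_eq_finrank
      (Subspace.dual_finrank_eq).symm).1 hinj
  obtain ⟨v, hv⟩ := hsurj (α : TangentSpace (𝓡 4) p →ₗ[ℝ] ℝ)
  exact ⟨v, ContinuousLinearMap.ext fun w => LinearMap.congr_fun hv w⟩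

/-- The gradient `∇f`, characterized by `g(∇f, X) = df(X)`. -/
def grad (f : M → ℝ) (p : M) : TangentSpace (𝓡 4) p :=
  (g.exists_val_eq p (mfderiv (𝓡 4) 𝓘(ℝ, ℝ) f p)).choose

theorem val_grad (f : M → ℝ) (p : M) (v : TangentSpace (𝓡 4) p) :
    g.val p (g.grad f p) v = mfderiv (𝓡 4) 𝓘(ℝ, ℝ) f p v :=
  congrArg (fun α : TangentSpace (𝓡 4) p →L[ℝ] ℝ => α v)
    (g.exists_val_eq p (mfderiv (𝓡 4) 𝓘(ℝ, ℝ) f p)).choose_spec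

/-- The components of the covariant derivative `∇_{∂_i} Y` for the Levi-Civita connection, put
together to a tangent vector: `∇_{∂_i} Y = ∑ k, (∂_i Y^k + Γ_{ij}^k Y^j) ∂_k`. -/
def covDeriv (φ : OpenPartialHomeomorph M R4) (i : Fin 4) (Y : ∀ p : M, TangentSpace (𝓡 4) p)
    (x : R4) : TangentSpace (𝓡 4) (φ.symm x) :=
  ∑ k, (partialD i (vecComp φ Y k) x + ∑ j, christoffel (g.comp φ) i j k x * vecComp φ Y j x) •
    coordVec φ x k

/-- `(M, g, f, μ)` is a generalized quasi-Einstein manifold: `f` is smooth and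
`Hes_f + ρ - μ df ⊗ df = λ g` for some smooth function `λ`. -/
def IsGeneralizedQuasiEinstein (f : M → ℝ) (μ : ℝ) : Prop :=
  ContMDiff (𝓡 4) 𝓘(ℝ, ℝ) ∞ f ∧
  ∃ lam : M → ℝ, ContMDiff (𝓡 4) 𝓘(ℝ, ℝ) ∞ lam ∧
    ∀ φ : OpenPartialHomeomorph M R4, IsCoord φ → ∀ x ∈ φ.target, ∀ i j,
      hessian (g.comp φ) (fun y => f (φ.symm y)) i j x + ricci (g.comp φ) i j x
        - μ * (partialD i (fun y => f (φ.symm y)) x * partialD j (fun y => f (φ.symm y)) x)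
      = lam (φ.symm x) * g.comp φ x i j

/-- The Weyl operator of `g` vanishes on the two-forms `θ` with `⋆θ = κ θ`.  In the coordinates
`φ` the Hodge star of the orientation `A` is formed with the sign of the Jacobian determinant of
the change from `φ` to a chart of the oriented atlas. -/
def WeylVanishesOn (A : OrientedAtlas M) (κ : ℝ) : Prop :=
  ∀ φ : OpenPartialHomeomorph M R4, IsCoord φ → ∀ ψ ∈ A.charts,
    ∀ x ∈ φ.target, φ.symm x ∈ ψ.source →
    ∀ θ : Matrix (Fin 4) (Fin 4) ℝ, θ.transpose = -θ →
      hodgeStar (Real.sign (jacobianDet φ ψ x)) (g.comp φ x) θ = κ • θ →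
      weylOp (g.comp φ) x θ = 0

/-- Self-dual: `W⁻ = 0`. -/
def IsSelfDual (A : OrientedAtlas M) : Prop := g.WeylVanishesOn A (-1)

/-- Anti-self-dual: `W⁺ = 0`. -/
def IsAntiSelfDual (A : OrientedAtlas M) : Prop := g.WeylVanishesOn A 1

/-- Half conformally flat: self-dual or anti-self-dual for some orientation. -/
def IsHalfConformallyFlat : Prop :=
  ∃ A : OrientedAtlas M, g.IsSelfDual A ∨ g.IsAntiSelfDual A

/-- `D` is null: `g` vanishes on `D`. -/
def IsNull (D : ∀ p : M, Submodule ℝ (TangentSpace (𝓡 4) p)) : Prop :=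
  ∀ p, ∀ v ∈ D p, ∀ w ∈ D p, g.val p v w = 0

/-- `D` is parallel: the Levi-Civita covariant derivatives of every local smooth section of `D`
are again in `D`. -/
def IsParallel (D : ∀ p : M, Submodule ℝ (TangentSpace (𝓡 4) p)) : Prop :=
  ∀ (O : Set M) (Y : ∀ p : M, TangentSpace (𝓡 4) p), IsOpen O → IsSmoothVectorFieldOn Y O →
    (∀ p ∈ O, Y p ∈ D p) →
    ∀ φ : OpenPartialHomeomorph M R4, IsCoord φ → ∀ x ∈ φ.target, φ.symm x ∈ O →
      ∀ i, g.covDeriv φ i Y x ∈ D (φ.symm x)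

/-- `D` is a Walker structure: a null parallel distribution of rank two. -/
structure IsWalkerStructure (D : ∀ p : M, Submodule ℝ (TangentSpace (𝓡 4) p)) : Prop where
  smooth : IsSmoothPlaneDistribution D
  null : g.IsNull D
  parallel : g.IsParallel D

/-- `φ = (x¹, x², x_{1'}, x_{2'})` are Walker coordinates for `g` and `D`:
`g = 2 dxⁱ ∘ dx_{i'} + a_{ij} dxⁱ ∘ dxʲ` with smooth functions `a_{ij} = a_{ji}`, and
`D = span {∂_{x_{1'}}, ∂_{x_{2'}}}`.  The indices `0, 1` stand for `x¹, x²` and the indices `2, 3`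
for `x_{1'}, x_{2'}`. -/
def IsWalkerCoord (D : ∀ p : M, Submodule ℝ (TangentSpace (𝓡 4) p))
    (φ : OpenPartialHomeomorph M R4) : Prop :=
  IsCoord φ ∧
  (∃ a : Matrix (Fin 2) (Fin 2) (R4 → ℝ), a.IsSymm ∧
    (∀ i j, ContDiffOn ℝ ∞ (a i j) φ.target) ∧
    ∀ x ∈ φ.target, g.comp φ x =
      !![a 0 0 x, a 0 1 x, 1, 0;
         a 1 0 x, a 1 1 x, 0, 1;
         1,       0,       0, 0;
         0,       1,       0, 0]) ∧
  ∀ x ∈ φ.target, D (φ.symm x) = Submodule.span ℝ {coordVec φ x 2, coordVec φ x 3}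

end PseudoRiemannianMetric

end Manifold

end

open scoped Manifold ContDiff

noncomputable section

open Filter Topology

/-! ### Partial derivatives -/

section PartialDerivatives

variable {u v : R4 → ℝ} {x : R4}

/-! Differentiating g(∇f, ∇f) = 0 gives Hes_f(∇f, ·) = 0 (`partialD_zero_partialD`). In neutral
signature a nonzero null vector lies in exactly two totally null planes, one for each orientation.
Complete ∇f to a null frame e₀ = ∇f, e₁, e₂, e₃ with g(e₀, e₂) = g(e₁, e₃) = 1; the two planes are
span{e₀, e₁} and span{e₀, e₃}. Orient the frame so that e₀∧e₃ lies in the half of the bivectors on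
which the Weyl tensor W vanishes. The distribution is D = span{e₀, e₁}, and everything rests on the
claim that Hes_f(e₁, ·) = 0.

The claim is linear algebra at one point (`hessian_eq_zero_of_quasiEinstein`). Skew-symmetrizing the
covariant derivative of the quasi-Einstein equation turns the third derivatives of f into the
curvature R(·, ·, ·, ∇f), by the Ricci identity, and the derivatives of ρ into the Cotton tensor C
plus multiples of dτ. Since div W = C/2 (`divergence_weyl`), the Cotton tensor inherits the
vanishing of half of W (`cotton_selfDual`). On the vanishing half both W and C drop out. What
remains compares the Ricci part of the curvature, with its coefficient 1/2, with the derivative of μ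
df ⊗ df; the result is (μ + 1/2) Hes_f(e₁, ·) = 0. Covariant derivatives are ordinary derivatives
here, because the computation takes place at the centre of coordinates that are normal with respect
to the null frame (`IsNullNormalAt`).

Once the Hessian annihilates D (`IsHessianPlane`), the rest uses only D = D^⊥. For a section Y of D,
g(∇Y, ∇f) = -Hes_f(·, Y) = 0. A second local generator c satisfies g(∇c, c) = 0 because g(c, c) = 0.
Hence ∇Y is orthogonal to D and so lies in D (`ofComp_covComp_mem`).

For the coordinates, D is spanned by commuting fields ∂₀ = ∇f and ∂₁ = ∇H
(`exists_coord_frobenius_exact`). Then f, H, y⁰, y¹ form a coordinate system, and the exact forms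
g(∂₀, ·) = df and g(∂₁, ·) = dH supply the constant entries of the metric (`exists_isWalkerCoord`).
The rectification of vector fields (`exists_coord_of_field`) relies on smooth dependence of flows
(`exists_smooth_flow`), which follows from the inverse function theorem in a Banach space of curves.
-/

theorem Filter.EventuallyEq.partialD_eq (h : u =ᶠ[𝓝 x] v) (i : Fin 4) :
    partialD i u x = partialD i v x := by
  rw [partialD, partialD, h.fderiv_eq]

theorem Filter.EventuallyEq.partialD (h : u =ᶠ[𝓝 x] v) (i : Fin 4) :
    partialD i u =ᶠ[𝓝 x] partialD i v :=
  h.eventuallyEq_nhds.mono fun _ hy => hy.partialD_eq i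

theorem ContDiffAt.partialD (h : ContDiffAt ℝ ∞ u x) (i : Fin 4) :
    ContDiffAt ℝ ∞ (partialD i u) x :=
  (h.fderiv_right (m := ∞) le_rfl).clm_apply contDiffAt_const

theorem ContDiffAt.differentiableAt_infty {E F : Type*} [NormedAddCommGroup E] [NormedSpace ℝ E]
    [NormedAddCommGroup F] [NormedSpace ℝ F] {w : E → F} {y : E} (h : ContDiffAt ℝ ∞ w y) :
    DifferentiableAt ℝ w y :=
  h.differentiableAt (by simp)

theorem ContDiffAt.eventually_differentiableAt {E F : Type*} [NormedAddCommGroup E]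
    [NormedSpace ℝ E] [NormedAddCommGroup F] [NormedSpace ℝ F] {w : E → F} {y : E}
    (h : ContDiffAt ℝ ∞ w y) : ∀ᶠ z in 𝓝 y, DifferentiableAt ℝ w z :=
  ((h.of_le (m := 1) (by exact_mod_cast le_top)).eventually (by simp)).mono
    fun _ hz => hz.differentiableAt one_ne_zero

theorem partialD_add (hu : DifferentiableAt ℝ u x) (hv : DifferentiableAt ℝ v x) (i : Fin 4) :
    partialD i (fun y => u y + v y) x = partialD i u x + partialD i v x := by
  simp [partialD, fderiv_fun_add hu hv]

theorem partialD_sub (hu : DifferentiableAt ℝ u x) (hv : DifferentiableAt ℝ v x) (i : Fin 4) :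
    partialD i (fun y => u y - v y) x = partialD i u x - partialD i v x := by
  simp [partialD, fderiv_fun_sub hu hv]

theorem partialD_mul (hu : DifferentiableAt ℝ u x) (hv : DifferentiableAt ℝ v x) (i : Fin 4) :
    partialD i (fun y => u y * v y) x = u x * partialD i v x + v x * partialD i u x := by
  simp [partialD, fderiv_fun_mul hu hv]

theorem partialD_const (c : ℝ) (i : Fin 4) : partialD i (fun _ => c) x = 0 := by
  simp [partialD]

theorem partialD_const_mul (c : ℝ) (hu : DifferentiableAt ℝ u x) (i : Fin 4) :
    partialD i (fun y => c * u y) x = c * partialD i u x := by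
  simp [partialD, fderiv_const_mul hu]

theorem partialD_sum {ι : Type*} (s : Finset ι) {w : ι → R4 → ℝ}
    (hw : ∀ k ∈ s, DifferentiableAt ℝ (w k) x) (i : Fin 4) :
    partialD i (fun y => ∑ k ∈ s, w k y) x = ∑ k ∈ s, partialD i (w k) x := by
  simp [partialD, fderiv_fun_sum hw]

theorem partialD_comm (h : ContDiffAt ℝ 2 u x) (i j : Fin 4) :
    partialD i (partialD j u) x = partialD j (partialD i u) x := by
  have hs : IsSymmSndFDerivAt ℝ u x := h.isSymmSndFDerivAt (by simp)
  have hd : DifferentiableAt ℝ (fderiv ℝ u) x :=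
    (h.fderiv_right (m := 1) (by norm_num)).differentiableAt one_ne_zero
  have e : ∀ i j : Fin 4, partialD i (partialD j u) x
      = fderiv ℝ (fderiv ℝ u) x (EuclideanSpace.single i 1) (EuclideanSpace.single j 1) := by
    intro i j
    have : partialD j u = fun y => fderiv ℝ u y (EuclideanSpace.single j 1) := rfl
    rw [this, _root_.partialD, fderiv_clm_apply hd (differentiableAt_const _)]
    simp
  rw [e, e, hs.eq]

theorem ContDiffAt.contDiffAt_two (h : ContDiffAt ℝ ∞ u x) : ContDiffAt ℝ 2 u x :=
  h.of_le (WithTop.coe_le_coe.2 le_top : ((2 : ℕ∞) : WithTop ℕ∞) ≤ ∞)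

theorem ContDiffAt.partialD_comm_eventuallyEq (h : ContDiffAt ℝ ∞ u x) (i j : Fin 4) :
    _root_.partialD i (_root_.partialD j u) =ᶠ[𝓝 x] _root_.partialD j (_root_.partialD i u) :=
  (h.contDiffAt_two.eventually (by decide)).mono fun _ hy => _root_.partialD_comm hy i j

end PartialDerivatives

/-! ### Matrix-valued functions -/

section MatrixFunctions

variable {E : Type*} [NormedAddCommGroup E] [NormedSpace ℝ E] {n : Type*} [Fintype n]
  [DecidableEq n] {G : E → Matrix n n ℝ} {p : E}

theorem ContDiffAt.matrix_det {m : WithTop ℕ∞} (hG : ∀ i j, ContDiffAt ℝ m (fun y => G y i j) p) :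
    ContDiffAt ℝ m (fun y => (G y).det) p := by
  simp_rw [Matrix.det_apply']
  exact ContDiffAt.sum fun σ _ => contDiffAt_const.mul (contDiffAt_prod fun i _ => hG _ _)

theorem ContDiffAt.matrix_inv {m : WithTop ℕ∞} (hG : ∀ i j, ContDiffAt ℝ m (fun y => G y i j) p)
    (hdet : (G p).det ≠ 0) (i j : n) : ContDiffAt ℝ m (fun y => (G y)⁻¹ i j) p := by
  simp_rw [Matrix.inv_def, Ring.inverse_eq_inv', Matrix.smul_apply, smul_eq_mul,
    Matrix.adjugate_apply]
  refine ((ContDiffAt.matrix_det hG).inv hdet).mul (ContDiffAt.matrix_det fun k l => ?_)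
  simp only [Matrix.updateRow_apply]
  split_ifs
  · exact contDiffAt_const
  · exact hG _ _

/-- A function with vanishing derivative at `p`. -/
def StationaryAt (u : E → ℝ) (p : E) : Prop := HasFDerivAt u (0 : E →L[ℝ] ℝ) p

namespace StationaryAt

variable {u v : E → ℝ}

theorem const (c : ℝ) : StationaryAt (fun _ => c) p := hasFDerivAt_const c p

theorem add (hu : StationaryAt u p) (hv : StationaryAt v p) :
    StationaryAt (fun y => u y + v y) p := by
  have := HasFDerivAt.fun_add hu hv
  rwa [add_zero] at this

theorem mul (hu : StationaryAt u p) (hv : StationaryAt v p) :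
    StationaryAt (fun y => u y * v y) p := by
  have := HasFDerivAt.fun_mul hu hv
  rwa [smul_zero, smul_zero, add_zero] at this

theorem sum {ι : Type*} {s : Finset ι} {w : ι → E → ℝ} (hw : ∀ k ∈ s, StationaryAt (w k) p) :
    StationaryAt (fun y => ∑ k ∈ s, w k y) p := by
  have := HasFDerivAt.fun_sum hw
  rwa [Finset.sum_const_zero] at this

theorem prod {ι : Type*} {s : Finset ι} {w : ι → E → ℝ} (hw : ∀ k ∈ s, StationaryAt (w k) p) :
    StationaryAt (fun y => ∏ k ∈ s, w k y) p := by
  classical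
  induction s using Finset.induction_on with
  | empty => simpa using const (p := p) 1
  | insert a s ha ih =>
    simp_rw [Finset.prod_insert ha]
    exact (hw a (Finset.mem_insert_self a s)).mul
      (ih fun k hk => hw k (Finset.mem_insert_of_mem hk))

theorem comp {φ : ℝ → ℝ} (hφ : DifferentiableAt ℝ φ (u p)) (hu : StationaryAt u p) :
    StationaryAt (fun y => φ (u y)) p := by
  have := hφ.hasDerivAt.comp_hasFDerivAt p hu
  rwa [smul_zero] at this

theorem det (hG : ∀ i j, StationaryAt (fun y => G y i j) p) :
    StationaryAt (fun y => (G y).det) p := by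
  simp_rw [Matrix.det_apply']
  exact sum fun σ _ => (const _).mul (prod fun i _ => hG _ _)

/-- The inverse is the adjugate divided by the determinant. Hence at the centre of normal
coordinates the inverse metric is stationary as well. -/
theorem inv (hG : ∀ i j, StationaryAt (fun y => G y i j) p) (hdet : (G p).det ≠ 0) (i j : n) :
    StationaryAt (fun y => (G y)⁻¹ i j) p := by
  simp_rw [Matrix.inv_def, Ring.inverse_eq_inv', Matrix.smul_apply, smul_eq_mul,
    Matrix.adjugate_apply]
  refine (comp (u := fun y => (G y).det) (differentiableAt_inv hdet) (det hG)).mul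
    (det fun k l => ?_)
  simp only [Matrix.updateRow_apply]
  split_ifs
  · exact const _
  · exact hG _ _

theorem partialD {u : R4 → ℝ} {p : R4} (h : StationaryAt u p) (i : Fin 4) :
    partialD i u p = 0 := by
  rw [_root_.partialD, HasFDerivAt.fderiv h]; rfl

end StationaryAt

theorem stationaryAt_of_partialD {u : R4 → ℝ} {p : R4} (hu : DifferentiableAt ℝ u p)
    (h : ∀ i, partialD i u p = 0) : StationaryAt u p := by
  have : fderiv ℝ u p = 0 := by
    apply ContinuousLinearMap.coe_injective
    refine (EuclideanSpace.basisFun (Fin 4) ℝ).toBasis.ext fun i => ?_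
    simpa [_root_.partialD] using h i
  rw [StationaryAt, ← this]
  exact hu.hasFDerivAt

end MatrixFunctions

/-! ### Smoothness of the curvature -/

section Smoothness

variable {G : R4 → Matrix (Fin 4) (Fin 4) ℝ} {p : R4}

theorem contDiffAt_christoffel (hG : ∀ i j, ContDiffAt ℝ ∞ (fun y => G y i j) p)
    (hdet : (G p).det ≠ 0) (i j k : Fin 4) : ContDiffAt ℝ ∞ (christoffel G i j k) p := by
  unfold christoffel
  exact contDiffAt_const.mul (ContDiffAt.sum fun l _ => (ContDiffAt.matrix_inv hG hdet _ _).mul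
    ((((hG _ _).partialD _).add ((hG _ _).partialD _)).sub ((hG _ _).partialD _)))

theorem contDiffAt_curvatureOp (hG : ∀ i j, ContDiffAt ℝ ∞ (fun y => G y i j) p)
    (hdet : (G p).det ≠ 0) (i j k l : Fin 4) : ContDiffAt ℝ ∞ (curvatureOp G i j k l) p := by
  have h := contDiffAt_christoffel hG hdet
  unfold curvatureOp
  exact ((((h _ _ _).partialD _).sub ((h _ _ _).partialD _)).add (ContDiffAt.sum fun m _ =>
    ((h _ _ _).mul (h _ _ _)).sub ((h _ _ _).mul (h _ _ _)))).neg

theorem contDiffAt_curvature (hG : ∀ i j, ContDiffAt ℝ ∞ (fun y => G y i j) p)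
    (hdet : (G p).det ≠ 0) (i j k l : Fin 4) : ContDiffAt ℝ ∞ (curvature G i j k l) p :=
  ContDiffAt.sum fun _ _ => (contDiffAt_curvatureOp hG hdet _ _ _ _).mul (hG _ _)

theorem contDiffAt_ricci (hG : ∀ i j, ContDiffAt ℝ ∞ (fun y => G y i j) p)
    (hdet : (G p).det ≠ 0) (i j : Fin 4) : ContDiffAt ℝ ∞ (ricci G i j) p :=
  ContDiffAt.sum fun _ _ => contDiffAt_curvatureOp hG hdet _ _ _ _

theorem contDiffAt_scalarCurvature (hG : ∀ i j, ContDiffAt ℝ ∞ (fun y => G y i j) p)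
    (hdet : (G p).det ≠ 0) : ContDiffAt ℝ ∞ (scalarCurvature G) p :=
  ContDiffAt.sum fun _ _ => ContDiffAt.sum fun _ _ =>
    (ContDiffAt.matrix_inv hG hdet _ _).mul (contDiffAt_ricci hG hdet _ _)

theorem contDiffAt_weyl (hG : ∀ i j, ContDiffAt ℝ ∞ (fun y => G y i j) p)
    (hdet : (G p).det ≠ 0) (i j k l : Fin 4) : ContDiffAt ℝ ∞ (weyl G i j k l) p := by
  have h := contDiffAt_ricci hG hdet
  exact ((contDiffAt_curvature hG hdet _ _ _ _).add
    (((contDiffAt_scalarCurvature hG hdet).div_const _).mul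
      (((hG _ _).mul (hG _ _)).sub ((hG _ _).mul (hG _ _))))).add (contDiffAt_const.mul
        (((((h _ _).mul (hG _ _)).sub ((h _ _).mul (hG _ _))).add ((h _ _).mul (hG _ _))).sub
          ((h _ _).mul (hG _ _))))

end Smoothness

/-! ### The algebra of curvature tensors in a null frame -/

/-- The matrix of the metric in a null frame `e₀, e₁, e₂, e₃` with
`g(e₀, e₂) = g(e₁, e₃) = 1`. -/
def nullForm : Matrix (Fin 4) (Fin 4) ℝ := !![0, 0, 1, 0; 0, 0, 0, 1; 1, 0, 0, 0; 0, 1, 0, 0]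

/-- The Ricci contraction of a curvature tensor in a null frame. -/
def nullRicci (R : Fin 4 → Fin 4 → Fin 4 → Fin 4 → ℝ) (i j : Fin 4) : ℝ :=
  ∑ k, R i k j (k + 2)

/-- The scalar curvature of a curvature tensor in a null frame. -/
def nullScalar (R : Fin 4 → Fin 4 → Fin 4 → Fin 4 → ℝ) : ℝ :=
  ∑ i, nullRicci R i (i + 2)

/-- The Weyl part of a curvature tensor in a null frame. -/
def nullWeyl (R : Fin 4 → Fin 4 → Fin 4 → Fin 4 → ℝ) (i j k l : Fin 4) : ℝ :=
  R i j k l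
    + nullScalar R / 6 * (nullForm i k * nullForm j l - nullForm i l * nullForm j k)
    + (1 / 2) * (nullRicci R i l * nullForm j k - nullRicci R i k * nullForm j l
      + nullRicci R j k * nullForm i l - nullRicci R j l * nullForm i k)

/-- A tensor, skew in its last two indices, that vanishes on `e₀ ∧ e₃`, `e₁ ∧ e₂` and
`e₀ ∧ e₂ - e₁ ∧ e₃`. -/
structure KillsASD (W : Fin 4 → Fin 4 → Fin 4 → Fin 4 → ℝ) : Prop where
  h03 : ∀ i j, W i j 0 3 = 0
  h12 : ∀ i j, W i j 1 2 = 0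
  h02 : ∀ i j, W i j 0 2 = W i j 1 3

/-- The Cotton tensor built from the derivative of the curvature tensor. -/
def nullCotton (DR : Fin 4 → Fin 4 → Fin 4 → Fin 4 → Fin 4 → ℝ) (m i j : Fin 4) : ℝ :=
  nullRicci (DR m) i j - nullRicci (DR i) m j
    - (1 / 6) * (nullScalar (DR m) * nullForm i j - nullScalar (DR i) * nullForm m j)

theorem nullForm_symm (i j : Fin 4) : nullForm i j = nullForm j i := by
  fin_cases i <;> fin_cases j <;> rfl


/-! ### Contracted Bianchi identities and the divergence of the Weyl tensor -/

section
variable {DR : Fin 4 → Fin 4 → Fin 4 → Fin 4 → Fin 4 → ℝ}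

/-- The dual of e_a in a null frame is e_{a+2}, with addition modulo 4 in `Fin 4`. Raising an index
is therefore the shift by 2, which accounts for every `+ 2` in the contractions. -/
theorem sum_mul_nullForm (f : Fin 4 → ℝ) (m : Fin 4) :
    ∑ a, f (a + 2) * nullForm a m = f m := by
  fin_cases m <;> simp [nullForm, Fin.sum_univ_four]

theorem sum_add_two (f : Fin 4 → ℝ) : ∑ a, f (a + 2) = ∑ a, f a := by
  simp [Fin.sum_univ_four]; ring

theorem add_two_add_two (a : Fin 4) : a + 2 + 2 = a := by
  fin_cases a <;> rfl

/-- The derivative of a curvature tensor: the curvature symmetries and the second Bianchi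
identity. -/
structure IsCurvatureDerivative (DR : Fin 4 → Fin 4 → Fin 4 → Fin 4 → Fin 4 → ℝ) : Prop where
  skew : ∀ m i j k l, DR m i j k l = -DR m j i k l
  pair : ∀ m i j k l, DR m i j k l = DR m k l i j
  bianchi : ∀ m i j k l, DR m i j k l + DR i j m k l + DR j m i k l = 0

namespace IsCurvatureDerivative

theorem skew' (h : IsCurvatureDerivative DR) (m i j k l : Fin 4) :
    DR m i j k l = -DR m i j l k := by
  rw [h.pair m i j k l, h.skew, h.pair m l k i j]

theorem ricci_symm (h : IsCurvatureDerivative DR) (m i j : Fin 4) :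
    nullRicci (DR m) i j = nullRicci (DR m) j i := by
  unfold nullRicci
  rw [← sum_add_two fun k => DR m i k j (k + 2)]
  refine Finset.sum_congr rfl fun k _ => ?_
  rw [add_two_add_two, h.pair]

/-- The second Bianchi identity, contracted once. -/
theorem divergence (h : IsCurvatureDerivative DR) (m i j : Fin 4) :
    ∑ a : Fin 4, DR (a + 2) a j m i = nullRicci (DR m) i j - nullRicci (DR i) m j := by
  unfold nullRicci
  rw [← sum_add_two fun k => DR m i k j (k + 2), ← sum_add_two fun k => DR i m k j (k + 2),
    ← Finset.sum_sub_distrib]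
  refine Finset.sum_congr rfl fun a _ => ?_
  rw [add_two_add_two]
  linarith [h.pair (a + 2) a j m i, h.bianchi (a + 2) m i a j, h.skew' m i (a + 2) a j,
    h.skew i (a + 2) m a j, h.skew' i m (a + 2) a j]

/-- The twice contracted Bianchi identity: `h1` and `h2` evaluate the same double contraction, once
by `divergence` and once by skew symmetry. -/
theorem divergence_ricci (h : IsCurvatureDerivative DR) (i : Fin 4) :
    ∑ a : Fin 4, nullRicci (DR (a + 2)) a i = (1 / 2) * nullScalar (DR i) := by
  have h1 : ∑ j : Fin 4, ∑ a : Fin 4, DR (a + 2) a j (j + 2) i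
      = nullScalar (DR i) * -1 + ∑ j : Fin 4, nullRicci (DR (j + 2)) i j := by
    simp_rw [h.divergence]
    rw [Finset.sum_sub_distrib, nullScalar, ← sum_add_two fun j => nullRicci (DR i) j (j + 2)]
    simp_rw [add_two_add_two]; ring
  have h2 : ∑ j : Fin 4, ∑ a : Fin 4, DR (a + 2) a j (j + 2) i
      = -∑ a : Fin 4, nullRicci (DR (a + 2)) a i := by
    rw [Finset.sum_comm, ← Finset.sum_neg_distrib]
    refine Finset.sum_congr rfl fun a _ => ?_
    unfold nullRicci
    rw [← Finset.sum_neg_distrib]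
    exact Finset.sum_congr rfl fun k _ => h.skew' _ _ _ _ _
  simp_rw [fun m => h.ricci_symm m i] at h1
  linarith

/-- The divergence of the Weyl tensor is a multiple of the Cotton tensor. -/
theorem divergence_weyl (h : IsCurvatureDerivative DR) (m i j : Fin 4) :
    ∑ a : Fin 4, nullWeyl (DR (a + 2)) a j m i = (1 / 2) * nullCotton DR m i j := by
  have e : ∀ a : Fin 4, nullWeyl (DR (a + 2)) a j m i = DR (a + 2) a j m i
      + (nullScalar (DR (a + 2)) * nullForm a m) * (nullForm j i / 6)
      - (nullScalar (DR (a + 2)) * nullForm a i) * (nullForm j m / 6)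
      + nullRicci (DR (a + 2)) a i * (nullForm j m / 2)
      - nullRicci (DR (a + 2)) a m * (nullForm j i / 2)
      + (nullRicci (DR (a + 2)) j m * nullForm a i) * (1 / 2)
      - (nullRicci (DR (a + 2)) j i * nullForm a m) * (1 / 2) := fun a => by
    unfold nullWeyl; ring
  simp only [e, Finset.sum_sub_distrib, Finset.sum_add_distrib, ← Finset.sum_mul]
  rw [h.divergence, h.divergence_ricci, h.divergence_ricci,
    sum_mul_nullForm fun b => nullScalar (DR b), sum_mul_nullForm fun b => nullScalar (DR b),
    sum_mul_nullForm fun b => nullRicci (DR b) j m, sum_mul_nullForm fun b => nullRicci (DR b) j i,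
    nullCotton, h.ricci_symm i m j, h.ricci_symm m i j, nullForm_symm i j, nullForm_symm m j]
  ring

end IsCurvatureDerivative

/-- At the centre of normal coordinates the derivative of the curvature is linear in the third
derivatives `T` of the metric. The symmetry of `T` in its three derivative indices and in its two
metric indices then gives all the identities. -/
theorem isCurvatureDerivative_of_eq {T : Fin 4 → Fin 4 → Fin 4 → Fin 4 → Fin 4 → ℝ}
    (hT₁ : ∀ a b c i j, T a b c i j = T b a c i j)
    (hT₂ : ∀ a b c i j, T a b c i j = T a c b i j)
    (hT₃ : ∀ a b c i j, T a b c i j = T a b c j i)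
    (hDR : ∀ m i j k l, DR m i j k l
      = -(1 / 2) * (T m i k j l - T m i l j k - T m j k i l + T m j l i k)) :
    IsCurvatureDerivative DR where
  skew m i j k l := by
    rw [hDR, hDR]; ring
  pair m i j k l := by
    rw [hDR, hDR, hT₂ m k i, hT₃ m i k l j, hT₂ m k j, hT₂ m l i, hT₂ m l j, hT₃ m i l k j,
      hT₃ m j k l i, hT₃ m j l k i]; ring
  bianchi m i j k l := by
    rw [hDR, hDR, hDR, hT₁ j i k, hT₁ j i l, hT₁ j m k, hT₁ j m l, hT₁ m i k, hT₁ m i l]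
    ring

end

/-! ### The half-flat Cotton tensor and the Hessian of the potential -/

section
variable {R : Fin 4 → Fin 4 → Fin 4 → Fin 4 → ℝ}
  {DR : Fin 4 → Fin 4 → Fin 4 → Fin 4 → Fin 4 → ℝ}

/-- The Cotton tensor of a metric with vanishing anti-self-dual Weyl tensor is self-dual. -/
theorem IsCurvatureDerivative.cotton_selfDual (h : IsCurvatureDerivative DR)
    (hW : ∀ m, KillsASD (nullWeyl (DR m))) (j : Fin 4) :
    nullCotton DR 0 3 j = 0 ∧ nullCotton DR 1 2 j = 0 ∧
      nullCotton DR 0 2 j = nullCotton DR 1 3 j := by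
  refine ⟨?_, ?_, ?_⟩
  -- The divergence contracts the first index, while the vanishing concerns the last pair; each
  -- summand is zero.
  · have := h.divergence_weyl 0 3 j
    rw [Finset.sum_eq_zero fun a _ => (hW _).h03 _ _] at this
    linarith
  · have := h.divergence_weyl 1 2 j
    rw [Finset.sum_eq_zero fun a _ => (hW _).h12 _ _] at this
    linarith
  · have := h.divergence_weyl 0 2 j
    rw [Finset.sum_congr rfl fun a _ => (hW _).h02 _ _, h.divergence_weyl 1 3 j] at this
    linarith

/-- If the gradient `e₀` of the potential is null, then its Hessian vanishes on the null plane
spanned by `e₀` and `e₁`. -/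
theorem hessian_eq_zero_of_quasiEinstein (hpair : ∀ i j k l, R i j k l = R k l i j)
    (hDR : IsCurvatureDerivative DR) (hW : KillsASD (nullWeyl R))
    (hDW : ∀ m, KillsASD (nullWeyl (DR m))) {F : Fin 4 → Fin 4 → ℝ} {c μ : ℝ} {dc : Fin 4 → ℝ}
    (hμ : μ ≠ -1 / 2) (hF : ∀ i j, F i j = F j i) (hF₀ : ∀ j, F 0 j = 0)
    (hQE : ∀ i j, F i j + nullRicci R i j - μ * (nullForm 0 i * nullForm 0 j) = c * nullForm i j)
    (hdQE : ∀ m i j, R m i j 0 + nullRicci (DR m) i j - nullRicci (DR i) m j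
      - μ * (F m j * nullForm 0 i - F i j * nullForm 0 m)
      = dc m * nullForm i j - dc i * nullForm m j) (j : Fin 4) :
    F 1 j = 0 := by
  have hC := hDR.cotton_selfDual hDW
  have W03 : ∀ j, nullWeyl R j 0 0 3 = 0 := fun j => hW.h03 j 0
  have W12 : ∀ j, nullWeyl R j 0 1 2 = 0 := fun j => hW.h12 j 0
  have W02 : ∀ j, nullWeyl R j 0 0 2 = nullWeyl R j 0 1 3 := fun j => hW.h02 j 0
  unfold nullWeyl at W03 W12 W02
  unfold nullCotton at hC
  generalize nullScalar R = τ at *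
  generalize hρ : nullRicci R = ρ at *
  have hρ' : ∀ i j, ρ i j = c * nullForm i j + μ * (nullForm 0 i * nullForm 0 j) - F i j :=
    fun i j => by linarith [hQE i j]
  generalize hDρ : (fun m => nullRicci (DR m)) = Dρ at *
  generalize hDτ : (fun m => nullScalar (DR m)) = Dτ at *
  replace hDρ := fun m => congrFun hDρ m
  replace hDτ := fun m => congrFun hDτ m
  simp only [hDρ, hDτ] at *
  -- The curvature with one argument ∇f, solved from the skew-symmetrized equation. The derivatives
  -- of ρ enter only through a difference that the Cotton tensor controls.
  have skew : ∀ m i j, R j 0 m i = dc m * nullForm i j - dc i * nullForm m j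
      + μ * (F m j * nullForm 0 i - F i j * nullForm 0 m) - (Dρ m i j - Dρ i m j) := fun m i j => by
    linarith [hdQE m i j, hpair m i j 0]
  -- The e₁∧e₂ components of W and C determine F₁₁ and F₁₂ directly. In the equation for F₁₃ the
  -- quantities `dc 2 - Dτ 2 / 6` and `τ / 6 - c` survive; the equality of the (0,2) and (1,3)
  -- components expresses that their combination vanishes.
  have C1 := (hC 1).2.1
  obtain ⟨C2, C2'⟩ := (hC 2).2
  have C3 := (hC 3).2.1
  have S1 := skew 1 2 1
  have S2 := skew 1 2 2
  have S3 := skew 1 2 3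
  have S4 := skew 0 2 2
  have S5 := skew 1 3 2
  have W1 := W12 1
  have W2 := W12 2
  have W3 := W12 3
  have W4 := W02 2
  clear skew hC W03 W12 W02 hW hDW hdQE hQE hDR
  simp only [nullForm, Matrix.of_apply, Matrix.cons_val', Matrix.cons_val, hρ', hF₀, hF _ 0]
    at C1 C2 C2' C3 S1 S2 S3 S4 S5 W1 W2 W3 W4
  -- The term μ comes from the derivative of μ df ⊗ df, the term 1/2 from the Ricci part of the Weyl
  -- tensor, where ρ is replaced by -F plus known terms.
  have key : (μ + 1 / 2) * F 1 j = 0 := by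
    fin_cases j
    · simp [hF 1 0, hF₀]
    · change (μ + 1 / 2) * F 1 1 = 0
      linarith
    · change (μ + 1 / 2) * F 1 2 = 0
      linarith [hF 1 2]
    · change (μ + 1 / 2) * F 1 3 = 0
      linarith [hF 1 3]
  exact (mul_eq_zero.1 key).resolve_left fun h => hμ (by linarith)

end

/-! ### The Hodge star -/


theorem permSymbol_mul_det (i j k l : Fin 4) (h : Matrix (Fin 4) (Fin 4) ℝ) :
    permSymbol i j k l * h.det = (h.submatrix ![i, j, k, l] id).det := by
  rw [permSymbol, ← Matrix.det_mul]
  congr 1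
  ext a b
  simp [Matrix.mul_apply, ite_mul]

/-- `permSymbol_mul_det` applied to the Vandermonde matrix with nodes 0, 1, 2, 3, whose determinant
is 12. The closed form lets the 256 components be evaluated by arithmetic. -/
theorem permSymbol_eq (i j k l : Fin 4) : permSymbol i j k l =
    (((j : ℕ) : ℝ) - (i : ℕ)) * (((k : ℕ) : ℝ) - (i : ℕ)) * (((l : ℕ) : ℝ) - (i : ℕ))
      * (((k : ℕ) : ℝ) - (j : ℕ)) * (((l : ℕ) : ℝ) - (j : ℕ)) * (((l : ℕ) : ℝ) - (k : ℕ)) / 12 := by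
  have h := permSymbol_mul_det i j k l (Matrix.vandermonde fun a : Fin 4 => ((a : ℕ) : ℝ))
  have e : (Matrix.vandermonde fun a : Fin 4 => ((a : ℕ) : ℝ)).submatrix ![i, j, k, l] id
      = Matrix.vandermonde fun a : Fin 4 => (((![i, j, k, l] a : Fin 4) : ℕ) : ℝ) := rfl
  have e₂ : ∀ v : Fin 4 → ℝ, ∏ a : Fin 4, ∏ b ∈ Finset.Ioi a, (v b - v a)
      = (v 1 - v 0) * (v 2 - v 0) * (v 3 - v 0) * (v 2 - v 1) * (v 3 - v 1) * (v 3 - v 2) := by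
    intro v
    rw [Fin.prod_univ_four, show Finset.Ioi (0 : Fin 4) = {1, 2, 3} from by decide,
      show Finset.Ioi (1 : Fin 4) = {2, 3} from by decide,
      show Finset.Ioi (2 : Fin 4) = {3} from by decide,
      show Finset.Ioi (3 : Fin 4) = ∅ from by decide]
    rw [Finset.prod_insert (by decide), Finset.prod_insert (by decide), Finset.prod_singleton,
      Finset.prod_insert (by decide), Finset.prod_singleton, Finset.prod_singleton,
      Finset.prod_empty]
    ring
  rw [e, Matrix.det_vandermonde, Matrix.det_vandermonde, e₂, e₂] at h
  have e₃ : ∀ v : Fin 4 → ℝ, v = ![v 0, v 1, v 2, v 3] := fun v => by ext a; fin_cases a <;> rfl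
  change _ * ((((1 : ℕ) : ℝ) - (0 : ℕ)) * (((2 : ℕ) : ℝ) - (0 : ℕ)) * (((3 : ℕ) : ℝ) - (0 : ℕ))
    * (((2 : ℕ) : ℝ) - (1 : ℕ)) * (((3 : ℕ) : ℝ) - (1 : ℕ)) * (((3 : ℕ) : ℝ) - (2 : ℕ)))
    = (((j : ℕ) : ℝ) - (i : ℕ)) * (((k : ℕ) : ℝ) - (i : ℕ)) * (((l : ℕ) : ℝ) - (i : ℕ))
      * (((k : ℕ) : ℝ) - (j : ℕ)) * (((l : ℕ) : ℝ) - (j : ℕ)) * (((l : ℕ) : ℝ) - (k : ℕ)) at h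
  rw [← h]
  norm_num

theorem det_of_rows (a b c d : Fin 4 → ℝ) : (Matrix.of ![a, b, c, d]).det =
    ∑ i, ∑ j, ∑ k, ∑ l, permSymbol i j k l * (a i * b j * c k * d l) := by
  simp [permSymbol_eq, Matrix.det_succ_row_zero, Fin.succAbove,
    Fin.sum_univ_succ]
  ring

theorem sum_permSymbol (h : Matrix (Fin 4) (Fin 4) ℝ) (i j k l : Fin 4) :
    ∑ a, ∑ b, ∑ c, ∑ d, permSymbol a b c d * (h i a * h j b * h k c * h l d)
      = permSymbol i j k l * h.det := by
  rw [permSymbol_mul_det, ← det_of_rows]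
  congr 1
  ext a b
  fin_cases a <;> rfl

/-- The dual `½ ε_{ijkl} θ_{kl}` of a skew matrix. -/
def skewDual (θ : Matrix (Fin 4) (Fin 4) ℝ) : Matrix (Fin 4) (Fin 4) ℝ :=
  !![0, θ 2 3, -θ 1 3, θ 1 2; -θ 2 3, 0, θ 0 3, -θ 0 2; θ 1 3, -θ 0 3, 0, θ 0 1;
    -θ 1 2, θ 0 2, -θ 0 1, 0]

theorem sum_permSymbol_mul {θ : Matrix (Fin 4) (Fin 4) ℝ} (hθ : θ.transpose = -θ) (i j : Fin 4) :
    ∑ k, ∑ l, permSymbol i j k l * θ k l = 2 * skewDual θ i j := by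
  have h : ∀ a b, θ b a = - θ a b := fun a b => congrFun (congrFun hθ a) b
  fin_cases i <;> fin_cases j <;>
    simp [Fin.sum_univ_four, permSymbol_eq, skewDual] <;> norm_num <;>
    linarith [h 0 1, h 0 2, h 0 3, h 1 2, h 1 3, h 2 3]

theorem skewDual_transpose (θ : Matrix (Fin 4) (Fin 4) ℝ) :
    (skewDual θ).transpose = -skewDual θ := by
  ext i j
  fin_cases i <;> fin_cases j <;> simp [skewDual]

theorem skewDual_skewDual {θ : Matrix (Fin 4) (Fin 4) ℝ} (hθ : θ.transpose = -θ) :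
    skewDual (skewDual θ) = θ := by
  have h : ∀ a b, θ b a = - θ a b := fun a b => congrFun (congrFun hθ a) b
  have h0 : ∀ a, θ a a = 0 := fun a => by linarith [h a a]
  ext i j
  fin_cases i <;> fin_cases j <;> simp [skewDual, h0] <;>
    linarith [h 0 1, h 0 2, h 0 3, h 1 2, h 1 3, h 2 3]

theorem raise_eq (g θ : Matrix (Fin 4) (Fin 4) ℝ) : raise g θ = g⁻¹ * θ * g⁻¹.transpose := by
  ext i j
  simp only [raise, Matrix.mul_apply, Matrix.transpose_apply, Finset.sum_mul]
  rw [Finset.sum_comm]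
  exact Finset.sum_congr rfl fun k _ => Finset.sum_congr rfl fun l _ => by ring

theorem raise_transpose {g θ : Matrix (Fin 4) (Fin 4) ℝ} (hθ : θ.transpose = -θ) :
    (raise g θ).transpose = -raise g θ := by
  simp [raise_eq, Matrix.transpose_mul, hθ, Matrix.mul_assoc]

theorem hodgeStar_eq {s : ℝ} {g θ : Matrix (Fin 4) (Fin 4) ℝ} (hθ : θ.transpose = -θ) :
    hodgeStar s g θ = (s * √|g.det|) • skewDual (raise g θ) := by
  ext i j
  have h := sum_permSymbol_mul (raise_transpose (g := g) hθ) i j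
  simp only [hodgeStar, Matrix.smul_apply, smul_eq_mul, mul_assoc, ← Finset.mul_sum]
  rw [h]; ring

theorem hodgeStar_transpose {s : ℝ} {g θ : Matrix (Fin 4) (Fin 4) ℝ} (hθ : θ.transpose = -θ) :
    (hodgeStar s g θ).transpose = -hodgeStar s g θ := by
  rw [hodgeStar_eq hθ, Matrix.transpose_smul, skewDual_transpose, smul_neg]

theorem sum_comm_four (f : Fin 4 → Fin 4 → Fin 4 → Fin 4 → Fin 4 → ℝ) :
    ∑ a, ∑ b, ∑ c, ∑ d, ∑ e, f a b c d e = ∑ e, ∑ a, ∑ b, ∑ c, ∑ d, f a b c d e :=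
  (Finset.sum_congr rfl fun _ _ => (Finset.sum_congr rfl fun _ _ => (Finset.sum_congr rfl
    fun _ _ => Finset.sum_comm).trans Finset.sum_comm).trans Finset.sum_comm).trans Finset.sum_comm

/-- Contracting ε with four copies of h yields det h times ε. The outer factors h supply two copies,
and conjugating θ supplies the other two. -/
theorem skewDual_conj {θ : Matrix (Fin 4) (Fin 4) ℝ} (hθ : θ.transpose = -θ)
    (h : Matrix (Fin 4) (Fin 4) ℝ) :
    h * skewDual (h.transpose * θ * h) * h.transpose = h.det • skewDual θ := by
  have hθ' : (h.transpose * θ * h).transpose = -(h.transpose * θ * h) := by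
    simp [Matrix.transpose_mul, hθ, Matrix.mul_assoc]
  ext i j
  rw [← mul_right_inj' (two_ne_zero' ℝ), Matrix.smul_apply, smul_eq_mul, mul_left_comm,
    ← sum_permSymbol_mul hθ]
  calc 2 * (h * skewDual (h.transpose * θ * h) * h.transpose) i j
      = ∑ a, ∑ b, h i a * h j b * (2 * skewDual (h.transpose * θ * h) a b) := by
        simp only [Matrix.mul_apply, Matrix.transpose_apply, Finset.sum_mul, Finset.mul_sum]
        rw [Finset.sum_comm]
        exact Finset.sum_congr rfl fun _ _ => Finset.sum_congr rfl fun _ _ => by ring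
    _ = ∑ a, ∑ b, ∑ c, ∑ d, ∑ f, ∑ e,
          permSymbol a b c d * (h i a * h j b * h e c * h f d) * θ e f := by
        simp only [← sum_permSymbol_mul hθ', Matrix.mul_apply, Matrix.transpose_apply,
          Finset.sum_mul, Finset.mul_sum]
        refine Finset.sum_congr rfl fun _ _ => Finset.sum_congr rfl fun _ _ =>
          Finset.sum_congr rfl fun _ _ => Finset.sum_congr rfl fun _ _ =>
          Finset.sum_congr rfl fun _ _ => Finset.sum_congr rfl fun _ _ => by ring
    _ = ∑ f, ∑ e, (∑ a, ∑ b, ∑ c, ∑ d,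
          permSymbol a b c d * (h i a * h j b * h e c * h f d)) * θ e f := by
        rw [sum_comm_four]
        refine Finset.sum_congr rfl fun _ _ => ?_
        rw [sum_comm_four]
        simp only [Finset.sum_mul]
    _ = _ := by
        simp only [sum_permSymbol]
        rw [Finset.sum_comm]
        simp only [Finset.mul_sum]
        exact Finset.sum_congr rfl fun _ _ => Finset.sum_congr rfl fun _ _ => by ring

/-- In neutral signature the Hodge star is an involution on two-forms. -/
theorem hodgeStar_hodgeStar {s : ℝ} (hs : s * s = 1) {g θ : Matrix (Fin 4) (Fin 4) ℝ}
    (hg : g.transpose = g) (hdet : 0 < g.det) (hθ : θ.transpose = -θ) :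
    hodgeStar s g (hodgeStar s g θ) = θ := by
  have hi : g⁻¹.transpose = g⁻¹ := by rw [Matrix.transpose_nonsing_inv, hg]
  have hd : √|g.det| * √|g.det| = g.det := by
    rw [Real.mul_self_sqrt (abs_nonneg _), abs_of_pos hdet]
  rw [hodgeStar_eq (hodgeStar_transpose hθ), raise_eq, hodgeStar_eq hθ, raise_eq]
  have h := skewDual_conj hθ g⁻¹
  rw [hi] at h ⊢
  rw [Matrix.mul_smul, Matrix.smul_mul, h, smul_smul, Matrix.det_nonsing_inv,
    Ring.inverse_eq_inv']
  have e : ∀ (c : ℝ) (θ : Matrix (Fin 4) (Fin 4) ℝ), skewDual (c • θ) = c • skewDual θ := by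
    intro c θ
    ext i j
    fin_cases i <;> fin_cases j <;> simp [skewDual]
  rw [e, smul_smul, skewDual_skewDual hθ]
  -- The sign of the determinant decides the sign of ⋆⋆; with a negative determinant this product
  -- would be -1.
  have : s * √|g.det| * (s * √|g.det| * g.det⁻¹) = 1 := by
    calc _ = (s * s) * (√|g.det| * √|g.det|) * g.det⁻¹ := by ring
    _ = 1 := by rw [hs, hd, one_mul, mul_inv_cancel₀ hdet.ne']
  rw [this, one_smul]

/-! ### Curvature in normal coordinates -/

/-- The common properties of evaluation at `p` and of a partial derivative at `p` that are needed
to compute in normal coordinates. -/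
structure IsJetFunctional (p : R4) (δ : (R4 → ℝ) → ℝ) : Prop where
  add : ∀ {u v}, ContDiffAt ℝ ∞ u p → ContDiffAt ℝ ∞ v p → δ (fun y => u y + v y) = δ u + δ v
  mul : ∀ {a u}, StationaryAt a p → ContDiffAt ℝ ∞ a p → ContDiffAt ℝ ∞ u p →
    δ (fun y => a y * u y) = a p * δ u
  mul_eq_zero : ∀ {u v}, ContDiffAt ℝ ∞ u p → ContDiffAt ℝ ∞ v p → u p = 0 → v p = 0 →
    δ (fun y => u y * v y) = 0
  congr : ∀ {u v}, u =ᶠ[𝓝 p] v → δ u = δ v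

theorem isJetFunctional_eval (p : R4) : IsJetFunctional p fun u => u p where
  add _ _ := rfl
  mul _ _ _ := rfl
  mul_eq_zero _ _ h _ := by simp [h]
  congr h := h.eq_of_nhds

theorem isJetFunctional_partialD (p : R4) (m : Fin 4) : IsJetFunctional p (partialD m · p) where
  add hu hv := partialD_add hu.differentiableAt_infty hv.differentiableAt_infty m
  mul ha ha' hu := by
    rw [partialD_mul ha'.differentiableAt_infty hu.differentiableAt_infty, ha.partialD]; ring
  mul_eq_zero hu hv h h' := by
    rw [partialD_mul hu.differentiableAt_infty hv.differentiableAt_infty, h, h']; ring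
  congr h := h.partialD_eq m

namespace IsJetFunctional

variable {p : R4} {δ : (R4 → ℝ) → ℝ} (hδ : IsJetFunctional p δ)
include hδ

theorem const_mul {u : R4 → ℝ} (c : ℝ) (hu : ContDiffAt ℝ ∞ u p) :
    δ (fun y => c * u y) = c * δ u :=
  hδ.mul (StationaryAt.const c) contDiffAt_const hu

theorem neg {u : R4 → ℝ} (hu : ContDiffAt ℝ ∞ u p) : δ (fun y => -u y) = -δ u := by
  simpa using hδ.const_mul (-1) hu

theorem sub {u v : R4 → ℝ} (hu : ContDiffAt ℝ ∞ u p) (hv : ContDiffAt ℝ ∞ v p) :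
    δ (fun y => u y - v y) = δ u - δ v := by
  simp_rw [sub_eq_add_neg]
  rw [hδ.add hu hv.neg, hδ.neg hv]

theorem zero : δ (fun _ => 0) = 0 := by
  simpa using hδ.const_mul (u := fun _ => 0) 0 contDiffAt_const

theorem sum {ι : Type*} (s : Finset ι) {w : ι → R4 → ℝ} (hw : ∀ k, ContDiffAt ℝ ∞ (w k) p) :
    δ (fun y => ∑ k ∈ s, w k y) = ∑ k ∈ s, δ (w k) := by
  classical
  induction s using Finset.induction_on with
  | empty => simpa using hδ.zero
  | insert a s ha ih =>
    simp_rw [Finset.sum_insert ha]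
    rw [hδ.add (hw a) (ContDiffAt.sum fun k _ => hw k), ih]

/-- The remaining term u ∂_i a is a product of two functions that both vanish at p, which δ
annihilates. -/
theorem partialD_mul {a u : R4 → ℝ} (ha : StationaryAt a p) (ha' : ContDiffAt ℝ ∞ a p)
    (hu : ContDiffAt ℝ ∞ u p) (hu₀ : u p = 0) (i : Fin 4) :
    δ (partialD i fun y => a y * u y) = a p * δ (partialD i u) := by
  have e : partialD i (fun y => a y * u y) =ᶠ[𝓝 p]
      fun y => a y * partialD i u y + u y * partialD i a y := by
    filter_upwards [ha'.eventually_differentiableAt, hu.eventually_differentiableAt] with y h h'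
      using _root_.partialD_mul h h' i
  rw [hδ.congr e, hδ.add (ha'.mul (hu.partialD i)) (hu.mul (ha'.partialD i)),
    hδ.mul ha ha' (hu.partialD i), hδ.mul_eq_zero hu (ha'.partialD i) hu₀ (ha.partialD i), add_zero]

theorem partialD_add {u v : R4 → ℝ} (hu : ContDiffAt ℝ ∞ u p)
    (hv : ContDiffAt ℝ ∞ v p) (i : Fin 4) :
    δ (partialD i fun y => u y + v y) = δ (partialD i u) + δ (partialD i v) := by
  have e : partialD i (fun y => u y + v y) =ᶠ[𝓝 p] fun y => partialD i u y + partialD i v y := by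
    filter_upwards [hu.eventually_differentiableAt, hv.eventually_differentiableAt] with y h h'
      using _root_.partialD_add h h' i
  rw [hδ.congr e, hδ.add (hu.partialD i) (hv.partialD i)]

theorem partialD_sub {u v : R4 → ℝ} (hu : ContDiffAt ℝ ∞ u p)
    (hv : ContDiffAt ℝ ∞ v p) (i : Fin 4) :
    δ (partialD i fun y => u y - v y) = δ (partialD i u) - δ (partialD i v) := by
  have e : partialD i (fun y => u y - v y) =ᶠ[𝓝 p] fun y => partialD i u y - partialD i v y := by
    filter_upwards [hu.eventually_differentiableAt, hv.eventually_differentiableAt] with y h h'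
      using _root_.partialD_sub h h' i
  rw [hδ.congr e, hδ.sub (hu.partialD i) (hv.partialD i)]

theorem partialD_sum {ι : Type*} (s : Finset ι) {w : ι → R4 → ℝ}
    (hw : ∀ k, ContDiffAt ℝ ∞ (w k) p) (i : Fin 4) :
    δ (partialD i fun y => ∑ k ∈ s, w k y) = ∑ k ∈ s, δ (partialD i (w k)) := by
  have e : partialD i (fun y => ∑ k ∈ s, w k y) =ᶠ[𝓝 p] fun y => ∑ k ∈ s, partialD i (w k) y := by
    filter_upwards [(s.eventually_all (l := 𝓝 p)
      (p := fun k y => DifferentiableAt ℝ (w k) y)).2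
      fun k _ => (hw k).eventually_differentiableAt] with y h
      using _root_.partialD_sum s h i
  rw [hδ.congr e, hδ.sum s fun k => (hw k).partialD i]

end IsJetFunctional

theorem sum_nullForm_mul (f : Fin 4 → ℝ) (k : Fin 4) : ∑ l, nullForm k l * f l = f (k + 2) := by
  fin_cases k <;> simp [nullForm, Fin.sum_univ_four]

theorem nullForm_mul_nullForm : nullForm * nullForm = 1 := by
  ext i j
  fin_cases i <;> fin_cases j <;> simp [nullForm, Matrix.mul_apply, Fin.sum_univ_four]

theorem nullForm_inv : nullForm⁻¹ = nullForm :=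
  Matrix.inv_eq_right_inv nullForm_mul_nullForm

theorem det_nullForm : nullForm.det = 1 := by
  simp [nullForm, Matrix.det_succ_row_zero, Fin.sum_univ_succ, Fin.succAbove]

/-- `G` is the component matrix of a metric in coordinates that are normal at `p` with respect to a
null frame. -/
structure IsNullNormalAt (G : R4 → Matrix (Fin 4) (Fin 4) ℝ) (p : R4) : Prop where
  smooth : ∀ i j, ContDiffAt ℝ ∞ (fun y => G y i j) p
  symm : ∀ᶠ y in 𝓝 p, (G y).transpose = G y
  eq : G p = nullForm
  stationary : ∀ i j, StationaryAt (fun y => G y i j) p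

namespace IsNullNormalAt

variable {G : R4 → Matrix (Fin 4) (Fin 4) ℝ} {p : R4} (hG : IsNullNormalAt G p)
include hG

theorem det_ne_zero : (G p).det ≠ 0 := by simp [hG.eq, det_nullForm]

theorem smooth_inv (i j : Fin 4) : ContDiffAt ℝ ∞ (fun y => (G y)⁻¹ i j) p :=
  ContDiffAt.matrix_inv hG.smooth hG.det_ne_zero i j

theorem stationary_inv (i j : Fin 4) : StationaryAt (fun y => (G y)⁻¹ i j) p :=
  StationaryAt.inv hG.stationary hG.det_ne_zero i j

theorem inv_eq : (G p)⁻¹ = nullForm := by rw [hG.eq, nullForm_inv]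

theorem partialD_symm {δ : (R4 → ℝ) → ℝ} (hδ : IsJetFunctional p δ) (a b i j : Fin 4) :
    δ (partialD a (partialD b fun y => G y i j))
      = δ (partialD a (partialD b fun y => G y j i)) := by
  refine hδ.congr (EventuallyEq.partialD (EventuallyEq.partialD ?_ b) a)
  filter_upwards [hG.symm] with y h
  exact congrFun (congrFun h j) i

theorem partialD_comm {δ : (R4 → ℝ) → ℝ} (hδ : IsJetFunctional p δ) (a b i j : Fin 4) :
    δ (partialD a (partialD b fun y => G y i j)) = δ (partialD b (partialD a fun y => G y i j)) :=
  hδ.congr ((hG.smooth i j).partialD_comm_eventuallyEq a b)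

theorem christoffel_eq_zero (i j k : Fin 4) : christoffel G i j k p = 0 := by
  simp [christoffel, (hG.stationary _ _).partialD]

variable {δ : (R4 → ℝ) → ℝ} (hδ : IsJetFunctional p δ)
include hδ

/-- The inverse metric is stationary at p and the bracket of first derivatives vanishes there, so
the inverse metric comes out of δ ∂_a as the constant null form, that is, as an index shift. -/
theorem jet_partialD_christoffel (a i j k : Fin 4) :
    δ (partialD a (christoffel G i j k)) = (1 / 2) *
      (δ (partialD a (partialD i fun y => G y j (k + 2)))
        + δ (partialD a (partialD j fun y => G y i (k + 2)))
        - δ (partialD a (partialD (k + 2) fun y => G y i j))) := by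
  have hs := hG.smooth
  unfold christoffel
  have h1 : ∀ l, ContDiffAt ℝ ∞ (fun x => partialD i (fun y => G y j l) x
      + partialD j (fun y => G y i l) x - partialD l (fun y => G y i j) x) p := fun l =>
    (((hs _ _).partialD _).add ((hs _ _).partialD _)).sub ((hs _ _).partialD _)
  rw [hδ.partialD_mul (StationaryAt.const _) contDiffAt_const
    (ContDiffAt.sum fun l _ => (hG.smooth_inv k l).mul (h1 l))
    (by simp [(hG.stationary _ _).partialD]),
    hδ.partialD_sum _ fun l => (hG.smooth_inv k l).mul (h1 l)]
  simp_rw [fun l => hδ.partialD_mul (hG.stationary_inv k l) (hG.smooth_inv k l) (h1 l)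
    (by simp [(hG.stationary _ _).partialD]) a, hG.inv_eq]
  rw [sum_nullForm_mul, hδ.partialD_sub (((hs _ _).partialD _).add ((hs _ _).partialD _))
    ((hs _ _).partialD _), hδ.partialD_add ((hs _ _).partialD _) ((hs _ _).partialD _)]

/-- The Christoffel symbols vanish at p, so their products contribute neither to the value nor to
the first derivative at p. -/
theorem jet_curvatureOp (i j k l : Fin 4) :
    δ (curvatureOp G i j k l) =
      -(δ (partialD i (christoffel G j k l)) - δ (partialD j (christoffel G i k l))) := by
  have h := contDiffAt_christoffel hG.smooth hG.det_ne_zero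
  have h0 := hG.christoffel_eq_zero
  unfold curvatureOp
  have h1 : ∀ m, ContDiffAt ℝ ∞ (fun x => christoffel G j k m x * christoffel G i m l x
      - christoffel G i k m x * christoffel G j m l x) p := fun m =>
    ((h _ _ _).mul (h _ _ _)).sub ((h _ _ _).mul (h _ _ _))
  rw [hδ.neg, hδ.add, hδ.sub, hδ.sum]
  · rw [Finset.sum_eq_zero, add_zero]
    intro m _
    rw [hδ.sub ((h _ _ _).mul (h _ _ _)) ((h _ _ _).mul (h _ _ _)),
      hδ.mul_eq_zero (h _ _ _) (h _ _ _) (h0 _ _ _) (h0 _ _ _),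
      hδ.mul_eq_zero (h _ _ _) (h _ _ _) (h0 _ _ _) (h0 _ _ _), sub_zero]
  · exact h1
  · exact (h _ _ _).partialD _
  · exact (h _ _ _).partialD _
  · exact ((h _ _ _).partialD _).sub ((h _ _ _).partialD _)
  · exact ContDiffAt.sum fun m _ => h1 m
  · exact (((h _ _ _).partialD _).sub ((h _ _ _).partialD _)).add (ContDiffAt.sum fun m _ => h1 m)

theorem jet_curvature' (i j k l : Fin 4) :
    δ (curvature G i j k l) = δ (curvatureOp G i j k (l + 2)) := by
  have h := contDiffAt_curvatureOp hG.smooth hG.det_ne_zero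
  unfold curvature
  rw [hδ.sum _ fun m => (h _ _ _ _).mul (hG.smooth _ _)]
  simp_rw [mul_comm (curvatureOp G _ _ _ _ _),
    fun m => hδ.mul (hG.stationary m l) (hG.smooth m l) (h i j k m), hG.eq]
  rw [← sum_nullForm_mul fun m => δ (curvatureOp G i j k m)]
  exact Finset.sum_congr rfl fun m _ => by rw [nullForm_symm]

/-- With δ the evaluation this is the curvature at p in second derivatives of the metric. With δ =
∂_m it is the covariant derivative of the curvature at p, in third derivatives. -/
theorem jet_curvature (i j k l : Fin 4) :
    δ (curvature G i j k l) = -(1 / 2) *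
      (δ (partialD i (partialD k fun y => G y j l)) - δ (partialD i (partialD l fun y => G y j k))
        - δ (partialD j (partialD k fun y => G y i l))
        + δ (partialD j (partialD l fun y => G y i k))) := by
  rw [hG.jet_curvature' hδ, hG.jet_curvatureOp hδ, hG.jet_partialD_christoffel hδ,
    hG.jet_partialD_christoffel hδ, add_two_add_two, hG.partialD_comm hδ j i k l]
  ring

theorem jet_ricci (i j : Fin 4) :
    δ (ricci G i j) = nullRicci (fun i j k l => δ (curvature G i j k l)) i j := by
  unfold ricci
  rw [hδ.sum _ fun m => contDiffAt_curvatureOp hG.smooth hG.det_ne_zero _ _ _ _]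
  unfold nullRicci
  exact Finset.sum_congr rfl fun k _ =>
    ((hG.jet_curvature' hδ i k j (k + 2)).trans (by rw [add_two_add_two])).symm

theorem jet_scalarCurvature :
    δ (scalarCurvature G) = nullScalar (fun i j k l => δ (curvature G i j k l)) := by
  have h := contDiffAt_ricci hG.smooth hG.det_ne_zero
  unfold scalarCurvature nullScalar
  rw [hδ.sum _ fun i => ContDiffAt.sum fun j _ => (hG.smooth_inv i j).mul (h _ _)]
  refine Finset.sum_congr rfl fun i _ => ?_
  rw [hδ.sum _ fun j => (hG.smooth_inv i j).mul (h _ _)]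
  simp_rw [fun j => hδ.mul (hG.stationary_inv i j) (hG.smooth_inv i j) (h i j), hG.inv_eq]
  rw [sum_nullForm_mul, hG.jet_ricci hδ]

/-- Reduces both W and ∇W at p to the algebra of null frames. -/
theorem jet_weyl (i j k l : Fin 4) :
    δ (weyl G i j k l) = nullWeyl (fun i j k l => δ (curvature G i j k l)) i j k l := by
  have h := contDiffAt_ricci hG.smooth hG.det_ne_zero
  have hS := contDiffAt_scalarCurvature hG.smooth hG.det_ne_zero
  have hR := contDiffAt_curvature hG.smooth hG.det_ne_zero
  have hs := hG.smooth
  have key : ∀ {u : R4 → ℝ} (_ : ContDiffAt ℝ ∞ u p) (a b : Fin 4),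
      δ (fun x => u x * G x a b) = δ u * nullForm a b := fun hu a b => by
    simp_rw [mul_comm _ (G _ a b)]
    rw [hδ.mul (hG.stationary _ _) (hs _ _) hu, hG.eq, mul_comm]
  have e : weyl G i j k l = fun x => curvature G i j k l x
      + (1 / 6) * (scalarCurvature G x * G x i k * G x j l)
      - (1 / 6) * (scalarCurvature G x * G x i l * G x j k)
      + (1 / 2) * (ricci G i l x * G x j k - ricci G i k x * G x j l
      + ricci G j k x * G x i l - ricci G j l x * G x i k) := by
    funext x; unfold weyl; ring
  have m : ∀ a b c d, ContDiffAt ℝ ∞ (fun x => ricci G a b x * G x c d) p := fun a b c d =>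
    (h a b).mul (hs c d)
  have n : ∀ a b c d, ContDiffAt ℝ ∞ (fun x => scalarCurvature G x * G x a b * G x c d) p :=
    fun a b c d => (hS.mul (hs a b)).mul (hs c d)
  rw [e, hδ.add, hδ.sub, hδ.add, hδ.const_mul, hδ.const_mul, hδ.const_mul, hδ.sub, hδ.add, hδ.sub,
    key (h _ _), key (h _ _), key (h _ _), key (h _ _), key (hS.mul (hs _ _)),
    key (hS.mul (hs _ _)), key hS, key hS, hG.jet_scalarCurvature hδ, hG.jet_ricci hδ,
    hG.jet_ricci hδ, hG.jet_ricci hδ, hG.jet_ricci hδ]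
  · unfold nullWeyl; ring
  all_goals first
    | exact m _ _ _ _
    | exact n _ _ _ _
    | exact hR _ _ _ _
    | exact (m _ _ _ _).sub (m _ _ _ _)
    | exact ((m _ _ _ _).sub (m _ _ _ _)).add (m _ _ _ _)
    | exact (((m _ _ _ _).sub (m _ _ _ _)).add (m _ _ _ _)).sub (m _ _ _ _)
    | exact contDiffAt_const.mul (n _ _ _ _)
    | exact (hR _ _ _ _).add (contDiffAt_const.mul (n _ _ _ _))
    | exact ((hR _ _ _ _).add (contDiffAt_const.mul (n _ _ _ _))).sub
        (contDiffAt_const.mul (n _ _ _ _))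
    | exact contDiffAt_const.mul ((((m _ _ _ _).sub (m _ _ _ _)).add (m _ _ _ _)).sub
        (m _ _ _ _))

end IsNullNormalAt

/-! ### Half conformally flat metrics in normal coordinates -/

theorem nullWeyl_skew' {R : Fin 4 → Fin 4 → Fin 4 → Fin 4 → ℝ}
    (hR : ∀ i j k l, R i j k l = -R i j l k) (i j k l : Fin 4) :
    nullWeyl R i j k l = -nullWeyl R i j l k := by
  unfold nullWeyl
  rw [hR i j k l]; ring

theorem hodgeStar_add_smul (s : ℝ) (g θ θ' : Matrix (Fin 4) (Fin 4) ℝ) (a b : ℝ) :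
    hodgeStar s g (a • θ + b • θ') = a • hodgeStar s g θ + b • hodgeStar s g θ' := by
  ext i j
  simp only [hodgeStar, raise, Matrix.add_apply, Matrix.smul_apply, smul_eq_mul, mul_add,
    Finset.sum_add_distrib, Finset.mul_sum]
  congr 1 <;>
  exact Finset.sum_congr rfl fun _ _ => Finset.sum_congr rfl fun _ _ =>
    Finset.sum_congr rfl fun _ _ => Finset.sum_congr rfl fun _ _ => by ring

namespace IsNullNormalAt

variable {G : R4 → Matrix (Fin 4) (Fin 4) ℝ} {p : R4} (hG : IsNullNormalAt G p)
include hG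

theorem smooth_raise {θ : R4 → Matrix (Fin 4) (Fin 4) ℝ}
    (hθ : ∀ i j, ContDiffAt ℝ ∞ (fun x => θ x i j) p) (i j : Fin 4) :
    ContDiffAt ℝ ∞ (fun x => raise (G x) (θ x) i j) p :=
  ContDiffAt.sum fun _ _ => ContDiffAt.sum fun _ _ =>
    ((hG.smooth_inv _ _).mul (hG.smooth_inv _ _)).mul (hθ _ _)

theorem stationary_raise {θ : R4 → Matrix (Fin 4) (Fin 4) ℝ}
    (hθ : ∀ i j, StationaryAt (fun x => θ x i j) p) (i j : Fin 4) :
    StationaryAt (fun x => raise (G x) (θ x) i j) p :=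
  StationaryAt.sum fun _ _ => StationaryAt.sum fun _ _ =>
    ((hG.stationary_inv _ _).mul (hG.stationary_inv _ _)).mul (hθ _ _)

theorem smooth_hodgeStar (s : ℝ) (θ : Matrix (Fin 4) (Fin 4) ℝ) (i j : Fin 4) :
    ContDiffAt ℝ ∞ (fun x => hodgeStar s (G x) θ i j) p := by
  have hd : ContDiffAt ℝ ∞ (fun x => √|(G x).det|) p :=
    ContDiffAt.sqrt (f := fun x => |(G x).det|)
      (ContDiffAt.comp (f := fun x => (G x).det) (g := abs) p (contDiffAt_abs hG.det_ne_zero)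
        (ContDiffAt.matrix_det hG.smooth))
      (abs_ne_zero.2 hG.det_ne_zero)
  exact contDiffAt_const.mul (ContDiffAt.sum fun _ _ => ContDiffAt.sum fun _ _ =>
    ((contDiffAt_const.mul hd).mul contDiffAt_const).mul
      (hG.smooth_raise (θ := fun _ => θ) (fun _ _ => contDiffAt_const) _ _))

theorem stationary_hodgeStar (s : ℝ) (θ : Matrix (Fin 4) (Fin 4) ℝ) (i j : Fin 4) :
    StationaryAt (fun x => hodgeStar s (G x) θ i j) p := by
  have hd : StationaryAt (fun x => √|(G x).det|) p :=
    StationaryAt.comp (φ := fun t => √|t|) (u := fun x => (G x).det)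
      ((differentiableAt_abs hG.det_ne_zero).sqrt (abs_ne_zero.2 hG.det_ne_zero))
      (StationaryAt.det hG.stationary)
  exact (StationaryAt.const _).mul (StationaryAt.sum fun _ _ => StationaryAt.sum fun _ _ =>
    (((StationaryAt.const _).mul hd).mul (StationaryAt.const _)).mul
      (hG.stationary_raise (θ := fun _ => θ) (fun _ _ => StationaryAt.const _) _ _))

theorem eventually_det_pos : ∀ᶠ x in 𝓝 p, 0 < (G x).det :=
  (ContDiffAt.matrix_det hG.smooth).continuousAt.eventually
    (lt_mem_nhds (by simp [hG.eq, det_nullForm]))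

variable {δ : (R4 → ℝ) → ℝ} (hδ : IsJetFunctional p δ)
include hδ

/-- The eigenspaces of the Hodge star vary with the point, so a fixed θ cannot simply be inserted
before differentiating. It is extended to a field of eigenforms that is stationary at p and hence
passes through δ unchanged. -/
theorem jet_weylOp {s κ : ℝ} (hs : s * s = 1) (hκ : κ * κ = 1)
    (hW : ∀ᶠ x in 𝓝 p, ∀ θ : Matrix (Fin 4) (Fin 4) ℝ, θ.transpose = -θ →
      hodgeStar s (G x) θ = κ • θ → weylOp G x θ = 0)
    {θ : Matrix (Fin 4) (Fin 4) ℝ} (hθ : θ.transpose = -θ)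
    (hθ' : hodgeStar s nullForm θ = κ • θ) (i j : Fin 4) :
    ∑ k, ∑ l, θ (k + 2) (l + 2) * nullWeyl (fun i j k l => δ (curvature G i j k l)) i j k l
      = 0 := by
  -- The projection ½(1 + κ⋆) onto the κ-eigenforms at x, applied to the constant form θ. It is a
  -- projection onto them because ⋆⋆ = 1 and κ² = 1.
  let Θ : R4 → Matrix (Fin 4) (Fin 4) ℝ := fun x =>
    Matrix.of fun a b => (1 / 2) * (θ a b + κ * hodgeStar s (G x) θ a b)
  have Θsmooth : ∀ a b, ContDiffAt ℝ ∞ (fun x => Θ x a b) p := fun a b =>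
    contDiffAt_const.mul (contDiffAt_const.add (contDiffAt_const.mul (hG.smooth_hodgeStar s θ a b)))
  have Θstat : ∀ a b, StationaryAt (fun x => Θ x a b) p := fun a b =>
    (StationaryAt.const _).mul ((StationaryAt.const _).add
      ((StationaryAt.const _).mul (hG.stationary_hodgeStar s θ a b)))
  have Θeq : ∀ x, Θ x = (1 / 2 : ℝ) • (θ + κ • hodgeStar s (G x) θ) := fun x => rfl
  have Θp : Θ p = θ := by
    rw [Θeq, hG.eq, hθ', smul_smul, hκ, one_smul, ← two_smul ℝ θ, smul_smul]
    norm_num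
  have Θskew : ∀ x, (Θ x).transpose = -Θ x := fun x => by
    rw [Θeq, Matrix.transpose_smul, Matrix.transpose_add, Matrix.transpose_smul,
      hodgeStar_transpose hθ, hθ, smul_neg, ← neg_add, smul_neg]
  have hz : (fun x => weylOp G x (Θ x) i j) =ᶠ[𝓝 p] fun _ => 0 := by
    filter_upwards [hW, hG.eventually_det_pos, hG.symm] with x hx hdet hsym
    rw [hx (Θ x) (Θskew x), Matrix.zero_apply]
    have hlin : hodgeStar s (G x) (Θ x)
        = (1 / 2 : ℝ) • (hodgeStar s (G x) θ + κ • hodgeStar s (G x) (hodgeStar s (G x) θ)) := by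
      rw [Θeq, smul_add, smul_smul, hodgeStar_add_smul, smul_add, smul_smul]
    rw [hlin, hodgeStar_hodgeStar hs hsym hdet hθ, Θeq, smul_comm κ, smul_add κ, smul_smul κ κ, hκ,
      one_smul, add_comm]
  have hw := hδ.congr hz
  rw [hδ.zero] at hw
  have hterm : ∀ k l, ContDiffAt ℝ ∞ (fun x => weyl G i j k l x * raise (G x) (Θ x) k l) p :=
    fun k l => (contDiffAt_weyl hG.smooth hG.det_ne_zero i j k l).mul (hG.smooth_raise Θsmooth k l)
  unfold weylOp at hw
  rw [hδ.const_mul _ (ContDiffAt.sum fun k _ => ContDiffAt.sum fun l _ => hterm k l),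
    hδ.sum _ fun k => ContDiffAt.sum fun l _ => hterm k l] at hw
  simp_rw [fun k => hδ.sum Finset.univ (hterm k), mul_comm (weyl G _ _ _ _ _),
    fun k l => hδ.mul (hG.stationary_raise Θstat k l) (hG.smooth_raise Θsmooth k l)
      (contDiffAt_weyl hG.smooth hG.det_ne_zero i j k l), hG.jet_weyl hδ, Θp, hG.eq] at hw
  have hr : ∀ k l, raise nullForm θ k l = θ (k + 2) (l + 2) := fun k l => by
    simp only [raise, nullForm_inv, mul_assoc, ← Finset.mul_sum]
    rw [sum_nullForm_mul fun a => ∑ b, nullForm l b * θ a b, sum_nullForm_mul]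
  simp_rw [hr] at hw
  linarith

/-- When the frame has orientation sign -κ, the κ-eigenforms of the star of `nullForm` are, after
raising indices, spanned by e₀∧e₃, e₁∧e₂ and e₀∧e₂ - e₁∧e₃. This relation between s and κ decides
which of the two null planes through ∇f is used. -/
theorem killsASD {s κ : ℝ} (hs : s * s = 1) (hκ : s = -κ)
    (hW : ∀ᶠ x in 𝓝 p, ∀ θ : Matrix (Fin 4) (Fin 4) ℝ, θ.transpose = -θ →
      hodgeStar s (G x) θ = κ • θ → weylOp G x θ = 0) :
    KillsASD (nullWeyl fun i j k l => δ (curvature G i j k l)) := by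
  obtain rfl : κ = -s := by linarith
  have key := @jet_weylOp G p hG δ hδ s (-s) hs (by linarith) hW
  have hsk : ∀ i j k l, nullWeyl (fun i j k l => δ (curvature G i j k l)) i j k l
      = -nullWeyl (fun i j k l => δ (curvature G i j k l)) i j l k :=
    nullWeyl_skew' fun i j k l => by rw [hG.jet_curvature hδ, hG.jet_curvature hδ]; ring
  generalize nullWeyl (fun i j k l => δ (curvature G i j k l)) = W at key hsk
  -- The general κ-eigenform. Raising shifts indices by 2, so that a yields the condition on e₁∧e₂
  -- and b the condition on e₀∧e₃.
  have star : ∀ a b c : ℝ, hodgeStar s nullForm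
      !![0, 0, c, a; 0, 0, b, -c; -c, -b, 0, 0; -a, c, 0, 0]
      = (-s) • !![0, 0, c, a; 0, 0, b, -c; -c, -b, 0, 0; -a, c, 0, 0] := by
    intro a b c
    rw [hodgeStar_eq (by ext i j; fin_cases i <;> fin_cases j <;> simp), det_nullForm, raise_eq,
      nullForm_inv]
    ext i j
    fin_cases i <;> fin_cases j <;>
      simp [skewDual, nullForm, Matrix.mul_apply, Fin.sum_univ_four]
  have key' : ∀ a b c : ℝ, ∀ i j, _ := fun a b c => key
    (θ := !![0, 0, c, a; 0, 0, b, -c; -c, -b, 0, 0; -a, c, 0, 0])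
    (by ext i j; fin_cases i <;> fin_cases j <;> simp) (star a b c)
  refine ⟨fun i j => ?_, fun i j => ?_, fun i j => ?_⟩
  · have := key' 0 1 0 i j
    simp [Fin.sum_univ_four] at this
    linarith [hsk i j 0 3]
  · have := key' 1 0 0 i j
    simp [Fin.sum_univ_four] at this
    linarith [hsk i j 1 2]
  · have := key' 0 0 1 i j
    simp [Fin.sum_univ_four] at this
    linarith [hsk i j 0 2, hsk i j 1 3]

end IsNullNormalAt

/-! ### The quasi-Einstein equation at the centre of normal coordinates -/

namespace IsNullNormalAt

variable {G : R4 → Matrix (Fin 4) (Fin 4) ℝ} {p : R4} (hG : IsNullNormalAt G p)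
include hG

theorem isCurvatureDerivative :
    IsCurvatureDerivative fun m i j k l => partialD m (curvature G i j k l) p := by
  refine isCurvatureDerivative_of_eq
    (T := fun a b c i j => partialD a (partialD b (partialD c fun y => G y i j)) p)
    (fun a b c i j => ?_) (fun a b c i j => ?_) (fun a b c i j => ?_)
    fun m i j k l => hG.jet_curvature (isJetFunctional_partialD p m) i j k l
  · exact _root_.partialD_comm ((hG.smooth i j).partialD c).contDiffAt_two a b
  · exact hG.partialD_comm (isJetFunctional_partialD p a) b c i j
  · exact hG.partialD_symm (isJetFunctional_partialD p a) b c i j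

theorem curvature_pair (i j k l : Fin 4) : curvature G i j k l p = curvature G k l i j p := by
  have h := isJetFunctional_eval p
  have hc := hG.partialD_comm h
  have hs := hG.partialD_symm h
  have e := fun i j k l => hG.jet_curvature h i j k l
  rw [e, e, hc i k, hs k i j l, hc i l, hs l i j k, hc j k, hs k j i l, hc j l, hs l j i k]
  ring

/-- The derivative of g(∇f, ∇f) = 0 is 2 Hes_f(∇f, ·) = 0. The inverse metric is stationary at p, so
only the derivatives of dF contribute. -/
theorem partialD_zero_partialD {F : R4 → ℝ} (hF : ContDiffAt ℝ ∞ F p)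
    (hFp : ∀ j, partialD j F p = nullForm 0 j)
    (hnull : ∀ᶠ x in 𝓝 p, ∑ i, ∑ j, (G x)⁻¹ i j * (partialD i F x * partialD j F x) = 0)
    (m : Fin 4) : partialD m (partialD 0 F) p = 0 := by
  have hδ := isJetFunctional_partialD p m
  have hp : ∀ i j, ContDiffAt ℝ ∞ (fun x => partialD i F x * partialD j F x) p :=
    fun i j => (hF.partialD i).mul (hF.partialD j)
  have hm : ∀ i j, ContDiffAt ℝ ∞ (fun x => (G x)⁻¹ i j * (partialD i F x * partialD j F x)) p :=
    fun i j => (hG.smooth_inv i j).mul (hp i j)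
  have h := hδ.congr hnull
  rw [hδ.zero, hδ.sum _ fun i => ContDiffAt.sum fun j _ => hm i j] at h
  simp_rw [fun i => hδ.sum Finset.univ (hm i), fun i j => hδ.mul (hG.stationary_inv i j)
    (hG.smooth_inv i j) (hp i j), fun i j => partialD_mul (hF.partialD i).differentiableAt_infty
    (hF.partialD j).differentiableAt_infty m, hFp, hG.inv_eq] at h
  simp [Fin.sum_univ_four, nullForm] at h
  linarith

/-- The pointwise statement behind the theorem: the Hessian of `F` annihilates the null plane
`span {∂₀, ∂₁}` which contains the gradient `∂₀` of `F`. -/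
theorem hessian_eq_zero {F lam : R4 → ℝ} {μ s κ : ℝ} (hμ : μ ≠ -1 / 2) (hs : s * s = 1)
    (hκ : s = -κ) (hF : ContDiffAt ℝ ∞ F p) (hFp : ∀ j, partialD j F p = nullForm 0 j)
    (hnull : ∀ᶠ x in 𝓝 p, ∑ i, ∑ j, (G x)⁻¹ i j * (partialD i F x * partialD j F x) = 0)
    (hlam : ContDiffAt ℝ ∞ lam p)
    (hQE : ∀ᶠ x in 𝓝 p, ∀ i j, hessian G F i j x + ricci G i j x
      - μ * (partialD i F x * partialD j F x) = lam x * G x i j)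
    (hW : ∀ᶠ x in 𝓝 p, ∀ θ : Matrix (Fin 4) (Fin 4) ℝ, θ.transpose = -θ →
      hodgeStar s (G x) θ = κ • θ → weylOp G x θ = 0) (j : Fin 4) :
    partialD 0 (partialD j F) p = 0 ∧ partialD 1 (partialD j F) p = 0 := by
  have hF₀ := hG.partialD_zero_partialD hF hFp hnull
  have hsymm : ∀ i j, partialD i (partialD j F) p = partialD j (partialD i F) p :=
    _root_.partialD_comm hF.contDiffAt_two
  refine ⟨by rw [hsymm, hF₀], ?_⟩
  have hΓ := contDiffAt_christoffel hG.smooth hG.det_ne_zero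
  have hρ := contDiffAt_ricci hG.smooth hG.det_ne_zero
  refine hessian_eq_zero_of_quasiEinstein (F := fun i j => partialD i (partialD j F) p)
    (R := fun i j k l => curvature G i j k l p) (c := lam p) (dc := fun m => partialD m lam p)
    hG.curvature_pair hG.isCurvatureDerivative
    (hG.killsASD (isJetFunctional_eval p) hs hκ hW)
    (fun m => hG.killsASD (isJetFunctional_partialD p m) hs hκ hW) hμ hsymm
    (fun j => by rw [hsymm, hF₀]) (fun i j => ?_) (fun m i j => ?_) j
  · rw [← hG.jet_ricci (isJetFunctional_eval p), ← hFp, ← hFp, ← hG.eq, ← hQE.self_of_nhds i j,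
      hessian]
    simp [hG.christoffel_eq_zero]
  -- The derivative of the quasi-Einstein equation along ∂_m. Since ∇F = ∂₀ at p, the only nonzero
  -- ∂_k F there is that with k = 2. Exchanging m and i and subtracting removes the third
  -- derivatives of F and leaves derivatives of Christoffel symbols that form a curvature component.
  · have key : ∀ m i j, partialD m (partialD i (partialD j F)) p
        - partialD m (christoffel G i j 2) p + partialD m (ricci G i j) p
        - μ * (nullForm 0 i * partialD m (partialD j F) p
          + nullForm 0 j * partialD m (partialD i F) p) - partialD m lam p * nullForm i j = 0 := by
      intro m i j
      have hδ := isJetFunctional_partialD p m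
      have h1 : ∀ k, ContDiffAt ℝ ∞ (fun x => christoffel G i j k x * partialD k F x) p :=
        fun k => (hΓ i j k).mul (hF.partialD k)
      have h2 : ContDiffAt ℝ ∞ (fun x => partialD i F x * partialD j F x) p :=
        (hF.partialD i).mul (hF.partialD j)
      have h3 : ContDiffAt ℝ ∞ (fun x => ∑ k, christoffel G i j k x * partialD k F x) p :=
        ContDiffAt.sum fun k _ => h1 k
      have h4 : ContDiffAt ℝ ∞ (fun x => G x i j * lam x) p := (hG.smooth i j).mul hlam
      have hz : (fun x => partialD i (partialD j F) x
          - (∑ k, christoffel G i j k x * partialD k F x) + ricci G i j x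
          - μ * (partialD i F x * partialD j F x) - G x i j * lam x) =ᶠ[𝓝 p] fun _ => 0 := by
        filter_upwards [hQE] with x hx
        have := hx i j
        rw [hessian] at this
        linarith
      have h := hδ.congr hz
      have h5 := (hF.partialD j).partialD i
      rw [hδ.zero, hδ.sub (((h5.sub h3).add (hρ i j)).sub (contDiffAt_const.mul h2)) h4,
        hδ.sub ((h5.sub h3).add (hρ i j)) (contDiffAt_const.mul h2),
        hδ.add (h5.sub h3) (hρ i j), hδ.sub h5 h3, hδ.sum _ h1,
        hδ.const_mul _ h2, hδ.mul (hG.stationary i j) (hG.smooth i j) hlam,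
        partialD_mul (hF.partialD i).differentiableAt_infty
          (hF.partialD j).differentiableAt_infty, hG.eq] at h
      simp_rw [fun k => partialD_mul (hΓ i j k).differentiableAt_infty
        (hF.partialD k).differentiableAt_infty m, hG.christoffel_eq_zero, hFp] at h
      simp only [zero_mul, zero_add] at h
      rw [sum_nullForm_mul fun k => partialD m (christoffel G i j k) p] at h
      simp only [zero_add] at h
      linarith
    -- Lowering the last index with the null form turns the upper index 2 into the lower index 0.
    have hR : curvature G m i j 0 p
        = -(partialD m (christoffel G i j 2) p - partialD i (christoffel G m j 2) p) := by
      have h := isJetFunctional_eval p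
      exact (hG.jet_curvature' h m i j 0).trans (hG.jet_curvatureOp h m i j 2)
    have h3 : partialD m (partialD i (partialD j F)) p = partialD i (partialD m (partialD j F)) p :=
      _root_.partialD_comm (hF.partialD j).contDiffAt_two m i
    rw [← hG.jet_ricci (isJetFunctional_partialD p m),
      ← hG.jet_ricci (isJetFunctional_partialD p i),
      hR]
    linarith [key m i j, key i m j, hsymm m i, congrArg (fun t => μ * nullForm 0 j * t) (hsymm m i)]

end IsNullNormalAt

/-! ### Components in a chart -/

section Components

variable {M : Type*} [TopologicalSpace M] [ChartedSpace R4 M]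

/-- The components of a tangent vector in the coordinates `φ`. -/
def toComp (φ : OpenPartialHomeomorph M R4) (p : M) (v : TangentSpace (𝓡 4) p) :
    Fin 4 → ℝ :=
  fun k => (show R4 from mfderiv (𝓡 4) (𝓡 4) φ p v) k

/-- The tangent vector with given components in the coordinates `φ`. -/
def ofComp (φ : OpenPartialHomeomorph M R4) (x : R4) (c : Fin 4 → ℝ) :
    TangentSpace (𝓡 4) (φ.symm x) :=
  ∑ k, c k • coordVec φ x k

theorem toComp_add (φ : OpenPartialHomeomorph M R4) (p : M)
    (v w : TangentSpace (𝓡 4) p) : toComp φ p (v + w) = toComp φ p v + toComp φ p w := by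
  funext k
  have : mfderiv (𝓡 4) (𝓡 4) φ p (v + w)
    = mfderiv (𝓡 4) (𝓡 4) φ p v + mfderiv (𝓡 4) (𝓡 4) φ p w := map_add _ _ _
  exact congrArg (fun u : R4 => u k) this

theorem toComp_smul (φ : OpenPartialHomeomorph M R4) (p : M) (c : ℝ)
    (v : TangentSpace (𝓡 4) p) : toComp φ p (c • v) = c • toComp φ p v := by
  funext k
  have : mfderiv (𝓡 4) (𝓡 4) φ p (c • v)
    = c • mfderiv (𝓡 4) (𝓡 4) φ p v := map_smul _ _ _
  exact congrArg (fun u : R4 => u k) this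

theorem toComp_zero (φ : OpenPartialHomeomorph M R4) (p : M) : toComp φ p 0 = 0 := by
  simpa using toComp_smul φ p 0 0

theorem toComp_sum {ι : Type*} (φ : OpenPartialHomeomorph M R4) (p : M) (s : Finset ι)
    (v : ι → TangentSpace (𝓡 4) p) : toComp φ p (∑ i ∈ s, v i) = ∑ i ∈ s, toComp φ p (v i) := by
  classical
  induction s using Finset.induction_on with
  | empty => simpa using toComp_zero φ p
  | insert a s ha ih => rw [Finset.sum_insert ha, Finset.sum_insert ha, toComp_add, ih]

theorem R4.sum_single (v : R4) : ∑ k, v k • EuclideanSpace.single k (1 : ℝ) = v := by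
  ext j
  simp [Finset.sum_apply, Pi.single_apply]

theorem ofComp_eq (φ : OpenPartialHomeomorph M R4) (x : R4) (c : Fin 4 → ℝ) :
    ofComp φ x c = mfderiv (𝓡 4) (𝓡 4) φ.symm x (WithLp.toLp 2 c : R4) := by
  conv_rhs => rw [← R4.sum_single (WithLp.toLp 2 c)]
  unfold ofComp coordVec
  exact ((map_sum (mfderiv (𝓡 4) (𝓡 4) φ.symm x) _ _).trans
    (Finset.sum_congr rfl fun k _ => map_smul _ _ _)).symm

variable {φ : OpenPartialHomeomorph M R4} {x : R4}

section
variable (hφ : IsCoord φ) (hx : x ∈ φ.target)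
include hφ

theorem IsCoord.mdifferentiable : φ.MDifferentiable (𝓡 4) (𝓡 4) :=
  have h : φ ∈ IsManifold.maximalAtlas (𝓡 4) 1 M :=
    IsManifold.maximalAtlas_subset_of_le (by exact_mod_cast le_top) hφ
  ⟨fun _ hp => (mdifferentiableAt_of_mem_maximalAtlas h hp).mdifferentiableWithinAt,
    fun _ hp => (mdifferentiableAt_symm_of_mem_maximalAtlas h hp).mdifferentiableWithinAt⟩

include hx

theorem mfderiv_mfderiv_symm (v : R4) :
    mfderiv (𝓡 4) (𝓡 4) φ (φ.symm x) (mfderiv (𝓡 4) (𝓡 4) φ.symm x v) = v :=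
  congrArg (fun A : R4 →L[ℝ] R4 => A v) (hφ.mdifferentiable.comp_symm_deriv hx)

theorem mfderiv_symm_mfderiv (v : TangentSpace (𝓡 4) (φ.symm x)) :
    mfderiv (𝓡 4) (𝓡 4) φ.symm x (mfderiv (𝓡 4) (𝓡 4) φ (φ.symm x) v) = v := by
  have h := congrArg (fun A => A v) (hφ.mdifferentiable.symm_comp_deriv (φ.map_target hx))
  have e : φ (φ.symm x) = x := φ.right_inv hx
  simp only [ContinuousLinearMap.comp_apply] at h
  rw [e] at h
  exact h

theorem toComp_ofComp (c : Fin 4 → ℝ) : toComp φ (φ.symm x) (ofComp φ x c) = c := by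
  funext k
  rw [ofComp_eq]
  exact congrArg (fun u : R4 => u k) (mfderiv_mfderiv_symm hφ hx (WithLp.toLp 2 c))

theorem ofComp_toComp (v : TangentSpace (𝓡 4) (φ.symm x)) :
    ofComp φ x (toComp φ (φ.symm x) v) = v := by
  rw [ofComp_eq]
  exact mfderiv_symm_mfderiv hφ hx v

theorem toComp_coordVec (i : Fin 4) : toComp φ (φ.symm x) (coordVec φ x i) = Pi.single i 1 := by
  have : coordVec φ x i = ofComp φ x (Pi.single i 1) := by
    simp [ofComp, Pi.single_apply]
  rw [this, toComp_ofComp hφ hx]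

theorem toComp_injective : Function.Injective (toComp φ (φ.symm x)) :=
  Function.LeftInverse.injective (ofComp_toComp hφ hx)

end

/-! ### Smooth vector fields in terms of their components -/

section SmoothFields

variable [IsManifold (𝓡 4) ∞ M]

theorem contMDiffAt_tangentBundle_snd {x : R4} {V : R4 → R4} (h : ContDiffAt ℝ ∞ V x) :
    ContMDiffAt (𝓡 4) ((𝓡 4).prod 𝓘(ℝ, R4)) ∞
      (fun y => (Bundle.TotalSpace.mk' R4 y (V y) : TangentBundle (𝓡 4) R4)) x :=
  contMDiffAt_vectorSpace_iff_contDiffAt.2 h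

/-- The components of a smooth vector field are smooth. -/
theorem IsSmoothVectorFieldOn.contDiffAt_vecComp {Y : ∀ p : M, TangentSpace (𝓡 4) p} {O : Set M}
    (hY : IsSmoothVectorFieldOn Y O) (hO : IsOpen O) (hφ : IsCoord φ) (hx : x ∈ φ.target)
    (hxO : φ.symm x ∈ O) (k : Fin 4) : ContDiffAt ℝ ∞ (vecComp φ Y k) x := by
  have h1 : ContMDiffOn (𝓡 4) (𝓡 4) ∞ φ φ.source := contMDiffOn_of_mem_maximalAtlas hφ
  have h2 := h1.contMDiffOn_tangentMapWithin (m := ∞) le_rfl φ.open_source.uniqueMDiffOn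
  have h3 : ContMDiffAt (𝓡 4) (𝓡 4) ∞ φ.symm x := contMDiffAt_symm_of_mem_maximalAtlas hφ hx
  have h4 := (hY.contMDiffAt (hO.mem_nhds hxO)).comp x h3
  have h5 : ContMDiffAt (𝓡 4).tangent (𝓡 4).tangent ∞
      (tangentMapWithin (𝓡 4) (𝓡 4) φ φ.source)
      (Bundle.TotalSpace.mk' R4 (φ.symm x) (Y (φ.symm x)) : TangentBundle (𝓡 4) M) := by
    refine h2.contMDiffAt (IsOpen.mem_nhds ?_ (φ.map_target hx))
    exact φ.open_source.preimage (FiberBundle.continuous_proj R4 (TangentSpace (𝓡 4)))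
  have h6 := (contMDiff_snd_tangentBundle_modelSpace R4 (𝓡 4)).contMDiffAt.comp x (h5.comp x h4)
  have h7 := h6.contDiffAt
  have h8 : ContDiffAt ℝ ∞ (fun y => (show R4 from mfderivWithin (𝓡 4) (𝓡 4) φ φ.source
    (φ.symm y) (Y (φ.symm y)))) x := h7
  have h9 : vecComp φ Y k =ᶠ[𝓝 x] fun y => (show R4 from mfderivWithin (𝓡 4) (𝓡 4) φ φ.source
      (φ.symm y) (Y (φ.symm y))) k := by
    filter_upwards [φ.open_target.mem_nhds hx] with y hy
    rw [mfderivWithin_of_isOpen φ.open_source (φ.map_target hy)]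
    rfl
  exact
    ((EuclideanSpace.proj k : R4 →L[ℝ] ℝ).contDiff.contDiffAt.comp x h8).congr_of_eventuallyEq h9

/-- The vector field on `M` with given components in the coordinates `φ`. -/
def fieldOfComp (φ : OpenPartialHomeomorph M R4) (c : R4 → Fin 4 → ℝ) (p : M) :
    TangentSpace (𝓡 4) p :=
  show R4 from mfderiv (𝓡 4) (𝓡 4) φ.symm (φ p) (WithLp.toLp 2 (c (φ p)) : R4)

omit [IsManifold (𝓡 4) ∞ M] in
theorem fieldOfComp_symm (φ : OpenPartialHomeomorph M R4) (c : R4 → Fin 4 → ℝ)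
    (hx : x ∈ φ.target) : fieldOfComp φ c (φ.symm x) = ofComp φ x (c x) := by
  rw [ofComp_eq, fieldOfComp, φ.right_inv hx]

/-- A vector field with smooth components is smooth. -/
theorem isSmoothVectorFieldOn_fieldOfComp (hφ : IsCoord φ) {V : Set R4}
    {c : R4 → Fin 4 → ℝ} (hc : ∀ y ∈ V, ∀ k, ContDiffAt ℝ ∞ (fun z => c z k) y) :
    IsSmoothVectorFieldOn (fieldOfComp φ c) (φ.source ∩ φ ⁻¹' V) := by
  intro p hp
  refine ContMDiffAt.contMDiffWithinAt ?_
  have h1 : ContMDiffOn (𝓡 4) (𝓡 4) ∞ φ.symm φ.target := contMDiffOn_symm_of_mem_maximalAtlas hφ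
  have h2 := h1.contMDiffOn_tangentMapWithin (m := ∞) le_rfl φ.open_target.uniqueMDiffOn
  have h3 : ContMDiffAt (𝓡 4) (𝓡 4) ∞ φ p := contMDiffAt_of_mem_maximalAtlas hφ hp.1
  have hC : ContDiffAt ℝ ∞ (fun z => (WithLp.toLp 2 (c z) : R4)) (φ p) :=
    contDiffAt_euclidean.2 fun k => hc _ hp.2 k
  have h4 := (contMDiffAt_tangentBundle_snd hC).comp p h3
  have h5 : ContMDiffAt (𝓡 4).tangent (𝓡 4).tangent ∞
      (tangentMapWithin (𝓡 4) (𝓡 4) φ.symm φ.target)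
      (Bundle.TotalSpace.mk' R4 (φ p) (WithLp.toLp 2 (c (φ p))) : TangentBundle (𝓡 4) R4) := by
    refine h2.contMDiffAt (IsOpen.mem_nhds ?_ (φ.map_source hp.1))
    exact φ.open_target.preimage (FiberBundle.continuous_proj R4 (TangentSpace (𝓡 4)))
  refine (h5.comp p h4).congr_of_eventuallyEq ?_
  filter_upwards [φ.open_source.mem_nhds hp.1] with q hq
  simp only [Function.comp_apply, tangentMapWithin]
  rw [mfderivWithin_of_isOpen φ.open_target (φ.map_source hq)]
  have e : φ.symm (φ q) = q := φ.left_inv hq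
  exact Bundle.TotalSpace.ext e.symm (HEq.refl _)

end SmoothFields

end Components

/-! ### The metric in a chart -/

section MetricComponents

variable {M : Type*} [TopologicalSpace M] [ChartedSpace R4 M] [IsManifold (𝓡 4) ∞ M]
  {φ : OpenPartialHomeomorph M R4} {x : R4}

namespace PseudoRiemannianMetric

variable (g : PseudoRiemannianMetric M)

theorem val_ofComp (φ : OpenPartialHomeomorph M R4) (x : R4) (c d : Fin 4 → ℝ) :
    g.val (φ.symm x) (ofComp φ x c) (ofComp φ x d) = ∑ i, ∑ j, c i * d j * g.comp φ x i j := by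
  unfold ofComp
  simp only [map_sum, map_smul, sum_apply, smul_apply,
    smul_eq_mul, comp, Matrix.of_apply, Finset.mul_sum]
  rw [Finset.sum_comm]
  exact Finset.sum_congr rfl fun i _ => Finset.sum_congr rfl fun j _ => by ring

theorem val_eq_sum (hφ : IsCoord φ) (hx : x ∈ φ.target) (v w : TangentSpace (𝓡 4) (φ.symm x)) :
    g.val (φ.symm x) v w
      = ∑ i, ∑ j, toComp φ (φ.symm x) v i * toComp φ (φ.symm x) w j * g.comp φ x i j := by
  rw [← g.val_ofComp, ofComp_toComp hφ hx, ofComp_toComp hφ hx]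

theorem val_eq_sum' (hφ : IsCoord φ) {p : M} (hp : p ∈ φ.source) (v w : TangentSpace (𝓡 4) p) :
    g.val p v w = ∑ i, ∑ j, toComp φ p v i * toComp φ p w j * g.comp φ (φ p) i j := by
  obtain ⟨x, hx, rfl⟩ : ∃ x ∈ φ.target, φ.symm x = p := ⟨φ p, φ.map_source hp, φ.left_inv hp⟩
  rw [φ.right_inv hx, g.val_eq_sum hφ hx]

theorem comp_transpose (φ : OpenPartialHomeomorph M R4) (x : R4) :
    (g.comp φ x).transpose = g.comp φ x := by
  ext i j
  exact g.symm _ _ _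

theorem comp_symm (φ : OpenPartialHomeomorph M R4) (x : R4) (i j : Fin 4) :
    g.comp φ x i j = g.comp φ x j i := g.symm _ _ _

theorem det_comp_ne_zero (hφ : IsCoord φ) (hx : x ∈ φ.target) : (g.comp φ x).det ≠ 0 := by
  intro h
  obtain ⟨v, hv, hv'⟩ := Matrix.exists_mulVec_eq_zero_iff.2 h
  have h0 : ofComp φ x v = 0 := by
    refine g.nondegenerate _ _ fun w => ?_
    rw [g.val_eq_sum hφ hx, toComp_ofComp hφ hx, Finset.sum_comm]
    refine Finset.sum_eq_zero fun j _ => ?_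
    have := congrFun hv' j
    simp only [Matrix.mulVec, dotProduct, Pi.zero_apply] at this
    calc _ = toComp φ (φ.symm x) w j * ∑ i, g.comp φ x j i * v i := by
          rw [Finset.mul_sum]
          exact Finset.sum_congr rfl fun i _ => by rw [g.comp_symm φ x i j]; ring
      _ = 0 := by rw [this, mul_zero]
  have h1 := congrArg (toComp φ (φ.symm x)) h0
  rw [toComp_ofComp hφ hx] at h1
  refine hv (h1.trans ?_)
  exact toComp_zero φ _

theorem contMDiffAt_coordVec (hφ : IsCoord φ) (hx : x ∈ φ.target) (i : Fin 4) :
    ContMDiffAt (𝓡 4) ((𝓡 4).prod 𝓘(ℝ, R4)) ∞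
      (fun y => (Bundle.TotalSpace.mk' R4 (φ.symm y) (coordVec φ y i) : TangentBundle (𝓡 4) M))
      x := by
  have h1 : ContMDiffOn (𝓡 4) (𝓡 4) ∞ φ.symm φ.target := contMDiffOn_symm_of_mem_maximalAtlas hφ
  have h2 := h1.contMDiffOn_tangentMapWithin (m := ∞) le_rfl φ.open_target.uniqueMDiffOn
  have h4 := contMDiffAt_tangentBundle_snd
    (contDiffAt_const (x := x) (n := ∞) (𝕜 := ℝ) (c := EuclideanSpace.single i (1 : ℝ)))
  have h5 : ContMDiffAt (𝓡 4).tangent (𝓡 4).tangent ∞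
      (tangentMapWithin (𝓡 4) (𝓡 4) φ.symm φ.target)
      (Bundle.TotalSpace.mk' R4 x (EuclideanSpace.single i (1 : ℝ)) : TangentBundle (𝓡 4) R4) := by
    refine h2.contMDiffAt (IsOpen.mem_nhds ?_ hx)
    exact φ.open_target.preimage (FiberBundle.continuous_proj R4 (TangentSpace (𝓡 4)))
  refine (h5.comp x h4).congr_of_eventuallyEq ?_
  filter_upwards [φ.open_target.mem_nhds hx] with y hy
  simp only [Function.comp_apply, tangentMapWithin]
  rw [mfderivWithin_of_isOpen φ.open_target hy]
  rfl

theorem contDiffAt_comp (hφ : IsCoord φ) (hx : x ∈ φ.target) (i j : Fin 4) :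
    ContDiffAt ℝ ∞ (fun y => g.comp φ y i j) x := by
  have h3 : ContMDiffAt (𝓡 4) (𝓡 4) ∞ φ.symm x := contMDiffAt_symm_of_mem_maximalAtlas hφ hx
  have hg := (g.contMDiff (φ.symm x)).comp x h3
  have h := ContMDiffAt.clm_bundle_apply₂ (E₃ := Bundle.Trivial M ℝ) (F₃ := ℝ) (b := φ.symm)
    hg (contMDiffAt_coordVec hφ hx i) (contMDiffAt_coordVec hφ hx j)
  exact (Bundle.contMDiffAt_totalSpace.1 h).2.contDiffAt

/-- The components of the gradient are `G^{kl} ∂_l F`. -/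
theorem sum_comp_mul_grad (hφ : IsCoord φ) (hx : x ∈ φ.target) {f : M → ℝ}
    (hf : ContMDiff (𝓡 4) 𝓘(ℝ, ℝ) ∞ f) (i : Fin 4) :
    ∑ k, toComp φ (φ.symm x) (g.grad f (φ.symm x)) k * g.comp φ x k i
      = partialD i (fun y => f (φ.symm y)) x := by
  have h1 := g.val_grad f (φ.symm x) (coordVec φ x i)
  rw [g.val_eq_sum hφ hx, toComp_coordVec hφ hx] at h1
  have h2 : partialD i (fun y => f (φ.symm y)) x
      = mfderiv (𝓡 4) 𝓘(ℝ, ℝ) f (φ.symm x) (coordVec φ x i) := by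
    have h := mfderiv_comp_apply x (g := f) (f := φ.symm) (I := 𝓡 4) (I' := 𝓡 4) (I'' := 𝓘(ℝ, ℝ))
      (hf.mdifferentiable (by simp) _) (hφ.mdifferentiable.mdifferentiableAt_symm hx)
      (EuclideanSpace.single i (1 : ℝ) : R4)
    rw [mfderiv_eq_fderiv] at h
    exact h
  rw [h2, ← h1]
  refine Finset.sum_congr rfl fun k _ => ?_
  simp [Pi.single_apply]

end PseudoRiemannianMetric

end MetricComponents

/-! ### Changing coordinates -/

section ChartChange

variable {M : Type*} [TopologicalSpace M] [ChartedSpace R4 M] [IsManifold (𝓡 4) ∞ M]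
  {φ : OpenPartialHomeomorph M R4} {x : R4}

/-- The Jacobian matrix of a map between open subsets of `ℝ⁴`. -/
def jacobian (Θ : R4 → R4) (y : R4) : Matrix (Fin 4) (Fin 4) ℝ :=
  Matrix.of fun a i => partialD i (fun z => Θ z a) y

theorem fderiv_single_apply {Θ : R4 → R4} {y : R4} (h : DifferentiableAt ℝ Θ y) (a i : Fin 4) :
    fderiv ℝ Θ y (EuclideanSpace.single i 1) a = jacobian Θ y a i := by
  have := ((EuclideanSpace.proj a : R4 →L[ℝ] ℝ).hasFDerivAt.comp y h.hasFDerivAt).fderiv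
  rw [jacobian, Matrix.of_apply, partialD]
  exact (congrArg (fun A : R4 →L[ℝ] ℝ => A (EuclideanSpace.single i 1)) this).symm

theorem det_fderiv {Θ : R4 → R4} {y : R4} (h : DifferentiableAt ℝ Θ y) :
    (fderiv ℝ Θ y).det = (jacobian Θ y).det := by
  rw [ContinuousLinearMap.det, ← LinearMap.det_toMatrix (EuclideanSpace.basisFun (Fin 4) ℝ).toBasis]
  congr 1
  ext a i
  rw [LinearMap.toMatrix_apply, ← fderiv_single_apply h]
  simp

/-- `Θ` expresses the coordinates `φ` in terms of the coordinates `φ'`. -/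
structure IsCoordChange (φ φ' : OpenPartialHomeomorph M R4) (Θ : R4 → R4) : Prop where
  isCoord : IsCoord φ
  isCoord' : IsCoord φ'
  mem : ∀ y ∈ φ'.target, Θ y ∈ φ.target
  symm_eq : ∀ y ∈ φ'.target, φ'.symm y = φ.symm (Θ y)
  smooth : ∀ y ∈ φ'.target, ContDiffAt ℝ ∞ Θ y

/-- A smooth map with invertible Jacobian defines new coordinates. -/
theorem exists_coord (hφ : IsCoord φ) {Θ : R4 → R4} {y₀ : R4} {U : Set R4} (hU : IsOpen U)
    (hy₀ : y₀ ∈ U) (hΘ : ∀ y ∈ U, ContDiffAt ℝ ∞ Θ y) (hmem : Θ y₀ ∈ φ.target)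
    (hdet : (jacobian Θ y₀).det ≠ 0) :
    ∃ φ' : OpenPartialHomeomorph M R4, IsCoordChange φ φ' Θ ∧ y₀ ∈ φ'.target ∧ φ'.target ⊆ U ∧
      ∀ y ∈ φ'.target, (jacobian Θ y).det ≠ 0 := by
  have hd : (fderiv ℝ Θ y₀).det ≠ 0 := by
    rwa [det_fderiv (hΘ y₀ hy₀).differentiableAt_infty]
  let A : R4 ≃L[ℝ] R4 := ContinuousLinearMap.toContinuousLinearEquivOfDetNeZero (fderiv ℝ Θ y₀) hd
  have hA : HasFDerivAt Θ (A : R4 →L[ℝ] R4) y₀ := (hΘ y₀ hy₀).differentiableAt_infty.hasFDerivAt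
  let e := (hΘ y₀ hy₀).toOpenPartialHomeomorph Θ hA (by simp)
  have he : ∀ y, e y = Θ y := fun y => rfl
  have he₀ : y₀ ∈ e.source := (hΘ y₀ hy₀).mem_toOpenPartialHomeomorph_source hA (by simp)
  have hcont : ContinuousOn Θ U := fun y hy => (hΘ y hy).continuousAt.continuousWithinAt
  -- The inverse function theorem gives only a local homeomorphism near y₀; on V its inverse is
  -- smooth at every point of the image.
  let V : Set R4 := {y ∈ U | Θ y ∈ φ.target ∧ (jacobian Θ y).det ≠ 0}
  have hV : IsOpen V := by
    rw [isOpen_iff_mem_nhds]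
    rintro y ⟨hy, hy', hy''⟩
    have hc : ContinuousAt (fun z => (jacobian Θ z).det) y :=
      (ContDiffAt.matrix_det (m := ∞) fun a i =>
        ((EuclideanSpace.proj a : R4 →L[ℝ] ℝ).contDiff.contDiffAt.comp y (hΘ y hy)).partialD
          i).continuousAt
    filter_upwards [hU.mem_nhds hy, (hΘ y hy).continuousAt.preimage_mem_nhds
      (φ.open_target.mem_nhds hy'), hc.eventually_ne hy''] with z h1 h2 h3 using ⟨h1, h2, h3⟩
  let e' := e.restrOpen V hV
  have he's : e'.source = e.source ∩ V := rfl
  refine ⟨φ.trans e'.symm, ⟨hφ, ?_, ?_, ?_, ?_⟩, ?_, ?_, ?_⟩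
  · have hs : ∀ z ∈ e'.target, ContDiffAt ℝ ∞ e'.symm z := by
      intro z hz
      have hz' := e'.map_target hz
      have hd' := hz'.2.2.2
      have hsm := hΘ _ hz'.2.1
      rw [← det_fderiv hsm.differentiableAt_infty] at hd'
      exact e'.contDiffAt_symm (f₀' := ContinuousLinearMap.toContinuousLinearEquivOfDetNeZero _ hd')
        hz hsm.differentiableAt_infty.hasFDerivAt hsm
    refine (φ.trans e'.symm).mem_maximalAtlas_of_contMDiffOn ?_ ?_
    · intro p hp
      rw [OpenPartialHomeomorph.trans_source] at hp
      refine ContMDiffAt.contMDiffWithinAt ?_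
      exact (hs _ hp.2).contMDiffAt.comp p (contMDiffAt_of_mem_maximalAtlas hφ hp.1)
    · intro y hy
      rw [OpenPartialHomeomorph.trans_target] at hy
      refine ContMDiffAt.contMDiffWithinAt ?_
      have hy1 : y ∈ e.source ∩ V := hy.1
      have h1 : ContMDiffAt (𝓡 4) (𝓡 4) ∞ φ.symm (e' y) :=
        contMDiffAt_symm_of_mem_maximalAtlas hφ hy1.2.2.1
      have h2 : ContMDiffAt (𝓡 4) (𝓡 4) ∞ e' y := (hΘ y hy1.2.1).contMDiffAt
      exact h1.comp y h2
  · rw [OpenPartialHomeomorph.trans_target]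
    exact fun y hy => hy.1.2.2.1
  · exact fun y _ => rfl
  · rw [OpenPartialHomeomorph.trans_target]
    exact fun y hy => hΘ y hy.1.2.1
  · rw [OpenPartialHomeomorph.trans_target]
    exact ⟨⟨he₀, hy₀, hmem, hdet⟩, hmem⟩
  · rw [OpenPartialHomeomorph.trans_target]
    exact fun y hy => hy.1.2.1
  · rw [OpenPartialHomeomorph.trans_target]
    exact fun y hy => hy.1.2.2.2

namespace IsCoordChange

variable {φ' : OpenPartialHomeomorph M R4} {Θ : R4 → R4} (h : IsCoordChange φ φ' Θ) {y : R4}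
  (hy : y ∈ φ'.target)
include h hy

omit [IsManifold (𝓡 4) ∞ M] in
theorem toComp_coordVec (i : Fin 4) :
    toComp φ (φ'.symm y) (coordVec φ' y i) = fun a => jacobian Θ y a i := by
  have hΘ := (h.smooth y hy).differentiableAt_infty
  have he : φ'.symm =ᶠ[𝓝 y] fun z => φ.symm (Θ z) :=
    Filter.eventuallyEq_of_mem (φ'.open_target.mem_nhds hy) h.symm_eq
  have h1 : (fderiv ℝ Θ y (EuclideanSpace.single i 1) : R4)
      = WithLp.toLp 2 fun a => jacobian Θ y a i := by
    ext a
    exact fderiv_single_apply hΘ a i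
  have h2 := mfderiv_comp_apply y (g := φ.symm) (f := Θ) (I := 𝓡 4) (I' := 𝓡 4) (I'' := 𝓡 4)
    (h.isCoord.mdifferentiable.mdifferentiableAt_symm (h.mem y hy)) hΘ.mdifferentiableAt
    (EuclideanSpace.single i (1 : ℝ) : R4)
  rw [mfderiv_eq_fderiv] at h2
  have h3 := mfderiv_mfderiv_symm h.isCoord (h.mem y hy) (WithLp.toLp 2 fun a => jacobian Θ y a i)
  rw [← h1] at h3
  have h4 : (show R4 from coordVec φ' y i) = mfderiv (𝓡 4) (𝓡 4) φ.symm (Θ y)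
      (fderiv ℝ Θ y (EuclideanSpace.single i 1)) := by
    rw [coordVec, he.mfderiv_eq]
    exact h2
  funext a
  have h5 : (show R4 from mfderiv (𝓡 4) (𝓡 4) φ (φ'.symm y) (coordVec φ' y i))
      = fderiv ℝ Θ y (EuclideanSpace.single i 1) := by
    rw [← h3]
    -- Both derivatives are read as endomorphisms of `R4`, because their base points are equal only
    -- propositionally.
    have h6 : @Eq (R4 →L[ℝ] R4) (mfderiv (𝓡 4) (𝓡 4) φ (φ'.symm y))
      (mfderiv (𝓡 4) (𝓡 4) φ (φ.symm (Θ y))) := mfderiv_congr_point (h.symm_eq y hy)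
    have h7 := congrArg₂ (fun (A : R4 →L[ℝ] R4) (v : R4) => A v) h6 h4
    exact h7
  have h8 := congrArg (fun u : R4 => u a) h5
  rw [fderiv_single_apply hΘ] at h8
  exact h8

omit [IsManifold (𝓡 4) ∞ M] in
/-- The transformation of the components of a tangent vector. -/
theorem mulVec_toComp (v : TangentSpace (𝓡 4) (φ'.symm y)) :
    (jacobian Θ y).mulVec (toComp φ' (φ'.symm y) v) = toComp φ (φ'.symm y) v := by
  conv_rhs => rw [← ofComp_toComp h.isCoord' hy v, ofComp, toComp_sum]
  funext a
  rw [Finset.sum_apply, Matrix.mulVec, dotProduct]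
  refine Finset.sum_congr rfl fun i _ => ?_
  rw [toComp_smul, h.toComp_coordVec hy, Pi.smul_apply, smul_eq_mul, mul_comm]

omit [IsManifold (𝓡 4) ∞ M] in
theorem symm_mem_source : φ'.symm y ∈ φ.source := by
  rw [h.symm_eq y hy]
  exact φ.map_target (h.mem y hy)

omit [IsManifold (𝓡 4) ∞ M] in
theorem apply_symm : φ (φ'.symm y) = Θ y := by
  rw [h.symm_eq y hy, φ.right_inv (h.mem y hy)]

/-- The transformation of the components of the metric. -/
theorem comp_eq (g : PseudoRiemannianMetric M) :
    g.comp φ' y = (jacobian Θ y).transpose * g.comp φ (Θ y) * jacobian Θ y := by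
  ext i j
  rw [PseudoRiemannianMetric.comp, Matrix.of_apply,
    g.val_eq_sum' h.isCoord (h.symm_mem_source hy), h.apply_symm hy, h.toComp_coordVec hy,
    h.toComp_coordVec hy]
  simp only [Matrix.mul_apply, Matrix.transpose_apply, Finset.sum_mul]
  rw [Finset.sum_comm]
  exact Finset.sum_congr rfl fun _ _ => Finset.sum_congr rfl fun _ _ => by ring

end IsCoordChange

end ChartChange

/-! ### The Levi-Civita connection in coordinates -/

section Christoffel

variable {G : R4 → Matrix (Fin 4) (Fin 4) ℝ} {x : R4}

/-- The Christoffel symbols of the first kind. -/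
theorem sum_christoffel_mul (hdet : (G x).det ≠ 0) (hs : (G x).transpose = G x) (i j l : Fin 4) :
    ∑ k, christoffel G i j k x * G x k l = (1 / 2) *
      (partialD i (fun y => G y j l) x
        + partialD j (fun y => G y i l) x - partialD l (fun y => G y i j) x) := by
  set T : Fin 4 → ℝ := fun l => partialD i (fun y => G y j l) x + partialD j (fun y => G y i l) x
    - partialD l (fun y => G y i j) x with hT
  have h1 : ∀ k, christoffel G i j k x = (1 / 2) * ((G x)⁻¹.mulVec T) k := fun k => rfl
  have h2 : (G x).mulVec ((G x)⁻¹.mulVec T) = T := by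
    rw [Matrix.mulVec_mulVec, Matrix.mul_nonsing_inv _ (isUnit_iff_ne_zero.2 hdet),
      Matrix.one_mulVec]
  change _ = (1 / 2) * T l
  conv_rhs => rw [← h2]
  rw [Matrix.mulVec, dotProduct, Finset.mul_sum]
  refine Finset.sum_congr rfl fun k _ => ?_
  have h3 : G x k l = G x l k := congrFun (congrFun hs l) k
  rw [h1, h3]
  ring

theorem partialD_metric_symm (hs : ∀ᶠ y in 𝓝 x, (G y).transpose = G y) (a i j : Fin 4) :
    partialD a (fun y => G y i j) x = partialD a (fun y => G y j i) x :=
  Filter.EventuallyEq.partialD_eq (hs.mono fun _ hy => congrFun (congrFun hy j) i) a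

theorem christoffel_symm (hs : ∀ᶠ y in 𝓝 x, (G y).transpose = G y) (i j k : Fin 4) :
    christoffel G i j k x = christoffel G j i k x := by
  unfold christoffel
  congr 1
  refine Finset.sum_congr rfl fun l _ => ?_
  rw [partialD_metric_symm hs l i j]
  ring

/-- Metric compatibility of the Levi-Civita connection. -/
theorem partialD_metric (hdet : (G x).det ≠ 0) (hs : ∀ᶠ y in 𝓝 x, (G y).transpose = G y)
    (c a b : Fin 4) : partialD c (fun y => G y a b) x
      = ∑ d, christoffel G c a d x * G x d b + ∑ d, christoffel G c b d x * G x d a := by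
  rw [sum_christoffel_mul hdet hs.self_of_nhds, sum_christoffel_mul hdet hs.self_of_nhds,
    partialD_metric_symm hs c b a, partialD_metric_symm hs a c b, partialD_metric_symm hs b c a]
  ring

end Christoffel

theorem contDiff_coord (i : Fin 4) : ContDiff ℝ ∞ fun y : R4 => y i :=
  (EuclideanSpace.proj i : R4 →L[ℝ] ℝ).contDiff

theorem partialD_coord (i j : Fin 4) (x : R4) :
    partialD j (fun y => y i) x = if i = j then 1 else 0 := by
  have : (fun y : R4 => y i) = (EuclideanSpace.proj i : R4 →L[ℝ] ℝ) := rfl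
  rw [partialD, this, ContinuousLinearMap.fderiv]
  simp

theorem partialD_comp {u : R4 → ℝ} {Θ : R4 → R4} {y : R4} (hu : DifferentiableAt ℝ u (Θ y))
    (hΘ : DifferentiableAt ℝ Θ y) (i : Fin 4) :
    partialD i (fun z => u (Θ z)) y = ∑ a, partialD a u (Θ y) * jacobian Θ y a i := by
  have h : fderiv ℝ (fun z => u (Θ z)) y = (fderiv ℝ u (Θ y)).comp (fderiv ℝ Θ y) :=
    (hu.hasFDerivAt.comp y hΘ.hasFDerivAt).fderiv
  rw [partialD, h, ContinuousLinearMap.comp_apply,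
    ← R4.sum_single (fderiv ℝ Θ y (EuclideanSpace.single i 1)), map_sum]
  refine Finset.sum_congr rfl fun a _ => ?_
  rw [map_smul, fderiv_single_apply hΘ, smul_eq_mul, mul_comm]
  rfl

/-- The quadratic coordinate change with given first and second derivatives at the origin. -/
def quadraticMap (x₀ : R4) (E : Matrix (Fin 4) (Fin 4) ℝ) (Q : Fin 4 → Fin 4 → Fin 4 → ℝ)
    (y : R4) : R4 :=
  WithLp.toLp 2 fun a => x₀ a + ∑ i, y i * (E a i - (1 / 2) * ∑ j, Q a i j * y j)

section Quadratic

variable (x₀ : R4) (E : Matrix (Fin 4) (Fin 4) ℝ) {Q : Fin 4 → Fin 4 → Fin 4 → ℝ}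

theorem contDiff_quadraticMap : ContDiff ℝ ∞ (quadraticMap x₀ E Q) :=
  contDiff_euclidean.2 fun _ => contDiff_const.add (ContDiff.sum fun i _ => (contDiff_coord i).mul
    (contDiff_const.sub (contDiff_const.mul (ContDiff.sum fun j _ =>
      contDiff_const.mul (contDiff_coord j)))))

theorem quadraticMap_zero : quadraticMap x₀ E Q 0 = x₀ := by
  ext a
  simp [quadraticMap]

/-- By symmetry of Q the two terms of the product rule agree, which absorbs the factor 1/2. -/
theorem jacobian_quadraticMap (hQ : ∀ a i j, Q a i j = Q a j i) (y : R4) (a k : Fin 4) :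
    jacobian (quadraticMap x₀ E Q) y a k = E a k - ∑ j, Q a k j * y j := by
  have hd : ∀ i, DifferentiableAt ℝ (fun y : R4 => y i) y := fun i =>
    (contDiff_coord i).contDiffAt.differentiableAt_infty
  have h1 : ∀ i, DifferentiableAt ℝ (fun y : R4 => ∑ j, Q a i j * y j) y := fun i =>
    DifferentiableAt.fun_sum fun j _ => (hd j).const_mul _
  have h2 : ∀ i, DifferentiableAt ℝ (fun y : R4 => E a i - (1 / 2) * ∑ j, Q a i j * y j) y :=
    fun i => (differentiableAt_const _).sub ((h1 i).const_mul _)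
  have h3 : ∀ i, partialD k (fun y : R4 => ∑ j, Q a i j * y j) y = Q a i k := fun i => by
    rw [partialD_sum _ fun j _ => (hd j).const_mul _]
    simp_rw [fun j => partialD_const_mul (Q a i j) (hd j) k, partialD_coord]
    simp
  change partialD k (fun y : R4 => x₀ a + ∑ i, y i * (E a i - (1 / 2) * ∑ j, Q a i j * y j)) y = _
  rw [partialD_add (differentiableAt_const _)
    (DifferentiableAt.fun_sum fun i _ => (hd i).fun_mul (h2 i)), partialD_const,
    partialD_sum _ fun i _ => (hd i).fun_mul (h2 i)]
  simp_rw [fun i => partialD_mul (hd i) (h2 i) k, fun i => partialD_sub (differentiableAt_const _)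
    ((h1 i).const_mul (1 / 2)) k, partialD_const, fun i => partialD_const_mul (1 / 2) (h1 i) k, h3,
    partialD_coord, Finset.sum_add_distrib]
  have h4 : ∑ i, y i * (0 - 1 / 2 * Q a i k) = -(1 / 2) * ∑ j, Q a k j * y j := by
    rw [Finset.mul_sum]
    exact Finset.sum_congr rfl fun i _ => by rw [hQ a i k]; ring
  rw [h4]
  simp
  ring

theorem jacobian_quadraticMap_zero (hQ : ∀ a i j, Q a i j = Q a j i) :
    jacobian (quadraticMap x₀ E Q) 0 = E := by
  ext a k
  simp [jacobian_quadraticMap x₀ E hQ]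

theorem partialD_jacobian_quadraticMap (hQ : ∀ a i j, Q a i j = Q a j i) (a k m : Fin 4) :
    partialD m (fun y => jacobian (quadraticMap x₀ E Q) y a k) 0 = -Q a k m := by
  have hd : ∀ i, DifferentiableAt ℝ (fun y : R4 => y i) 0 := fun i =>
    (contDiff_coord i).contDiffAt.differentiableAt_infty
  simp_rw [jacobian_quadraticMap x₀ E hQ]
  rw [partialD_sub (differentiableAt_const _)
    (DifferentiableAt.fun_sum fun j _ => (hd j).const_mul _), partialD_const,
    partialD_sum _ fun j _ => (hd j).const_mul _]
  simp_rw [fun j => partialD_const_mul (Q a k j) (hd j) m, partialD_coord]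
  simp

end Quadratic

/-! ### Normal coordinates adapted to a null frame -/

theorem partialD_matrix_mul {A B : R4 → Matrix (Fin 4) (Fin 4) ℝ} {x : R4}
    (hA : ∀ i j, DifferentiableAt ℝ (fun y => A y i j) x)
    (hB : ∀ i j, DifferentiableAt ℝ (fun y => B y i j) x) (c : Fin 4) :
    (Matrix.of fun i j => partialD c (fun y => (A y * B y) i j) x)
      = (Matrix.of fun i j => partialD c (fun y => A y i j) x) * B x
        + A x * Matrix.of fun i j => partialD c (fun y => B y i j) x := by
  ext i j
  simp only [Matrix.mul_apply, Matrix.of_apply, Matrix.add_apply]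
  rw [partialD_sum _ fun k _ => (hA i k).fun_mul (hB k j), ← Finset.sum_add_distrib]
  exact Finset.sum_congr rfl fun k _ =>
    (partialD_mul (hA i k) (hB k j) c).trans (by rw [add_comm, mul_comm (B x k j)])

/-- The second order coefficients that make a quadratic coordinate change normal. -/
def normalCoeff (G : R4 → Matrix (Fin 4) (Fin 4) ℝ) (x : R4) (E : Matrix (Fin 4) (Fin 4) ℝ)
    (a i j : Fin 4) : ℝ :=
  ∑ b, ∑ c, christoffel G b c a x * E b j * E c i

section NormalCoeff

variable {G : R4 → Matrix (Fin 4) (Fin 4) ℝ} {x : R4} {E : Matrix (Fin 4) (Fin 4) ℝ}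

theorem normalCoeff_symm (hs : ∀ᶠ y in 𝓝 x, (G y).transpose = G y) (a i j : Fin 4) :
    normalCoeff G x E a i j = normalCoeff G x E a j i := by
  unfold normalCoeff
  rw [Finset.sum_comm]
  refine Finset.sum_congr rfl fun b _ => Finset.sum_congr rfl fun c _ => ?_
  rw [christoffel_symm hs c b]
  ring

/-- The quadratic term contributes -(NE)ᵀGE - EᵀG(NE), and metric compatibility contributes Eᵀ(NᵀG +
GN)E; these cancel. -/
theorem stationaryAt_of_normalCoeff (hG : ∀ i j, ContDiffAt ℝ ∞ (fun y => G y i j) x)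
    (hdet : (G x).det ≠ 0) (hs : ∀ᶠ y in 𝓝 x, (G y).transpose = G y) (i j : Fin 4) :
    StationaryAt (fun y => ((jacobian (quadraticMap x E (normalCoeff G x E)) y).transpose
      * G (quadraticMap x E (normalCoeff G x E) y)
      * jacobian (quadraticMap x E (normalCoeff G x E)) y) i j) 0 := by
  set Θ := quadraticMap x E (normalCoeff G x E) with hΘ
  have hQ := fun a i j => normalCoeff_symm (E := E) hs a i j
  have hΘs : ContDiff ℝ ∞ Θ := contDiff_quadraticMap x E
  have hΘ0 : Θ 0 = x := quadraticMap_zero x E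
  have hJ : ∀ a k, DifferentiableAt ℝ (fun y => jacobian Θ y a k) 0 := fun a k =>
    (((EuclideanSpace.proj a : R4 →L[ℝ] ℝ).contDiff.contDiffAt.comp 0
      hΘs.contDiffAt).partialD k).differentiableAt_infty
  have hGd : ∀ a k, DifferentiableAt ℝ (fun y => G y a k) (Θ 0) := fun a k => by
    rw [hΘ0]; exact (hG a k).differentiableAt_infty
  have hGΘ : ∀ a k, DifferentiableAt ℝ (fun y => G (Θ y) a k) 0 := fun a k =>
    (hGd a k).comp 0 hΘs.contDiffAt.differentiableAt_infty
  have hJt : ∀ a k, DifferentiableAt ℝ (fun y => (jacobian Θ y).transpose a k) 0 :=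
    fun a k => hJ k a
  have hJG : ∀ a k, DifferentiableAt ℝ (fun y => ((jacobian Θ y).transpose * G (Θ y)) a k) 0 := by
    intro a k
    simp only [Matrix.mul_apply]
    exact DifferentiableAt.fun_sum fun l _ => (hJt a l).fun_mul (hGΘ l k)
  refine stationaryAt_of_partialD ?_ fun c => ?_
  · simp only [Matrix.mul_apply (N := jacobian Θ _)]
    exact DifferentiableAt.fun_sum fun l _ => (hJG i l).fun_mul (hJ l j)
  -- The connection matrix in the direction of the c-th frame vector.
  let N : Matrix (Fin 4) (Fin 4) ℝ := Matrix.of fun a b => ∑ d, E d c * christoffel G d b a x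
  have h1 : (Matrix.of fun i j => partialD c (fun y => jacobian Θ y i j) 0) = -(N * E) := by
    ext a k
    rw [Matrix.of_apply, hΘ, partialD_jacobian_quadraticMap x E hQ, Matrix.neg_apply,
      Matrix.mul_apply, normalCoeff, Finset.sum_comm]
    simp only [N, Matrix.of_apply, Finset.sum_mul]
    congr 1
    exact Finset.sum_congr rfl fun b _ => Finset.sum_congr rfl fun d _ => by ring
  have h2 : (Matrix.of fun i j => partialD c (fun y => (jacobian Θ y).transpose i j) 0)
      = -(E.transpose * N.transpose) := by
    rw [← Matrix.transpose_mul, ← Matrix.transpose_neg, ← h1]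
    rfl
  have h3 : (Matrix.of fun i j => partialD c (fun y => G (Θ y) i j) 0)
      = N.transpose * G x + G x * N := by
    ext a b
    rw [Matrix.of_apply, partialD_comp (u := fun z => G z a b) (hGd a b)
      hΘs.contDiffAt.differentiableAt_infty, hΘ0, hΘ, jacobian_quadraticMap_zero x E hQ]
    simp only [fun d => partialD_metric hdet hs d a b, Matrix.add_apply, Matrix.mul_apply,
      Matrix.transpose_apply, N, Matrix.of_apply, add_mul, Finset.sum_add_distrib, Finset.sum_mul,
      Finset.mul_sum]
    congr 1
    · rw [Finset.sum_comm]
      exact Finset.sum_congr rfl fun b _ => Finset.sum_congr rfl fun d _ => by ring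
    · rw [Finset.sum_comm]
      refine Finset.sum_congr rfl fun k _ => Finset.sum_congr rfl fun d _ => ?_
      rw [show G x k a = G x a k from congrFun (congrFun hs.self_of_nhds a) k]
      ring
  have h4 := partialD_matrix_mul hJG hJ c
  rw [partialD_matrix_mul hJt hGΘ c, h1, h2, h3, hΘ0, hΘ, jacobian_quadraticMap_zero x E hQ] at h4
  have h5 : (-(E.transpose * N.transpose) * G x + E.transpose * (N.transpose * G x + G x * N)) * E
      + E.transpose * G x * -(N * E) = 0 := by noncomm_ring
  rw [h5] at h4
  exact congrFun (congrFun h4 i) j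

/-- Second derivatives at the centre of normal coordinates are components of the Hessian. -/
theorem partialD_partialD_comp_quadraticMap {F : R4 → ℝ} (hF : ContDiffAt ℝ ∞ F x)
    (hs : ∀ᶠ y in 𝓝 x, (G y).transpose = G y) (i j : Fin 4) :
    partialD i (partialD j fun y => F (quadraticMap x E (normalCoeff G x E) y)) 0
      = ∑ b, (∑ a, E a i * hessian G F a b x) * E b j := by
  set Θ := quadraticMap x E (normalCoeff G x E) with hΘ
  have hQ := fun a i j => normalCoeff_symm (E := E) hs a i j
  have hΘs : ContDiff ℝ ∞ Θ := contDiff_quadraticMap x E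
  have hΘ0 : Θ 0 = x := quadraticMap_zero x E
  have hF' : ContDiffAt ℝ ∞ F (Θ 0) := by rwa [hΘ0]
  have hJ : ∀ a k, DifferentiableAt ℝ (fun y => jacobian Θ y a k) 0 := fun a k =>
    (((EuclideanSpace.proj a : R4 →L[ℝ] ℝ).contDiff.contDiffAt.comp 0
      hΘs.contDiffAt).partialD k).differentiableAt_infty
  have hd : ∀ a, DifferentiableAt ℝ (fun y => partialD a F (Θ y)) 0 := fun a =>
    (hF'.partialD a).differentiableAt_infty.comp 0 hΘs.contDiffAt.differentiableAt_infty
  have h1 : partialD j (fun y => F (Θ y)) =ᶠ[𝓝 0]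
      fun y => ∑ a, partialD a F (Θ y) * jacobian Θ y a j := by
    filter_upwards [hΘs.continuous.continuousAt.eventually hF'.eventually_differentiableAt]
      with y hy
    exact partialD_comp hy hΘs.contDiffAt.differentiableAt_infty j
  rw [h1.partialD_eq, partialD_sum _ fun a _ => (hd a).fun_mul (hJ a j)]
  have h2 : ∀ a, partialD i (fun y => partialD a F (Θ y) * jacobian Θ y a j) 0
      = (∑ b, partialD b (partialD a F) x * E b i) * E a j
        - partialD a F x * ∑ b, ∑ c, christoffel G b c a x * E b i * E c j := fun a => by
    rw [partialD_mul (hd a) (hJ a j), partialD_comp (u := partialD a F)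
      (hF'.partialD a).differentiableAt_infty hΘs.contDiffAt.differentiableAt_infty, hΘ0, hΘ,
      jacobian_quadraticMap_zero x E hQ, partialD_jacobian_quadraticMap x E hQ, normalCoeff]
    ring
  simp only [h2, hessian, mul_sub, Finset.sum_sub_distrib, sub_mul, Finset.mul_sum, Finset.sum_mul]
  congr 1
  · exact Finset.sum_congr rfl fun b _ => Finset.sum_congr rfl fun d _ => by ring
  · rw [Finset.sum_congr rfl fun b _ => Finset.sum_comm, Finset.sum_comm]
    refine Finset.sum_congr rfl fun b _ => ?_
    rw [Finset.sum_comm]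
    exact Finset.sum_congr rfl fun d _ => Finset.sum_congr rfl fun k _ => by ring

end NormalCoeff

/-! ### The Hessian along a null frame -/

section Transfer

variable {M : Type*} [TopologicalSpace M] [ChartedSpace R4 M] [IsManifold (𝓡 4) ∞ M]
  {φ ψ : OpenPartialHomeomorph M R4} {x : R4}

omit [IsManifold (𝓡 4) ∞ M] in
theorem contDiffAt_comp_symm (hφ : IsCoord φ) (hx : x ∈ φ.target) {f : M → ℝ}
    (hf : ContMDiff (𝓡 4) 𝓘(ℝ, ℝ) ∞ f) : ContDiffAt ℝ ∞ (fun y => f (φ.symm y)) x :=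
  (hf.contMDiffAt.comp x (contMDiffAt_symm_of_mem_maximalAtlas hφ hx)).contDiffAt

omit [IsManifold (𝓡 4) ∞ M] in
theorem IsCoord.restr (hφ : IsCoord φ) {O : Set M} (hO : IsOpen O) : IsCoord (φ.restr O) :=
  restr_mem_maximalAtlas (contDiffGroupoid ∞ (𝓡 4)) hφ hO

omit [IsManifold (𝓡 4) ∞ M] in
theorem isCoordChange_comp_symm (hφ : IsCoord φ) (hψ : IsCoord ψ) :
    IsCoordChange ψ (φ.restr ψ.source) fun y => ψ (φ.symm y) := by
  have ht : ∀ y ∈ (φ.restr ψ.source).target, y ∈ φ.target ∧ φ.symm y ∈ ψ.source := by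
    intro y hy
    rw [OpenPartialHomeomorph.restr_target, ψ.open_source.interior_eq] at hy
    exact hy
  refine ⟨hψ, hφ.restr ψ.open_source, fun y hy => ψ.map_source (ht y hy).2,
    fun y hy => (ψ.left_inv (ht y hy).2).symm, fun y hy => ?_⟩
  exact ((contMDiffAt_of_mem_maximalAtlas hψ (ht y hy).2).comp y
    (contMDiffAt_symm_of_mem_maximalAtlas hφ (ht y hy).1)).contDiffAt

omit [ChartedSpace R4 M] [IsManifold (𝓡 4) ∞ M] in
theorem mem_restr_target (hx : x ∈ φ.target) (hxψ : φ.symm x ∈ ψ.source) :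
    x ∈ (φ.restr ψ.source).target := by
  rw [OpenPartialHomeomorph.restr_target, ψ.open_source.interior_eq]
  exact ⟨hx, hxψ⟩

omit [IsManifold (𝓡 4) ∞ M] in
theorem jacobianDet_eq (hφ : IsCoord φ) (hψ : IsCoord ψ) (hx : x ∈ φ.target)
    (hxψ : φ.symm x ∈ ψ.source) :
    jacobianDet φ ψ x = (jacobian (fun y => ψ (φ.symm y)) x).det :=
  det_fderiv ((isCoordChange_comp_symm hφ hψ).smooth x
    (mem_restr_target hx hxψ)).differentiableAt_infty

omit [IsManifold (𝓡 4) ∞ M] in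
theorem IsCoordChange.det_jacobian_ne_zero {Θ : R4 → R4} (h : IsCoordChange φ ψ Θ)
    (hx : x ∈ ψ.target) : (jacobian Θ x).det ≠ 0 := by
  intro h0
  obtain ⟨v, hv, hv'⟩ := Matrix.exists_mulVec_eq_zero_iff.2 h0
  rw [← toComp_ofComp h.isCoord' hx v, h.mulVec_toComp hx] at hv'
  rw [h.symm_eq x hx] at hv'
  have h1 : ofComp ψ x v = (0 : R4) := by
    have := toComp_injective h.isCoord (h.mem x hx) (hv'.trans (toComp_zero φ _).symm)
    exact this
  refine hv ?_
  rw [← toComp_ofComp h.isCoord' hx v]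
  exact (congrArg (toComp ψ (ψ.symm x)) h1).trans (toComp_zero ψ _)

omit [IsManifold (𝓡 4) ∞ M] in
theorem jacobianDet_ne_zero (hφ : IsCoord φ) (hψ : IsCoord ψ) (hx : x ∈ φ.target)
    (hxψ : φ.symm x ∈ ψ.source) : jacobianDet φ ψ x ≠ 0 := by
  rw [jacobianDet_eq hφ hψ hx hxψ]
  exact (isCoordChange_comp_symm hφ hψ).det_jacobian_ne_zero (mem_restr_target hx hxψ)

omit [ChartedSpace R4 M] [IsManifold (𝓡 4) ∞ M] in
theorem eventually_mem_target_source (hx : x ∈ φ.target) (hxψ : φ.symm x ∈ ψ.source) :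
    ∀ᶠ y in 𝓝 x, y ∈ φ.target ∧ φ.symm y ∈ ψ.source := by
  filter_upwards [φ.open_target.mem_nhds hx,
    (φ.symm.continuousAt hx).preimage_mem_nhds (ψ.open_source.mem_nhds hxψ)] with y h1 h2
  exact ⟨h1, h2⟩

omit [IsManifold (𝓡 4) ∞ M] in
theorem continuousAt_jacobianDet (hφ : IsCoord φ) (hψ : IsCoord ψ) (hx : x ∈ φ.target)
    (hxψ : φ.symm x ∈ ψ.source) : ContinuousAt (jacobianDet φ ψ) x := by
  have hsm := (isCoordChange_comp_symm hφ hψ).smooth x (mem_restr_target hx hxψ)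
  have h1 : ContinuousAt (fun y => (jacobian (fun y => ψ (φ.symm y)) y).det) x :=
    (ContDiffAt.matrix_det (m := ∞) fun a i =>
      ((EuclideanSpace.proj a : R4 →L[ℝ] ℝ).contDiff.contDiffAt.comp x hsm).partialD
        i).continuousAt
  exact h1.congr ((eventually_mem_target_source hx hxψ).mono
    fun y hy => (jacobianDet_eq hφ hψ hy.1 hy.2).symm)

theorem ContinuousAt.eventually_sign_eq {X : Type*} [TopologicalSpace X] {u : X → ℝ} {p : X}
    (hu : ContinuousAt u p) (h0 : u p ≠ 0) : ∀ᶠ q in 𝓝 p, Real.sign (u q) = Real.sign (u p) := by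
  rcases lt_or_gt_of_ne h0 with h | h
  · filter_upwards [hu.eventually (gt_mem_nhds h)] with y h'
    rw [Real.sign_of_neg h, Real.sign_of_neg h']
  · filter_upwards [hu.eventually (lt_mem_nhds h)] with y h'
    rw [Real.sign_of_pos h, Real.sign_of_pos h']

theorem jacobian_comp {Θ Ξ : R4 → R4} {y : R4} (hΞ : DifferentiableAt ℝ Ξ (Θ y))
    (hΘ : DifferentiableAt ℝ Θ y) :
    jacobian (fun z => Ξ (Θ z)) y = jacobian Ξ (Θ y) * jacobian Θ y := by
  ext a i
  rw [Matrix.mul_apply]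
  exact partialD_comp (u := fun z => Ξ z a)
    ((EuclideanSpace.proj a : R4 →L[ℝ] ℝ).differentiableAt.comp _ hΞ) hΘ i

omit [IsManifold (𝓡 4) ∞ M] in
theorem IsCoordChange.jacobianDet_eq_mul {φ' : OpenPartialHomeomorph M R4} {Θ : R4 → R4}
    (h : IsCoordChange φ φ' Θ) (hψ : IsCoord ψ) {y : R4} (hy : y ∈ φ'.target)
    (hyψ : φ'.symm y ∈ ψ.source) :
    jacobianDet φ' ψ y = jacobianDet φ ψ (Θ y) * (jacobian Θ y).det := by
  have hyψ' : φ.symm (Θ y) ∈ ψ.source := by rwa [← h.symm_eq y hy]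
  rw [jacobianDet_eq h.isCoord' hψ hy hyψ, jacobianDet_eq h.isCoord hψ (h.mem y hy) hyψ',
    ← Matrix.det_mul, ← jacobian_comp ((isCoordChange_comp_symm h.isCoord hψ).smooth _
      (mem_restr_target (h.mem y hy) hyψ')).differentiableAt_infty
      (h.smooth y hy).differentiableAt_infty]
  congr 1
  ext a i
  refine Filter.EventuallyEq.partialD_eq ?_ i
  filter_upwards [φ'.open_target.mem_nhds hy] with z hz
  rw [h.symm_eq z hz]

namespace PseudoRiemannianMetric

variable (g : PseudoRiemannianMetric M) {f : M → ℝ}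

theorem sum_inv_comp_mul_partialD (hφ : IsCoord φ) (hx : x ∈ φ.target)
    (hf : ContMDiff (𝓡 4) 𝓘(ℝ, ℝ) ∞ f) :
    ∑ i, ∑ j, (g.comp φ x)⁻¹ i j
        * (partialD i (fun y => f (φ.symm y)) x * partialD j (fun y => f (φ.symm y)) x)
      = g.val (φ.symm x) (g.grad f (φ.symm x)) (g.grad f (φ.symm x)) := by
  rw [g.val_eq_sum hφ hx]
  set v := toComp φ (φ.symm x) (g.grad f (φ.symm x)) with hv
  have h1 : ∀ i, partialD i (fun y => f (φ.symm y)) x = (g.comp φ x).mulVec v i := fun i => by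
    rw [← g.sum_comp_mul_grad hφ hx hf, Matrix.mulVec, dotProduct]
    exact Finset.sum_congr rfl fun k _ => by rw [← hv, g.comp_symm φ x k i, mul_comm]
  have h2 : (g.comp φ x)⁻¹.mulVec ((g.comp φ x).mulVec v) = v := by
    rw [Matrix.mulVec_mulVec, Matrix.nonsing_inv_mul _ (isUnit_iff_ne_zero.2
      (g.det_comp_ne_zero hφ hx)), Matrix.one_mulVec]
  simp only [h1]
  refine Finset.sum_congr rfl fun i _ => ?_
  have h3 : ∀ j, (g.comp φ x)⁻¹ i j * ((g.comp φ x).mulVec v i * (g.comp φ x).mulVec v j)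
      = (g.comp φ x).mulVec v i * ((g.comp φ x)⁻¹ i j * (g.comp φ x).mulVec v j) :=
    fun j => by ring
  simp only [h3, ← Finset.mul_sum]
  have h4 : ∑ j, (g.comp φ x)⁻¹ i j * (g.comp φ x).mulVec v j = v i := congrFun h2 i
  rw [h4, mul_comm, Matrix.mulVec, dotProduct, Finset.mul_sum]
  exact Finset.sum_congr rfl fun j _ => by ring

/-- The Hessian vanishes in the directions of the first two vectors of a null frame that starts
with the gradient and has the appropriate orientation. -/
theorem hessian_eq_zero_of_frame {μ κ : ℝ} (hμ : μ ≠ -1 / 2) (hκ : κ * κ = 1)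
    (hQE : g.IsGeneralizedQuasiEinstein f μ) {A : OrientedAtlas M} (hW : g.WeylVanishesOn A κ)
    (hnull : ∀ p, g.val p (g.grad f p) (g.grad f p) = 0)
    (hφ : IsCoord φ) (hψ : ψ ∈ A.charts) (hx : x ∈ φ.target) (hxψ : φ.symm x ∈ ψ.source)
    {E : Matrix (Fin 4) (Fin 4) ℝ} (hE : E.transpose * g.comp φ x * E = nullForm)
    (hE0 : ∀ a, E a 0 = toComp φ (φ.symm x) (g.grad f (φ.symm x)) a)
    (hsign : Real.sign (jacobianDet φ ψ x * E.det) = -κ) (b : Fin 4) :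
    ∑ a, E a 0 * hessian (g.comp φ) (fun y => f (φ.symm y)) a b x = 0 ∧
      ∑ a, E a 1 * hessian (g.comp φ) (fun y => f (φ.symm y)) a b x = 0 := by
  obtain ⟨hf, lam, hlam, hQE⟩ := hQE
  set G := g.comp φ with hG
  set F : R4 → ℝ := fun y => f (φ.symm y) with hFdef
  have hGsymm : ∀ᶠ y in 𝓝 x, (G y).transpose = G y := .of_forall (g.comp_transpose φ)
  have hGs := g.contDiffAt_comp hφ hx
  have hGdet := g.det_comp_ne_zero hφ hx
  set Θ := quadraticMap x E (normalCoeff G x E) with hΘ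
  have hQ := fun a i j => normalCoeff_symm (E := E) hGsymm a i j
  have hΘ0 : Θ 0 = x := quadraticMap_zero x E
  have hJ0 : jacobian Θ 0 = E := jacobian_quadraticMap_zero x E hQ
  have hEdet : E.det ≠ 0 := by
    intro h0
    have := congrArg Matrix.det hE
    rw [Matrix.det_mul, h0, mul_zero, det_nullForm] at this
    exact zero_ne_one this
  obtain ⟨φ', hc, h0, -, -⟩ := exists_coord hφ isOpen_univ (Set.mem_univ 0)
    (fun y _ => (contDiff_quadraticMap x E).contDiffAt) (by rwa [← hΘ, hΘ0])
    (by rwa [← hΘ, hJ0])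
  rw [← hΘ] at hc
  have h0ψ : φ'.symm 0 ∈ ψ.source := by rwa [hc.symm_eq 0 h0, hΘ0]
  have hsign' : Real.sign (jacobianDet φ' ψ 0) = -κ := by
    rw [hc.jacobianDet_eq_mul (A.isCoord ψ hψ) h0 h0ψ, hΘ0, hJ0, hsign]
  -- `WeylVanishesOn` takes the orientation sign point by point, while
  -- `IsNullNormalAt.hessian_eq_zero` needs one sign s = -κ on a neighbourhood. A nonvanishing
  -- continuous Jacobian determinant keeps its sign.
  have hnear := (continuousAt_jacobianDet hc.isCoord' (A.isCoord ψ hψ) h0 h0ψ).eventually_sign_eq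
    (jacobianDet_ne_zero hc.isCoord' (A.isCoord ψ hψ) h0 h0ψ)
  rw [hsign'] at hnear
  have hcomp : ∀ᶠ y in 𝓝 0, g.comp φ' y
      = (jacobian Θ y).transpose * G (Θ y) * jacobian Θ y := by
    filter_upwards [φ'.open_target.mem_nhds h0] with y hy using hc.comp_eq hy g
  have hnormal : IsNullNormalAt (g.comp φ') 0 := by
    refine ⟨g.contDiffAt_comp hc.isCoord' h0, .of_forall (g.comp_transpose φ'), ?_, fun i j => ?_⟩
    · rw [hcomp.self_of_nhds, hΘ0, hJ0, hE]
    · exact (stationaryAt_of_normalCoeff (E := E) hGs hGdet hGsymm i j).congr_of_eventuallyEq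
        (hcomp.mono fun y hy => congrFun (congrFun hy i) j)
  have hgrad0 : toComp φ' (φ'.symm 0) (g.grad f (φ'.symm 0)) = Pi.single 0 1 := by
    have h1 := hc.mulVec_toComp h0 (g.grad f (φ'.symm 0))
    have h2 : toComp φ (φ'.symm 0) (g.grad f (φ'.symm 0)) = E.mulVec (Pi.single 0 1) := by
      rw [hc.symm_eq 0 h0, hΘ0]
      funext a
      rw [← hE0, Matrix.mulVec_single_one]
      rfl
    rw [hJ0, h2] at h1
    exact Matrix.mulVec_injective_of_isUnit
      ((Matrix.isUnit_iff_isUnit_det _).2 (isUnit_iff_ne_zero.2 hEdet)) h1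
  have hF' : ∀ y ∈ φ'.target, ContDiffAt ℝ ∞ (fun z => f (φ'.symm z)) y :=
    fun y hy => contDiffAt_comp_symm hc.isCoord' hy hf
  have key := hnormal.hessian_eq_zero (F := fun z => f (φ'.symm z))
    (lam := fun z => lam (φ'.symm z)) (s := -κ) (κ := κ) hμ (by linarith) rfl (hF' 0 h0)
    (fun j => ?_) ?_ (contDiffAt_comp_symm hc.isCoord' h0 hlam) ?_ ?_
  rotate_left
  · rw [← g.sum_comp_mul_grad hc.isCoord' h0 hf, hgrad0, hnormal.eq]
    simp [Pi.single_apply]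
  · filter_upwards [φ'.open_target.mem_nhds h0] with y hy
    rw [g.sum_inv_comp_mul_partialD hc.isCoord' hy hf, hnull]
  · filter_upwards [φ'.open_target.mem_nhds h0] with y hy i j
    exact hQE φ' hc.isCoord' y hy i j
  · filter_upwards [eventually_mem_target_source h0 h0ψ, hnear] with y hy hy' θ hθ h
    refine hW φ' hc.isCoord' ψ hψ y hy.1 hy.2 θ hθ ?_
    rwa [hy']
  have hF : ContDiffAt ℝ ∞ F x := contDiffAt_comp_symm hφ hx hf
  have hFeq : (fun z => f (φ'.symm z)) =ᶠ[𝓝 0] fun z => F (Θ z) := by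
    filter_upwards [φ'.open_target.mem_nhds h0] with y hy
    rw [hc.symm_eq y hy]
  -- The second derivatives at the centre are the entries of EᵀHE, with H the Hessian; a zero row of
  -- this product means a zero row of EᵀH, as E is invertible.
  have hmain : ∀ i, (∀ j, partialD i (partialD j fun z => f (φ'.symm z)) 0 = 0) →
      ∀ b, ∑ a, E a i * hessian G F a b x = 0 := by
    intro i hi b
    have h1 : Matrix.vecMul (fun b => ∑ a, E a i * hessian G F a b x) E = 0 := by
      funext j
      have := hi j
      rw [(hFeq.partialD j).partialD_eq, partialD_partialD_comp_quadraticMap hF hGsymm] at this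
      exact this
    have h2 := Matrix.eq_zero_of_vecMul_eq_zero hEdet h1
    exact congrFun h2 b
  exact ⟨hmain 0 (fun j => (key j).1) b, hmain 1 (fun j => (key j).2) b⟩

end PseudoRiemannianMetric

end Transfer

/-! ### Null frames -/

/-- The columns of `E` form a null frame for `h` whose first vector is `u`. -/
structure IsNullFrame (h : Matrix (Fin 4) (Fin 4) ℝ) (u : Fin 4 → ℝ)
    (E : Matrix (Fin 4) (Fin 4) ℝ) : Prop where
  gram : E.transpose * h * E = nullForm
  zero : ∀ a, E a 0 = u a

namespace IsNullFrame

variable {h E E' : Matrix (Fin 4) (Fin 4) ℝ} {u : Fin 4 → ℝ}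

theorem det_ne_zero (hE : IsNullFrame h u E) : E.det ≠ 0 := by
  intro h0
  have := congrArg Matrix.det hE.gram
  rw [Matrix.det_mul, h0, mul_zero, det_nullForm] at this
  exact zero_ne_one this

/-- Exchanging the second and the fourth vector reverses the orientation. -/
theorem exists_det_neg (hE : IsNullFrame h u E) :
    ∃ E', IsNullFrame h u E' ∧ E'.det = -E.det := by
  let P : Matrix (Fin 4) (Fin 4) ℝ := !![1, 0, 0, 0; 0, 0, 0, 1; 0, 0, 1, 0; 0, 1, 0, 0]
  have hP : P.transpose * nullForm * P = nullForm := by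
    ext i j
    fin_cases i <;> fin_cases j <;>
      simp [P, nullForm, Matrix.mul_apply, Fin.sum_univ_four]
  have hPd : P.det = -1 := by
    simp [P, Matrix.det_succ_row_zero, Fin.sum_univ_succ, Fin.succAbove]
  refine ⟨E * P, ⟨?_, fun a => ?_⟩, by rw [Matrix.det_mul, hPd, mul_neg_one]⟩
  · rw [Matrix.transpose_mul]
    calc _ = P.transpose * (E.transpose * h * E) * P := by simp only [Matrix.mul_assoc]
      _ = _ := by rw [hE.gram, hP]
  · rw [← hE.zero]
    simp [P, Matrix.mul_apply, Fin.sum_univ_four]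

/-- Two equally oriented null frames with the same first vector span the same plane. -/
theorem exists_eq_add (hE : IsNullFrame h u E) (hE' : IsNullFrame h u E')
    (hdet : 0 < E.det * E'.det) :
    ∃ α β : ℝ, ∀ a, E' a 1 = α * E a 0 + β * E a 1 := by
  have hu : IsUnit E.det := isUnit_iff_ne_zero.2 hE.det_ne_zero
  -- The transition matrix is an isometry of the null form that fixes its first basis vector, and
  -- its determinant is positive.
  obtain ⟨P, rfl⟩ : ∃ P, E' = E * P := ⟨E⁻¹ * E', by rw [Matrix.mul_nonsing_inv_cancel_left _ _ hu]⟩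
  have hP : P.transpose * nullForm * P = nullForm := by
    calc _ = P.transpose * (E.transpose * h * E) * P := by rw [hE.gram]
      _ = (E * P).transpose * h * (E * P) := by
        simp only [Matrix.transpose_mul, Matrix.mul_assoc]
      _ = _ := hE'.gram
  have hP0 : ∀ a, P a 0 = if a = 0 then 1 else 0 := by
    have h1 : E.mulVec (fun a => P a 0) = E.mulVec (Pi.single 0 1) := by
      funext a
      rw [Matrix.mulVec_single_one]
      exact (hE'.zero a).trans (hE.zero a).symm
    have h2 := Matrix.mulVec_injective_of_isUnit ((Matrix.isUnit_iff_isUnit_det _).2 hu) h1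
    intro a
    have := congrFun h2 a
    simpa [Pi.single_apply] using this
  have hPd : 0 < P.det := by
    rw [Matrix.det_mul, ← mul_assoc] at hdet
    exact (pos_iff_pos_of_mul_pos hdet).1 (mul_self_pos.2 hE.det_ne_zero)
  have h00 := hP0 0
  have h10 := hP0 1
  have h20 := hP0 2
  have h30 := hP0 3
  have e : ∀ i j, (P.transpose * nullForm * P) i j = nullForm i j := fun i j => by rw [hP]
  have e01 := e 0 1
  have e02 := e 0 2
  have e03 := e 0 3
  have e11 := e 1 1
  have e13 := e 1 3
  simp [nullForm, Matrix.mul_apply, Fin.sum_univ_four] at h00 h10 h20 h30 e01 e02 e03 e11 e13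
  simp only [h00, h10, h20, h30, one_mul, zero_mul, add_zero, zero_add] at e01 e02 e03 e11 e13
  simp only [e01, e03, mul_zero, zero_mul, add_zero, zero_add] at e11 e13
  have hd : P.det = P 1 1 * P 3 3 - P 1 3 * P 3 1 := by
    have h1 : P = !![1, P 0 1, P 0 2, P 0 3; 0, P 1 1, P 1 2, P 1 3; 0, 0, 1, 0;
        0, P 3 1, P 3 2, P 3 3] := by
      ext i j
      fin_cases i <;> fin_cases j <;> simp [*]
    rw [h1, Matrix.det_succ_column_zero]
    simp [Fin.sum_univ_succ, Matrix.det_fin_three, Fin.succAbove]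
  -- P induces an isometry of the hyperbolic plane e₀^⊥/e₀. Such a map preserves or exchanges the
  -- two null lines, and the exchange has determinant -1.
  have h31 : P 3 1 = 0 := by
    by_contra h31
    have h11 : P 1 1 = 0 := by
      have : P 1 1 * P 3 1 = 0 := by linarith
      exact (mul_eq_zero.1 this).resolve_right h31
    rw [hd, h11] at hPd
    rw [h11] at e13
    linarith
  refine ⟨P 0 1, P 1 1, fun a => ?_⟩
  rw [Matrix.mul_apply, Fin.sum_univ_four, h31, e01]
  ring

end IsNullFrame

/-- In signature `(2, 2)` every nonzero null vector is part of a null frame. -/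
theorem exists_isNullFrame {h T : Matrix (Fin 4) (Fin 4) ℝ} {u : Fin 4 → ℝ}
    (hT : T.transpose * h * T = Matrix.diagonal ![-1, -1, 1, 1]) (hu : u ≠ 0)
    (hnull : u ⬝ᵥ h.mulVec u = 0) : ∃ E, IsNullFrame h u E := by
  have hTd : T.det ≠ 0 := by
    intro h0
    have := congrArg Matrix.det hT
    rw [Matrix.det_mul, h0, mul_zero, Matrix.det_diagonal] at this
    simp [Fin.prod_univ_four] at this
  obtain ⟨w, rfl⟩ : ∃ w, T.mulVec w = u := ⟨T⁻¹.mulVec u, by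
    rw [Matrix.mulVec_mulVec, Matrix.mul_nonsing_inv _ (isUnit_iff_ne_zero.2 hTd),
      Matrix.one_mulVec]⟩
  have hw : w 2 ^ 2 + w 3 ^ 2 = w 0 ^ 2 + w 1 ^ 2 := by
    have h1 : w ⬝ᵥ (T.transpose * h * T).mulVec w = 0 := by
      rw [← hnull, ← Matrix.mulVec_mulVec, ← Matrix.mulVec_mulVec, Matrix.dotProduct_mulVec,
        Matrix.vecMul_transpose]
    rw [hT] at h1
    simp [Matrix.mulVec_diagonal, dotProduct, Fin.sum_univ_four] at h1
    linarith
  set r := w 0 ^ 2 + w 1 ^ 2 with hr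
  have hr0 : r ≠ 0 := by
    intro h0
    refine hu ?_
    have h1 : w = 0 := by
      funext i
      have h2 : w 2 ^ 2 + w 3 ^ 2 = 0 := hw.trans h0
      rw [hr] at h0
      fin_cases i <;> simp <;>
        nlinarith [sq_nonneg (w 0), sq_nonneg (w 1), sq_nonneg (w 2), sq_nonneg (w 3)]
    rw [h1, Matrix.mulVec_zero]
  -- Write w = (z₁, z₂) in ℂ², so that being null means |z₁|² = |z₂|² = r. The columns are w, iw,
  -- (-z₁, z₂)/(2r) and i(-z₁, z₂)/(2r).
  let B : Matrix (Fin 4) (Fin 4) ℝ :=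
    !![w 0, -w 1, -w 0 / (2 * r), w 1 / (2 * r); w 1, w 0, -w 1 / (2 * r), -w 0 / (2 * r);
      w 2, -w 3, w 2 / (2 * r), -w 3 / (2 * r); w 3, w 2, w 3 / (2 * r), w 2 / (2 * r)]
  have hB : B.transpose * Matrix.diagonal ![-1, -1, 1, 1] * B = nullForm := by
    ext i j
    fin_cases i <;> fin_cases j <;>
      simp [B, nullForm, Matrix.mul_apply, Fin.sum_univ_four] <;> field_simp <;> linarith
  refine ⟨T * B, ?_, fun a => ?_⟩
  · rw [Matrix.transpose_mul, ← hB, ← hT]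
    simp only [Matrix.mul_assoc]
  · simp [B, Matrix.mul_apply, Matrix.mulVec, dotProduct, Fin.sum_univ_four]

/-! ### Smooth null frames -/

/-- The scalar product of two vectors with respect to the matrix `h`. -/
def scalarProd (h : Matrix (Fin 4) (Fin 4) ℝ) (v w : Fin 4 → ℝ) : ℝ := v ⬝ᵥ h.mulVec w

section ScalarProd

variable {h : Matrix (Fin 4) (Fin 4) ℝ}

theorem scalarProd_eq_sum (v w : Fin 4 → ℝ) :
    scalarProd h v w = ∑ i, ∑ j, v i * w j * h i j := by
  rw [scalarProd, dotProduct]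
  refine Finset.sum_congr rfl fun i _ => ?_
  rw [Matrix.mulVec, dotProduct, Finset.mul_sum]
  exact Finset.sum_congr rfl fun j _ => by ring

theorem scalarProd_add_left (v v' w : Fin 4 → ℝ) :
    scalarProd h (v + v') w = scalarProd h v w + scalarProd h v' w := add_dotProduct _ _ _

theorem scalarProd_smul_left (c : ℝ) (v w : Fin 4 → ℝ) :
    scalarProd h (c • v) w = c * scalarProd h v w := smul_dotProduct _ _ _

theorem scalarProd_add_right (v w w' : Fin 4 → ℝ) :
    scalarProd h v (w + w') = scalarProd h v w + scalarProd h v w' := by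
  rw [scalarProd, Matrix.mulVec_add, dotProduct_add]; rfl

theorem scalarProd_smul_right (c : ℝ) (v w : Fin 4 → ℝ) :
    scalarProd h v (c • w) = c * scalarProd h v w := by
  rw [scalarProd, Matrix.mulVec_smul, dotProduct_smul]; rfl

theorem scalarProd_comm (hs : h.transpose = h) (v w : Fin 4 → ℝ) :
    scalarProd h v w = scalarProd h w v := by
  rw [scalarProd, Matrix.dotProduct_mulVec, ← Matrix.mulVec_transpose, hs, dotProduct_comm]; rfl

theorem transpose_mul_mul_apply (E : Matrix (Fin 4) (Fin 4) ℝ) (i j : Fin 4) :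
    (E.transpose * h * E) i j = scalarProd h (fun a => E a i) fun a => E a j := by
  rw [Matrix.mul_assoc, Matrix.mul_apply]
  rfl

end ScalarProd

/-- The null vector paired to one with `u` in the plane spanned by `u` and `w`, where `u` is
null. -/
def nullPartner (h : Matrix (Fin 4) (Fin 4) ℝ) (u w : Fin 4 → ℝ) : Fin 4 → ℝ :=
  (scalarProd h u w)⁻¹ • w + (-(scalarProd h w w / (2 * scalarProd h u w ^ 2))) • u

/-- The orthogonal projection away from a hyperbolic plane. -/
def hyperbolicProj (h : Matrix (Fin 4) (Fin 4) ℝ) (u f v : Fin 4 → ℝ) : Fin 4 → ℝ :=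
  v + ((-scalarProd h v f) • u + (-scalarProd h v u) • f)

/-- A null vector in the hyperbolic plane spanned by `c` and `d`, where `c` is nearly null. -/
def nullAdjust (h : Matrix (Fin 4) (Fin 4) ℝ) (c d : Fin 4 → ℝ) : Fin 4 → ℝ :=
  c + (-(scalarProd h c c / (scalarProd h c d
    + √(scalarProd h c d ^ 2 - scalarProd h c c * scalarProd h d d)))) • d

section GramSchmidt

variable {h : Matrix (Fin 4) (Fin 4) ℝ} (hs : h.transpose = h) {u f v w c d : Fin 4 → ℝ}

theorem scalarProd_nullPartner (hu : scalarProd h u u = 0) (hw : scalarProd h u w ≠ 0) :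
    scalarProd h u (nullPartner h u w) = 1 := by
  simp only [nullPartner, scalarProd_add_right, scalarProd_smul_right, hu]
  field_simp
  ring

include hs in
theorem scalarProd_nullPartner_self (hu : scalarProd h u u = 0) (hw : scalarProd h u w ≠ 0) :
    scalarProd h (nullPartner h u w) (nullPartner h u w) = 0 := by
  simp only [nullPartner, scalarProd_add_right, scalarProd_smul_right, scalarProd_add_left,
    scalarProd_smul_left, hu, scalarProd_comm hs w u]
  field_simp
  ring

theorem scalarProd_nullPartner_of_eq_zero (h1 : scalarProd h v u = 0) (h2 : scalarProd h v w = 0) :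
    scalarProd h v (nullPartner h u w) = 0 := by
  simp only [nullPartner, scalarProd_add_right, scalarProd_smul_right, h1, h2, mul_zero, add_zero]

include hs in
theorem scalarProd_hyperbolicProj_left (hu : scalarProd h u u = 0) (huf : scalarProd h u f = 1) :
    scalarProd h u (hyperbolicProj h u f v) = 0 := by
  simp only [hyperbolicProj, scalarProd_add_right, scalarProd_smul_right, hu, huf,
    scalarProd_comm hs v u]
  ring

include hs in
theorem scalarProd_hyperbolicProj_right (hf : scalarProd h f f = 0) (huf : scalarProd h u f = 1) :
    scalarProd h f (hyperbolicProj h u f v) = 0 := by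
  simp only [hyperbolicProj, scalarProd_add_right, scalarProd_smul_right, hf,
    scalarProd_comm hs f u, huf, scalarProd_comm hs v f]
  ring

include hs in
-- The coefficient t of d solves g(c, c) + 2t g(c, d) + t² g(d, d) = 0. The root is written with the
-- square root in the denominator, so that it remains smooth where g(d, d) = 0 and vanishes when c
-- is null.
theorem scalarProd_nullAdjust_self (hcd : 0 < scalarProd h c d)
    (hdisc : 0 ≤ scalarProd h c d ^ 2 - scalarProd h c c * scalarProd h d d) :
    scalarProd h (nullAdjust h c d) (nullAdjust h c d) = 0 := by
  simp only [nullAdjust, scalarProd_add_right, scalarProd_smul_right, scalarProd_add_left,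
    scalarProd_smul_left, scalarProd_comm hs d c]
  have h1 := Real.sq_sqrt hdisc
  set s := √(scalarProd h c d ^ 2 - scalarProd h c c * scalarProd h d d)
  have h2 : 0 ≤ s := Real.sqrt_nonneg _
  have h3 : scalarProd h c d + s ≠ 0 := by positivity
  field_simp
  linear_combination scalarProd h c c * h1

theorem scalarProd_nullAdjust_of_eq_zero (h1 : scalarProd h v c = 0) (h2 : scalarProd h v d = 0) :
    scalarProd h v (nullAdjust h c d) = 0 := by
  simp only [nullAdjust, scalarProd_add_right, scalarProd_smul_right, h1, h2, mul_zero, add_zero]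

end GramSchmidt

/-- The vectors that complete `u` to a null frame by Gram-Schmidt orthogonalization. -/
def gramSchmidt (h : Matrix (Fin 4) (Fin 4) ℝ) (u : Fin 4 → ℝ) (w : Fin 4 → Fin 4 → ℝ) :
    Fin 4 → Fin 4 → ℝ :=
  let f := nullPartner h u (w 2)
  let c := hyperbolicProj h u f (w 1)
  let d := hyperbolicProj h u f (w 3)
  let b := nullAdjust h c d
  ![u, b, f, nullPartner h b d]

/-- The conditions under which Gram-Schmidt orthogonalization is possible. -/
structure IsNearlyNull (h : Matrix (Fin 4) (Fin 4) ℝ) (u : Fin 4 → ℝ) (w : Fin 4 → Fin 4 → ℝ) :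
    Prop where
  ne_zero : scalarProd h u (w 2) ≠ 0
  pos : 0 < scalarProd h (hyperbolicProj h u (nullPartner h u (w 2)) (w 1))
    (hyperbolicProj h u (nullPartner h u (w 2)) (w 3))
  disc : 0 < scalarProd h (hyperbolicProj h u (nullPartner h u (w 2)) (w 1))
        (hyperbolicProj h u (nullPartner h u (w 2)) (w 3)) ^ 2
      - scalarProd h (hyperbolicProj h u (nullPartner h u (w 2)) (w 1))
          (hyperbolicProj h u (nullPartner h u (w 2)) (w 1))
        * scalarProd h (hyperbolicProj h u (nullPartner h u (w 2)) (w 3))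
          (hyperbolicProj h u (nullPartner h u (w 2)) (w 3))
  ne_zero' : scalarProd h (nullAdjust h (hyperbolicProj h u (nullPartner h u (w 2)) (w 1))
        (hyperbolicProj h u (nullPartner h u (w 2)) (w 3)))
      (hyperbolicProj h u (nullPartner h u (w 2)) (w 3)) ≠ 0

theorem isNullFrame_gramSchmidt {h : Matrix (Fin 4) (Fin 4) ℝ} (hs : h.transpose = h)
    {u : Fin 4 → ℝ} {w : Fin 4 → Fin 4 → ℝ} (hu : scalarProd h u u = 0) (hw : IsNearlyNull h u w) :
    IsNullFrame h u (Matrix.of fun a i => gramSchmidt h u w i a) := by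
  obtain ⟨h2, hcd, hdisc, hbd⟩ := hw
  have hdisc := hdisc.le
  set f := nullPartner h u (w 2) with hf
  set c := hyperbolicProj h u f (w 1) with hc
  set d := hyperbolicProj h u f (w 3) with hd
  set b := nullAdjust h c d with hb
  set e := nullPartner h b d with he
  have huf : scalarProd h u f = 1 := scalarProd_nullPartner hu h2
  have hff : scalarProd h f f = 0 := scalarProd_nullPartner_self hs hu h2
  have huc : scalarProd h u c = 0 := scalarProd_hyperbolicProj_left hs hu huf
  have hud : scalarProd h u d = 0 := scalarProd_hyperbolicProj_left hs hu huf
  have hfc : scalarProd h f c = 0 := scalarProd_hyperbolicProj_right hs hff huf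
  have hfd : scalarProd h f d = 0 := scalarProd_hyperbolicProj_right hs hff huf
  have hbb : scalarProd h b b = 0 := scalarProd_nullAdjust_self hs hcd hdisc
  have hub : scalarProd h u b = 0 := scalarProd_nullAdjust_of_eq_zero huc hud
  have hfb : scalarProd h f b = 0 := scalarProd_nullAdjust_of_eq_zero hfc hfd
  have hbe : scalarProd h b e = 1 := scalarProd_nullPartner hbb hbd
  have hee : scalarProd h e e = 0 := scalarProd_nullPartner_self hs hbb hbd
  have hue : scalarProd h u e = 0 := scalarProd_nullPartner_of_eq_zero hub hud
  have hfe : scalarProd h f e = 0 := scalarProd_nullPartner_of_eq_zero hfb hfd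
  refine ⟨?_, fun a => rfl⟩
  have key : ∀ i j : Fin 4, scalarProd h (![u, b, f, e] i) (![u, b, f, e] j) = nullForm i j := by
    intro i j
    fin_cases i <;> fin_cases j <;>
      simp [nullForm, hu, huf, hff, hbb, hub, hfb, hbe, hee, hue, hfe, scalarProd_comm hs f u,
        scalarProd_comm hs b u, scalarProd_comm hs e u, scalarProd_comm hs b f,
        scalarProd_comm hs e f, scalarProd_comm hs e b]
  ext i j
  rw [transpose_mul_mul_apply]
  exact key i j

/-! ### Smooth dependence of the Gram-Schmidt frame on the point -/

section SmoothFrame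

variable {G : R4 → Matrix (Fin 4) (Fin 4) ℝ} {p : R4} {u v w f c d : R4 → Fin 4 → ℝ}

section
variable (hG : ∀ i j, ContDiffAt ℝ ∞ (fun y => G y i j) p)
include hG

theorem ContDiffAt.scalarProd (hv : ContDiffAt ℝ ∞ v p) (hw : ContDiffAt ℝ ∞ w p) :
    ContDiffAt ℝ ∞ (fun y => scalarProd (G y) (v y) (w y)) p := by
  simp only [scalarProd_eq_sum]
  exact ContDiffAt.sum fun i _ => ContDiffAt.sum fun j _ =>
    ((contDiffAt_pi.1 hv i).mul (contDiffAt_pi.1 hw j)).mul (hG i j)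

theorem ContDiffAt.nullPartner (hu : ContDiffAt ℝ ∞ u p) (hw : ContDiffAt ℝ ∞ w p)
    (h0 : _root_.scalarProd (G p) (u p) (w p) ≠ 0) :
    ContDiffAt ℝ ∞ (fun y => nullPartner (G y) (u y) (w y)) p := by
  have h1 := ContDiffAt.scalarProd hG hu hw
  have h2 := ContDiffAt.scalarProd hG hw hw
  exact ((h1.inv h0).smul hw).add ((h2.div (contDiffAt_const.mul (h1.pow 2))
    (by positivity)).neg.smul hu)

theorem ContDiffAt.hyperbolicProj (hu : ContDiffAt ℝ ∞ u p) (hf : ContDiffAt ℝ ∞ f p)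
    (hv : ContDiffAt ℝ ∞ v p) :
    ContDiffAt ℝ ∞ (fun y => hyperbolicProj (G y) (u y) (f y) (v y)) p :=
  hv.add (((ContDiffAt.scalarProd hG hv hf).neg.smul hu).add
    ((ContDiffAt.scalarProd hG hv hu).neg.smul hf))

theorem ContDiffAt.nullAdjust (hc : ContDiffAt ℝ ∞ c p) (hd : ContDiffAt ℝ ∞ d p)
    (hcd : 0 < _root_.scalarProd (G p) (c p) (d p))
    (hdisc : 0 < _root_.scalarProd (G p) (c p) (d p) ^ 2
      - _root_.scalarProd (G p) (c p) (c p) * _root_.scalarProd (G p) (d p) (d p)) :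
    ContDiffAt ℝ ∞ (fun y => nullAdjust (G y) (c y) (d y)) p := by
  have h1 := ContDiffAt.scalarProd hG hc hc
  have h2 := ContDiffAt.scalarProd hG hc hd
  have h3 := ContDiffAt.scalarProd hG hd hd
  exact hc.add (((h1.div (h2.add (((h2.pow 2).sub (h1.mul h3)).sqrt hdisc.ne'))
    (add_pos_of_pos_of_nonneg hcd (Real.sqrt_nonneg _)).ne').neg).smul hd)

theorem ContDiffAt.gramSchmidt (hu : ContDiffAt ℝ ∞ u p) {w : Fin 4 → Fin 4 → ℝ}
    (hw : IsNearlyNull (G p) (u p) w) (i : Fin 4) :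
    ContDiffAt ℝ ∞ (fun y => gramSchmidt (G y) (u y) w i) p := by
  have hf := ContDiffAt.nullPartner hG hu contDiffAt_const hw.ne_zero
  have hc := ContDiffAt.hyperbolicProj hG hu hf (contDiffAt_const (c := w 1))
  have hd := ContDiffAt.hyperbolicProj hG hu hf (contDiffAt_const (c := w 3))
  have hb := ContDiffAt.nullAdjust hG hc hd hw.pos hw.disc
  have hk := ContDiffAt.nullPartner hG hb hd hw.ne_zero'
  fin_cases i
  exacts [hu, hb, hf, hk]

theorem eventually_isNearlyNull (hu : ContDiffAt ℝ ∞ u p) {w : Fin 4 → Fin 4 → ℝ}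
    (hw : IsNearlyNull (G p) (u p) w) : ∀ᶠ y in 𝓝 p, IsNearlyNull (G y) (u y) w := by
  have hf := ContDiffAt.nullPartner hG hu contDiffAt_const hw.ne_zero
  have hc := ContDiffAt.hyperbolicProj hG hu hf (contDiffAt_const (c := w 1))
  have hd := ContDiffAt.hyperbolicProj hG hu hf (contDiffAt_const (c := w 3))
  have hb := ContDiffAt.nullAdjust hG hc hd hw.pos hw.disc
  have c1 := (ContDiffAt.scalarProd hG hu (contDiffAt_const (c := w 2))).continuousAt
  have c2 := (ContDiffAt.scalarProd hG hc hd).continuousAt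
  have c3 := (ContDiffAt.scalarProd hG hb hd).continuousAt
  have c4 := (((ContDiffAt.scalarProd hG hc hd).pow 2).sub
    ((ContDiffAt.scalarProd hG hc hc).mul (ContDiffAt.scalarProd hG hd hd))).continuousAt
  filter_upwards [c1.eventually_ne hw.ne_zero, c2.eventually (lt_mem_nhds hw.pos),
    c3.eventually_ne hw.ne_zero', c4.eventually (lt_mem_nhds hw.disc)] with y y1 y2 y3 y4
  exact ⟨y1, y2, y4, y3⟩

end

/-- A null frame at a point extends to a smooth null frame with prescribed first vector. -/
theorem exists_smooth_isNullFrame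
    (hG : ∀ᶠ y in 𝓝 p, ∀ i j, ContDiffAt ℝ ∞ (fun y => G y i j) y)
    (hs : ∀ᶠ y in 𝓝 p, (G y).transpose = G y) (hu : ∀ᶠ y in 𝓝 p, ContDiffAt ℝ ∞ u y)
    (hnull : ∀ᶠ y in 𝓝 p, scalarProd (G y) (u y) (u y) = 0)
    {E₀ : Matrix (Fin 4) (Fin 4) ℝ} (hE₀ : IsNullFrame (G p) (u p) E₀) :
    ∃ E : R4 → Matrix (Fin 4) (Fin 4) ℝ, E p = E₀ ∧ ∀ᶠ y in 𝓝 p,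
      (∀ a i, ContDiffAt ℝ ∞ (fun y => E y a i) y) ∧ IsNullFrame (G y) (u y) (E y) := by
  let e : Fin 4 → Fin 4 → ℝ := fun i a => E₀ a i
  have he : ∀ i j, scalarProd (G p) (e i) (e j) = nullForm i j := fun i j => by
    rw [← hE₀.gram, transpose_mul_mul_apply]
  have he0 : u p = e 0 := funext fun a => (hE₀.zero a).symm
  have hn : nullForm = !![0, 0, 1, 0; 0, 0, 0, 1; 1, 0, 0, 0; 0, 1, 0, 0] := rfl
  -- At p the constant vectors already form a null frame, so every stage of the orthogonalization
  -- leaves them unchanged. In particular the open conditions `IsNearlyNull` hold at p.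
  have hf : nullPartner (G p) (e 0) (e 2) = e 2 := by simp [nullPartner, he, hn]
  have hc : hyperbolicProj (G p) (e 0) (e 2) (e 1) = e 1 := by simp [hyperbolicProj, he, hn]
  have hd : hyperbolicProj (G p) (e 0) (e 2) (e 3) = e 3 := by simp [hyperbolicProj, he, hn]
  have hb : nullAdjust (G p) (e 1) (e 3) = e 1 := by simp [nullAdjust, he, hn]
  have hk : nullPartner (G p) (e 1) (e 3) = e 3 := by simp [nullPartner, he, hn]
  have hw : IsNearlyNull (G p) (u p) e := by
    rw [he0]
    refine ⟨?_, ?_, ?_, ?_⟩ <;> simp [hf, hc, hd, hb, he, hn]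
  refine ⟨fun y => Matrix.of fun a i => gramSchmidt (G y) (u y) e i a, ?_, ?_⟩
  · ext a i
    change gramSchmidt (G p) (u p) e i a = e i a
    rw [gramSchmidt, he0]
    simp only [hf, hc, hd, hb, hk]
    fin_cases i <;> rfl
  · filter_upwards [hG, hs, hu, hnull, eventually_isNearlyNull hG.self_of_nhds hu.self_of_nhds hw]
      with y y1 y2 y3 y4 y5
    exact ⟨fun a i => contDiffAt_pi.1 (ContDiffAt.gramSchmidt y1 y3 y5 i) a,
      isNullFrame_gramSchmidt y2 y4 y5⟩

end SmoothFrame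

/-! ### The null plane field spanned by oriented null frames -/

section OrientedFrames

variable {M : Type*} [TopologicalSpace M] [ChartedSpace R4 M] [IsManifold (𝓡 4) ∞ M]
  {φ ψ ψ' : OpenPartialHomeomorph M R4} {x : R4}

theorem Real.sign_mul_of_pos_left {a b : ℝ} (ha : 0 < a) : Real.sign (a * b) = Real.sign b := by
  rcases lt_trichotomy b 0 with h | rfl | h
  · rw [Real.sign_of_neg h, Real.sign_of_neg (mul_neg_of_pos_of_neg ha h)]
  · rw [mul_zero]
  · rw [Real.sign_of_pos h, Real.sign_of_pos (mul_pos ha h)]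

omit [IsManifold (𝓡 4) ∞ M] in
theorem jacobian_mulVec_toComp (hφ : IsCoord φ) (hψ : IsCoord ψ) (hx : x ∈ φ.target)
    (hxψ : φ.symm x ∈ ψ.source) (v : TangentSpace (𝓡 4) (φ.symm x)) :
    (jacobian (fun y => ψ (φ.symm y)) x).mulVec (toComp φ (φ.symm x) v)
      = toComp ψ (φ.symm x) v :=
  (isCoordChange_comp_symm hφ hψ).mulVec_toComp (mem_restr_target hx hxψ) v

omit [IsManifold (𝓡 4) ∞ M] in
theorem det_toComp_ofComp (hφ : IsCoord φ) (hψ : IsCoord ψ) (hx : x ∈ φ.target)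
    (hxψ : φ.symm x ∈ ψ.source) (E : Matrix (Fin 4) (Fin 4) ℝ) :
    (Matrix.of fun a i => toComp ψ (φ.symm x) (ofComp φ x fun b => E b i) a).det
      = jacobianDet φ ψ x * E.det := by
  rw [jacobianDet_eq hφ hψ hx hxψ, ← Matrix.det_mul]
  congr 1
  ext a i
  rw [Matrix.of_apply, ← jacobian_mulVec_toComp hφ hψ hx hxψ, toComp_ofComp hφ hx]
  rfl

omit [IsManifold (𝓡 4) ∞ M] in
theorem jacobianDet_trans (hφ : IsCoord φ) (hψ : IsCoord ψ) (hψ' : IsCoord ψ') (hx : x ∈ φ.target)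
    (hxψ : φ.symm x ∈ ψ.source) (hxψ' : φ.symm x ∈ ψ'.source) :
    jacobianDet φ ψ' x = jacobianDet ψ ψ' (ψ (φ.symm x)) * jacobianDet φ ψ x := by
  rw [jacobianDet_eq hφ hψ hx hxψ]
  exact (isCoordChange_comp_symm hφ hψ).jacobianDet_eq_mul hψ' (mem_restr_target hx hxψ) hxψ'

namespace PseudoRiemannianMetric

variable (g : PseudoRiemannianMetric M) (A : OrientedAtlas M) (f : M → ℝ) (κ : ℝ)

/-- A null frame that starts with the gradient of `f` and whose orientation is given by `-κ`. -/
structure IsAdaptedFrame (q : M) (e : Fin 4 → TangentSpace (𝓡 4) q) : Prop where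
  gram : ∀ i j, g.val q (e i) (e j) = nullForm i j
  zero : e 0 = g.grad f q
  sign : ∀ ψ ∈ A.charts, q ∈ ψ.source →
    Real.sign (Matrix.of fun a i => toComp ψ q (e i) a).det = -κ

/-- The plane field spanned by the first two vectors of the adapted frames. -/
def adaptedPlane (q : M) : Submodule ℝ (TangentSpace (𝓡 4) q) :=
  Submodule.span ℝ {v | ∃ e, g.IsAdaptedFrame A f κ q e ∧ (v = e 0 ∨ v = e 1)}

/-- The components of the gradient are smooth. -/
theorem contDiffAt_toComp_grad {f : M → ℝ} (hf : ContMDiff (𝓡 4) 𝓘(ℝ, ℝ) ∞ f) (hφ : IsCoord φ)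
    (hx : x ∈ φ.target) (k : Fin 4) :
    ContDiffAt ℝ ∞ (fun y => toComp φ (φ.symm y) (g.grad f (φ.symm y)) k) x := by
  have h1 : ContDiffAt ℝ ∞ (fun y => ∑ i, partialD i (fun y => f (φ.symm y)) y
      * (g.comp φ y)⁻¹ i k) x := ContDiffAt.sum fun i _ =>
    ((contDiffAt_comp_symm hφ hx hf).partialD i).mul
      (ContDiffAt.matrix_inv (g.contDiffAt_comp hφ hx) (g.det_comp_ne_zero hφ hx) i k)
  refine h1.congr_of_eventuallyEq ?_
  filter_upwards [φ.open_target.mem_nhds hx] with y hy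
  simp only [← g.sum_comp_mul_grad hφ hy hf]
  have h2 : ∀ v : Fin 4 → ℝ, Matrix.vecMul (Matrix.vecMul v (g.comp φ y)) (g.comp φ y)⁻¹ = v :=
    fun v => by
      rw [Matrix.vecMul_vecMul, Matrix.mul_nonsing_inv _ (isUnit_iff_ne_zero.2
        (g.det_comp_ne_zero hφ hy)), Matrix.vecMul_one]
  exact (congrFun (h2 _) k).symm

variable {g A f κ}

section NullFrame

variable {q : M} {e : Fin 4 → TangentSpace (𝓡 4) q}
  (he : ∀ i j, g.val q (e i) (e j) = nullForm i j)
include he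

theorem linearIndependent_of_gram : LinearIndependent ℝ e := by
  rw [Fintype.linearIndependent_iff]
  intro c hc j
  have h1 := congrArg (fun v => g.val q v (e (j + 2))) hc
  simp only [map_sum, map_smul, sum_apply, smul_apply, smul_eq_mul, he, map_zero, zero_apply]
    at h1
  have h2 : ∑ k, c k * nullForm k (j + 2) = c j := by
    fin_cases j <;> simp [nullForm, Fin.sum_univ_four]
  exact h2.symm.trans h1

theorem eq_zero_of_gram {v : TangentSpace (𝓡 4) q} (hv : ∀ i, g.val q v (e i) = 0) : v = 0 := by
  have : FiniteDimensional ℝ (TangentSpace (𝓡 4) q) := inferInstanceAs (FiniteDimensional ℝ R4)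
  have hf : Module.finrank ℝ (TangentSpace (𝓡 4) q) = 4 :=
    (finrank_euclideanSpace_fin : Module.finrank ℝ R4 = 4)
  have hspan := (linearIndependent_of_gram he).span_eq_top_of_card_eq_finrank' (by simp [hf])
  refine g.nondegenerate q v fun w => ?_
  have hw : w ∈ Submodule.span ℝ (Set.range e) := hspan ▸ Submodule.mem_top
  obtain ⟨c, rfl⟩ := (Submodule.mem_span_range_iff_exists_fun ℝ).1 hw
  simp [map_sum, hv]

/-- The plane spanned by the first two vectors of a null frame is its own orthogonal space. -/
theorem mem_span_iff_of_gram {v : TangentSpace (𝓡 4) q} :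
    v ∈ Submodule.span ℝ {e 0, e 1} ↔ g.val q v (e 0) = 0 ∧ g.val q v (e 1) = 0 := by
  have hn : nullForm = !![0, 0, 1, 0; 0, 0, 0, 1; 1, 0, 0, 0; 0, 1, 0, 0] := rfl
  constructor
  · intro hv
    obtain ⟨a, b, rfl⟩ := Submodule.mem_span_pair.1 hv
    simp [he, hn]
  · rintro ⟨h0, h1⟩
    refine Submodule.mem_span_pair.2 ⟨g.val q v (e 2), g.val q v (e 3), ?_⟩
    refine (sub_eq_zero.1 (eq_zero_of_gram he fun i => ?_)).symm
    rw [map_sub, map_add, map_smul, map_smul]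
    fin_cases i <;> simp [he, hn, h0, h1]

end NullFrame

/-- It suffices to check the orientation in one chart of the atlas, since the transition
determinants are positive. -/
theorem isAdaptedFrame_ofComp (hφ : IsCoord φ) (hψ : ψ ∈ A.charts) (hx : x ∈ φ.target)
    (hxψ : φ.symm x ∈ ψ.source) {E : Matrix (Fin 4) (Fin 4) ℝ}
    (hE : IsNullFrame (g.comp φ x) (toComp φ (φ.symm x) (g.grad f (φ.symm x))) E)
    (hsign : Real.sign (jacobianDet φ ψ x * E.det) = -κ) :
    g.IsAdaptedFrame A f κ (φ.symm x) fun i => ofComp φ x fun a => E a i := by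
  refine ⟨fun i j => ?_, ?_, fun ψ' hψ' hxψ' => ?_⟩
  · rw [g.val_ofComp, ← hE.gram, transpose_mul_mul_apply, scalarProd_eq_sum]
  · rw [funext hE.zero, ofComp_toComp hφ hx]
  · rw [det_toComp_ofComp hφ (A.isCoord _ hψ') hx hxψ',
      jacobianDet_trans hφ (A.isCoord _ hψ) (A.isCoord _ hψ') hx hxψ hxψ', mul_assoc,
      Real.sign_mul_of_pos_left (A.jacobianDet_pos _ hψ _ hψ' _ ⟨hxψ, hxψ'⟩), hsign]

theorem IsAdaptedFrame.isNullFrame {q : M} {e : Fin 4 → TangentSpace (𝓡 4) q}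
    (he : g.IsAdaptedFrame A f κ q e) (hφ : IsCoord φ) (hq : q ∈ φ.source) :
    IsNullFrame (g.comp φ (φ q)) (toComp φ q (g.grad f q))
      (Matrix.of fun a i => toComp φ q (e i) a) := by
  refine ⟨?_, fun a => by rw [← he.zero]; rfl⟩
  ext i j
  rw [transpose_mul_mul_apply, scalarProd_eq_sum, ← he.gram, g.val_eq_sum' hφ hq]
  rfl

/-- Equal orientations put the second vectors of both frames in the same null plane. This makes D
independent of the frame and hence globally defined. -/
theorem IsAdaptedFrame.one_mem_span {q : M} {e e' : Fin 4 → TangentSpace (𝓡 4) q}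
    (hκ : κ * κ = 1) (he : g.IsAdaptedFrame A f κ q e) (he' : g.IsAdaptedFrame A f κ q e') :
    e' 1 ∈ Submodule.span ℝ {e 0, e 1} := by
  obtain ⟨ψ, hψ, hq⟩ := A.cover q
  have hψc := A.isCoord ψ hψ
  have hs : ∀ a b : ℝ, Real.sign a = -κ → Real.sign b = -κ → 0 < a * b := by
    intro a b ha hb
    have hne : κ ≠ 0 := by rintro rfl; simp at hκ
    rcases lt_trichotomy a 0 with h | rfl | h
    · rcases lt_trichotomy b 0 with h' | rfl | h'
      · exact mul_pos_of_neg_of_neg h h'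
      · rw [Real.sign_zero] at hb; exact absurd (neg_eq_zero.1 hb.symm) hne
      · rw [Real.sign_of_neg h] at ha; rw [Real.sign_of_pos h'] at hb; linarith
    · rw [Real.sign_zero] at ha; exact absurd (neg_eq_zero.1 ha.symm) hne
    · rcases lt_trichotomy b 0 with h' | rfl | h'
      · rw [Real.sign_of_pos h] at ha; rw [Real.sign_of_neg h'] at hb; linarith
      · rw [Real.sign_zero] at hb; exact absurd (neg_eq_zero.1 hb.symm) hne
      · exact mul_pos h h'
  obtain ⟨α, β, h⟩ := (he.isNullFrame hψc hq).exists_eq_add (he'.isNullFrame hψc hq)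
    (hs _ _ (he.sign ψ hψ hq) (he'.sign ψ hψ hq))
  refine Submodule.mem_span_pair.2 ⟨α, β, ?_⟩
  obtain ⟨x, hx, rfl⟩ : ∃ x ∈ ψ.target, ψ.symm x = q := ⟨ψ q, ψ.map_source hq, ψ.left_inv hq⟩
  refine toComp_injective hψc hx ?_
  funext a
  rw [toComp_add, toComp_smul, toComp_smul]
  exact (h a).symm

theorem IsAdaptedFrame.adaptedPlane_eq {q : M} {e : Fin 4 → TangentSpace (𝓡 4) q}
    (hκ : κ * κ = 1) (he : g.IsAdaptedFrame A f κ q e) :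
    g.adaptedPlane A f κ q = Submodule.span ℝ {e 0, e 1} := by
  refine le_antisymm (Submodule.span_le.2 ?_) (Submodule.span_le.2 ?_)
  · rintro v ⟨e', he', rfl | rfl⟩
    · rw [he'.zero, ← he.zero]
      exact Submodule.subset_span (Set.mem_insert _ _)
    · exact he.one_mem_span hκ he'
  · rintro v (rfl | rfl)
    exacts [Submodule.subset_span ⟨e, he, .inl rfl⟩, Submodule.subset_span ⟨e, he, .inr rfl⟩]

theorem IsAdaptedFrame.finrank_span {q : M} {e : Fin 4 → TangentSpace (𝓡 4) q}
    (he : g.IsAdaptedFrame A f κ q e) :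
    Module.finrank ℝ (Submodule.span ℝ {e 0, e 1}) = 2 := by
  have h1 : LinearIndependent ℝ ![e 0, e 1] := by
    have := (linearIndependent_of_gram he.gram).comp ![0, 1] (by decide)
    convert this using 1
    ext i
    fin_cases i <;> rfl
  have h2 := finrank_span_eq_card h1
  rwa [Matrix.range_cons_cons_empty, Fintype.card_fin] at h2

variable (hκ : κ * κ = 1) (hsig : g.HasSignatureTwoTwo) (hgrad : ∀ p, g.grad f p ≠ 0)
  (hnull : ∀ p, g.val p (g.grad f p) (g.grad f p) = 0)
include hκ hsig hgrad hnull

/-- A null frame of the wrong orientation is corrected by exchanging e₁ and e₃, which keeps ∇f in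
place. -/
theorem exists_isNullFrame_comp (hφ : IsCoord φ) (hψ : IsCoord ψ) (hx : x ∈ φ.target)
    (hxψ : φ.symm x ∈ ψ.source) :
    ∃ E, IsNullFrame (g.comp φ x) (toComp φ (φ.symm x) (g.grad f (φ.symm x))) E ∧
      Real.sign (jacobianDet φ ψ x * E.det) = -κ := by
  obtain ⟨b, hb⟩ := hsig (φ.symm x)
  have hT : (Matrix.of fun a i => toComp φ (φ.symm x) (b i) a).transpose * g.comp φ x
      * (Matrix.of fun a i => toComp φ (φ.symm x) (b i) a)
      = Matrix.diagonal ![-1, -1, 1, 1] := by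
    ext i j
    rw [transpose_mul_mul_apply, scalarProd_eq_sum, ← hb, g.val_eq_sum hφ hx]
    rfl
  have hu : toComp φ (φ.symm x) (g.grad f (φ.symm x)) ≠ 0 := fun h =>
    hgrad (φ.symm x) (toComp_injective hφ hx (h.trans (toComp_zero φ _).symm))
  have hn := hnull (φ.symm x)
  rw [g.val_eq_sum hφ hx, ← scalarProd_eq_sum] at hn
  obtain ⟨E, hE⟩ := exists_isNullFrame hT hu hn
  have h0 : jacobianDet φ ψ x * E.det ≠ 0 :=
    mul_ne_zero (jacobianDet_ne_zero hφ hψ hx hxψ) hE.det_ne_zero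
  obtain ⟨E', hE', hd⟩ := hE.exists_det_neg
  have hn : jacobianDet φ ψ x * E'.det = -(jacobianDet φ ψ x * E.det) := by rw [hd, mul_neg]
  have hκ' : κ = 1 ∨ κ = -1 := mul_self_eq_one_iff.1 hκ
  rcases lt_or_gt_of_ne h0 with h | h <;> rcases hκ' with rfl | rfl
  · exact ⟨E, hE, Real.sign_of_neg h⟩
  · exact ⟨E', hE', by rw [hn, Real.sign_of_pos (neg_pos.2 h), neg_neg]⟩
  · exact ⟨E', hE', by rw [hn, Real.sign_of_neg (neg_lt_zero.2 h)]⟩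
  · exact ⟨E, hE, by rw [Real.sign_of_pos h, neg_neg]⟩

theorem exists_isAdaptedFrame (q : M) : ∃ e, g.IsAdaptedFrame A f κ q e := by
  obtain ⟨ψ, hψ, hq⟩ := A.cover q
  obtain ⟨x, hx, rfl⟩ : ∃ x ∈ ψ.target, ψ.symm x = q := ⟨ψ q, ψ.map_source hq, ψ.left_inv hq⟩
  obtain ⟨E, hE, hs⟩ := exists_isNullFrame_comp hκ hsig hgrad hnull (A.isCoord ψ hψ)
    (A.isCoord ψ hψ) hx hq
  exact ⟨_, isAdaptedFrame_ofComp (A.isCoord ψ hψ) hψ hx hq hE hs⟩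

/-- Near every point of a chart there is a smooth adapted frame. -/
theorem exists_smooth_adaptedFrame (hf : ContMDiff (𝓡 4) 𝓘(ℝ, ℝ) ∞ f) (hφ : IsCoord φ)
    (hx : x ∈ φ.target) :
    ∃ E : R4 → Matrix (Fin 4) (Fin 4) ℝ, ∃ ψ ∈ A.charts, ∀ᶠ y in 𝓝 x, y ∈ φ.target ∧
      φ.symm y ∈ ψ.source ∧ (∀ a i, ContDiffAt ℝ ∞ (fun y => E y a i) y) ∧
        IsNullFrame (g.comp φ y) (toComp φ (φ.symm y) (g.grad f (φ.symm y))) (E y) ∧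
        Real.sign (jacobianDet φ ψ y * (E y).det) = -κ := by
  obtain ⟨ψ, hψ, hxψ⟩ := A.cover (φ.symm x)
  have hψc := A.isCoord ψ hψ
  obtain ⟨E₀, hE₀, hs⟩ := exists_isNullFrame_comp hκ hsig hgrad hnull hφ hψc hx hxψ
  have hn : ∀ᶠ y in 𝓝 x, scalarProd (g.comp φ y) (toComp φ (φ.symm y) (g.grad f (φ.symm y)))
      (toComp φ (φ.symm y) (g.grad f (φ.symm y))) = 0 := by
    filter_upwards [φ.open_target.mem_nhds hx] with y hy
    rw [scalarProd_eq_sum, ← g.val_eq_sum hφ hy, hnull]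
  have ht := φ.open_target.mem_nhds hx
  obtain ⟨E, rfl, hE⟩ := exists_smooth_isNullFrame
    (Filter.mem_of_superset ht fun y hy => g.contDiffAt_comp hφ hy)
    (.of_forall (g.comp_transpose φ))
    (Filter.mem_of_superset ht fun y hy => contDiffAt_pi.2 (g.contDiffAt_toComp_grad hf hφ hy))
    hn hE₀
  have hc := (continuousAt_jacobianDet hφ hψc hx hxψ).mul
    (ContDiffAt.matrix_det (m := ∞) hE.self_of_nhds.1).continuousAt
  refine ⟨E, ψ, hψ, ?_⟩
  filter_upwards [eventually_mem_target_source hx hxψ, hE, hc.eventually_sign_eq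
    (mul_ne_zero (jacobianDet_ne_zero hφ hψc hx hxψ) hE₀.det_ne_zero)] with y h1 h2 h3
  exact ⟨h1.1, h1.2, h2.1, h2.2, h3.trans hs⟩

end PseudoRiemannianMetric

end OrientedFrames

/-! ### Null plane fields annihilated by the Hessian are parallel -/

section HessianPlane

variable {M : Type*} [TopologicalSpace M] [ChartedSpace R4 M] [IsManifold (𝓡 4) ∞ M]
  {φ : OpenPartialHomeomorph M R4} {x : R4}

theorem hessian_symm {G : R4 → Matrix (Fin 4) (Fin 4) ℝ} {F : R4 → ℝ} {x : R4}
    (hs : ∀ᶠ y in 𝓝 x, (G y).transpose = G y) (hF : ContDiffAt ℝ ∞ F x) (i j : Fin 4) :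
    hessian G F i j x = hessian G F j i x := by
  rw [hessian, hessian, partialD_comm hF.contDiffAt_two]
  simp only [christoffel_symm hs i j]

namespace PseudoRiemannianMetric

/-- `D` is a smooth maximal null plane field that contains the gradient of `f` and is annihilated
by the Hessian of `f`. -/
structure IsHessianPlane (g : PseudoRiemannianMetric M) (f : M → ℝ)
    (D : ∀ p : M, Submodule ℝ (TangentSpace (𝓡 4) p)) : Prop where
  finrank : ∀ q, Module.finrank ℝ (D q) = 2
  mem_iff : ∀ q v, v ∈ D q ↔ ∀ w ∈ D q, g.val q v w = 0
  grad_mem : ∀ q, g.grad f q ∈ D q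
  hessian : ∀ φ, IsCoord φ → ∀ x ∈ φ.target, ∀ v ∈ D (φ.symm x), ∀ b,
    ∑ a, toComp φ (φ.symm x) v a * hessian (g.comp φ) (fun y => f (φ.symm y)) a b x = 0
  exists_smooth : ∀ φ, IsCoord φ → ∀ x ∈ φ.target, ∃ c : R4 → Fin 4 → ℝ,
    ∀ᶠ y in 𝓝 x, y ∈ φ.target ∧ (∀ k, ContDiffAt ℝ ∞ (fun y => c y k) y) ∧
      D (φ.symm y) = Submodule.span ℝ {g.grad f (φ.symm y), ofComp φ y (c y)}

variable {g : PseudoRiemannianMetric M} {f : M → ℝ}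

/-- The only place where curvature enters the construction of D; parallelism and Walker coordinates
use just the properties collected in `IsHessianPlane`. -/
theorem isHessianPlane_adaptedPlane {A : OrientedAtlas M} {μ κ : ℝ} (hμ : μ ≠ -1 / 2)
    (hκ : κ * κ = 1) (hsig : g.HasSignatureTwoTwo) (hQE : g.IsGeneralizedQuasiEinstein f μ)
    (hW : g.WeylVanishesOn A κ) (hgrad : ∀ p, g.grad f p ≠ 0)
    (hnull : ∀ p, g.val p (g.grad f p) (g.grad f p) = 0) :
    g.IsHessianPlane f (g.adaptedPlane A f κ) := by
  have hex := exists_isAdaptedFrame (A := A) hκ hsig hgrad hnull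
  refine ⟨fun q => ?_, fun q v => ?_, fun q => ?_, fun φ hφ x hx v hv b => ?_, fun φ hφ x hx => ?_⟩
  · obtain ⟨e, he⟩ := hex q
    rw [he.adaptedPlane_eq hκ, he.finrank_span]
  · obtain ⟨e, he⟩ := hex q
    rw [he.adaptedPlane_eq hκ, mem_span_iff_of_gram he.gram]
    constructor
    · rintro ⟨h0, h1⟩ w hw
      obtain ⟨a, b, rfl⟩ := Submodule.mem_span_pair.1 hw
      rw [map_add, map_smul, map_smul, h0, h1, smul_zero, smul_zero, add_zero]
    · exact fun h => ⟨h _ (Submodule.subset_span (by simp)), h _ (Submodule.subset_span (by simp))⟩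
  · obtain ⟨e, he⟩ := hex q
    rw [he.adaptedPlane_eq hκ, ← he.zero]
    exact Submodule.subset_span (by simp)
  · obtain ⟨ψ, hψ, hxψ⟩ := A.cover (φ.symm x)
    obtain ⟨E, hE, hs⟩ := exists_isNullFrame_comp hκ hsig hgrad hnull hφ (A.isCoord ψ hψ) hx hxψ
    have h := g.hessian_eq_zero_of_frame hμ hκ hQE hW hnull hφ hψ hx hxψ hE.gram hE.zero hs b
    rw [(isAdaptedFrame_ofComp hφ hψ hx hxψ hE hs).adaptedPlane_eq hκ] at hv
    obtain ⟨α, β, rfl⟩ := Submodule.mem_span_pair.1 hv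
    simp only [toComp_add, toComp_smul, toComp_ofComp hφ hx, Pi.add_apply, Pi.smul_apply,
      smul_eq_mul, add_mul, Finset.sum_add_distrib, mul_assoc, ← Finset.mul_sum, h.1, h.2,
      mul_zero, add_zero]
  · obtain ⟨E, ψ, hψ, hE⟩ := exists_smooth_adaptedFrame (A := A) hκ hsig hgrad hnull hQE.1 hφ hx
    refine ⟨fun y a => E y a 1, ?_⟩
    filter_upwards [hE] with y ⟨h1, h2, h0, h3, h4⟩
    have he := isAdaptedFrame_ofComp hφ hψ h1 h2 h3 h4
    exact ⟨h1, fun k => h0 k 1, by rw [he.adaptedPlane_eq hκ, he.zero]⟩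

namespace IsHessianPlane

variable {D : ∀ p : M, Submodule ℝ (TangentSpace (𝓡 4) p)} (hD : g.IsHessianPlane f D)
include hD

theorem isNull : g.IsNull D := fun q v hv w hw => (hD.mem_iff q v).1 hv w hw

/-- D is its own orthogonal space, so membership can be tested against two spanning vectors. -/
theorem mem_of_eq_span {q : M} {v a b : TangentSpace (𝓡 4) q}
    (h : D q = Submodule.span ℝ {a, b}) (ha : g.val q v a = 0) (hb : g.val q v b = 0) :
    v ∈ D q := by
  rw [hD.mem_iff, h]
  intro w hw
  obtain ⟨s, t, rfl⟩ := Submodule.mem_span_pair.1 hw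
  rw [map_add, map_smul, map_smul, ha, hb, smul_zero, smul_zero, add_zero]

/-- The gradient and a second smooth vector field span `D` locally. -/
theorem exists_isSmoothVectorFieldOn (p : M) : ∃ O : Set M, IsOpen O ∧ p ∈ O ∧
    ∃ U : ∀ q : M, TangentSpace (𝓡 4) q,
      IsSmoothVectorFieldOn U O ∧ ∀ q ∈ O, D q = Submodule.span ℝ {g.grad f q, U q} := by
  set φ := chartAt R4 p
  have hφ : IsCoord φ := IsManifold.chart_mem_maximalAtlas p
  have hp : p ∈ φ.source := mem_chart_source R4 p
  obtain ⟨c, hc⟩ := hD.exists_smooth φ hφ (φ p) (φ.map_source hp)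
  obtain ⟨V, hV, hVo, hpV⟩ := eventually_nhds_iff.1 hc
  refine ⟨φ.source ∩ φ ⁻¹' V, φ.isOpen_inter_preimage hVo, ⟨hp, hpV⟩, fieldOfComp φ c,
    isSmoothVectorFieldOn_fieldOfComp hφ fun y hy => (hV y hy).2.1, fun q hq => ?_⟩
  obtain ⟨y, hy, rfl⟩ : ∃ y ∈ φ.target, φ.symm y = q := ⟨φ q, φ.map_source hq.1, φ.left_inv hq.1⟩
  have hyV : y ∈ V := by
    have := hq.2
    rwa [Set.mem_preimage, φ.right_inv hy] at this
  rw [fieldOfComp_symm φ c hy]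
  exact (hV y hyV).2.2

end IsHessianPlane

end PseudoRiemannianMetric

end HessianPlane

/-! ### Covariant derivatives of component fields -/

section CovariantDerivative

/-- The components of the covariant derivative of a vector field in the direction `∂_i`. -/
def covComp (G : R4 → Matrix (Fin 4) (Fin 4) ℝ) (i : Fin 4) (Y : R4 → Fin 4 → ℝ) (x : R4)
    (k : Fin 4) : ℝ :=
  partialD i (fun y => Y y k) x + ∑ j, christoffel G i j k x * Y x j

variable {G : R4 → Matrix (Fin 4) (Fin 4) ℝ} {x : R4}

/-- The product rule for the Levi-Civita connection. -/
theorem partialD_scalarProd (hG : ∀ i j, ContDiffAt ℝ ∞ (fun y => G y i j) x)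
    (hdet : (G x).det ≠ 0) (hs : ∀ᶠ y in 𝓝 x, (G y).transpose = G y) {Y Z : R4 → Fin 4 → ℝ}
    (hY : ∀ k, DifferentiableAt ℝ (fun y => Y y k) x)
    (hZ : ∀ k, DifferentiableAt ℝ (fun y => Z y k) x) (i : Fin 4) :
    partialD i (fun y => scalarProd (G y) (Y y) (Z y)) x
      = scalarProd (G x) (covComp G i Y x) (Z x) + scalarProd (G x) (Y x) (covComp G i Z x) := by
  have hd : ∀ a b, DifferentiableAt ℝ (fun y => G y a b) x := fun a b =>
    (hG a b).differentiableAt_infty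
  have h1 : ∀ a b, partialD i (fun y => Y y a * Z y b * G y a b) x
      = partialD i (fun y => Y y a) x * Z x b * G x a b
        + Y x a * partialD i (fun y => Z y b) x * G x a b
        + Y x a * Z x b * (∑ d, christoffel G i a d x * G x d b
          + ∑ d, christoffel G i b d x * G x d a) := fun a b => by
    rw [partialD_mul ((hY a).fun_mul (hZ b)) (hd a b), partialD_mul (hY a) (hZ b),
      partialD_metric hdet hs]
    ring
  simp only [scalarProd_eq_sum]
  rw [partialD_sum _ fun a _ => DifferentiableAt.fun_sum fun b _ =>
    ((hY a).fun_mul (hZ b)).fun_mul (hd a b)]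
  simp only [fun a =>
      partialD_sum Finset.univ (fun b _ => ((hY a).fun_mul (hZ b)).fun_mul (hd a b)) i,
    h1, covComp, add_mul, mul_add, Finset.sum_add_distrib, Finset.sum_mul, Finset.mul_sum]
  have e1 : ∑ a, ∑ b, ∑ d, Y x a * Z x b * (christoffel G i a d x * G x d b)
      = ∑ d, ∑ b, ∑ a, christoffel G i a d x * Y x a * Z x b * G x d b := by
    refine (Finset.sum_congr rfl fun a _ => Finset.sum_comm).trans (Finset.sum_comm.trans
      (Finset.sum_congr rfl fun d _ => Finset.sum_comm.trans (Finset.sum_congr rfl fun b _ =>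
        Finset.sum_congr rfl fun a _ => ?_)))
    ring
  have e2 : ∑ a, ∑ b, ∑ d, Y x a * Z x b * (christoffel G i b d x * G x d a)
      = ∑ a, ∑ d, ∑ b, Y x a * (christoffel G i b d x * Z x b) * G x a d := by
    refine Finset.sum_congr rfl fun a _ => ?_
    rw [Finset.sum_comm]
    refine Finset.sum_congr rfl fun d _ => Finset.sum_congr rfl fun b _ => ?_
    rw [show G x d a = G x a d from congrFun (congrFun hs.self_of_nhds a) d]
    ring
  rw [e1, e2]
  ring

end CovariantDerivative

/-! ### Parallelism of the plane field -/

section Parallel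

variable {M : Type*} [TopologicalSpace M] [ChartedSpace R4 M] [IsManifold (𝓡 4) ∞ M]
  {φ : OpenPartialHomeomorph M R4} {x : R4}

theorem scalarProd_eq_sum_single (h : Matrix (Fin 4) (Fin 4) ℝ) (v w : Fin 4 → ℝ) :
    scalarProd h v w = ∑ a, v a * scalarProd h (Pi.single a 1) w := by
  simp only [scalarProd, single_one_dotProduct]
  rfl

theorem covComp_const (G : R4 → Matrix (Fin 4) (Fin 4) ℝ) (i : Fin 4) (v : Fin 4 → ℝ) (x : R4) :
    covComp G i (fun _ => v) x = fun k => ∑ j, christoffel G i j k x * v j := by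
  funext k
  rw [covComp, partialD_const, zero_add]

namespace PseudoRiemannianMetric

variable {g : PseudoRiemannianMetric M} {f : M → ℝ}

theorem covDeriv_eq (φ : OpenPartialHomeomorph M R4) (i : Fin 4)
    (Y : ∀ p : M, TangentSpace (𝓡 4) p) (x : R4) :
    g.covDeriv φ i Y x
      = ofComp φ x (covComp (g.comp φ) i (fun y => toComp φ (φ.symm y) (Y (φ.symm y))) x) := rfl

theorem scalarProd_comp (hφ : IsCoord φ) (hx : x ∈ φ.target)
    (v w : TangentSpace (𝓡 4) (φ.symm x)) :
    scalarProd (g.comp φ x) (toComp φ (φ.symm x) v) (toComp φ (φ.symm x) w)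
      = g.val (φ.symm x) v w := by
  rw [scalarProd_eq_sum, g.val_eq_sum hφ hx]

theorem isSmoothVectorFieldOn_grad (hf : ContMDiff (𝓡 4) 𝓘(ℝ, ℝ) ∞ f) (hφ : IsCoord φ) :
    IsSmoothVectorFieldOn (g.grad f) φ.source := by
  have h := isSmoothVectorFieldOn_fieldOfComp hφ (V := φ.target)
    (c := fun y => toComp φ (φ.symm y) (g.grad f (φ.symm y)))
    fun y hy k => g.contDiffAt_toComp_grad hf hφ hy k
  refine (h.mono fun q hq => ⟨hq, φ.map_source hq⟩).congr fun q hq => ?_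
  obtain ⟨y, hy, rfl⟩ : ∃ y ∈ φ.target, φ.symm y = q := ⟨φ q, φ.map_source hq, φ.left_inv hq⟩
  rw [fieldOfComp_symm φ _ hy, ofComp_toComp hφ hy]

theorem scalarProd_comp_grad (hf : ContMDiff (𝓡 4) 𝓘(ℝ, ℝ) ∞ f) (hφ : IsCoord φ)
    (hx : x ∈ φ.target) (v : Fin 4 → ℝ) :
    scalarProd (g.comp φ x) v (toComp φ (φ.symm x) (g.grad f (φ.symm x)))
      = ∑ j, v j * partialD j (fun y => f (φ.symm y)) x := by
  rw [scalarProd, dotProduct]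
  refine Finset.sum_congr rfl fun j _ => ?_
  rw [← g.sum_comp_mul_grad hφ hx hf, Matrix.mulVec, dotProduct]
  congr 1
  exact Finset.sum_congr rfl fun k _ => by rw [g.comp_symm φ x j k, mul_comm]

/-- The covariant derivative of the gradient is the Hessian. -/
theorem scalarProd_covComp_grad (hf : ContMDiff (𝓡 4) 𝓘(ℝ, ℝ) ∞ f) (hφ : IsCoord φ)
    (hx : x ∈ φ.target) (i : Fin 4) (v : Fin 4 → ℝ) :
    scalarProd (g.comp φ x) v
        (covComp (g.comp φ) i (fun y => toComp φ (φ.symm y) (g.grad f (φ.symm y))) x)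
      = ∑ a, v a * hessian (g.comp φ) (fun y => f (φ.symm y)) i a x := by
  rw [scalarProd_eq_sum_single]
  refine Finset.sum_congr rfl fun a _ => ?_
  congr 1
  have h1 := partialD_scalarProd (g.contDiffAt_comp hφ hx) (g.det_comp_ne_zero hφ hx)
    (.of_forall (g.comp_transpose φ)) (Y := fun _ => Pi.single a 1)
    (Z := fun y => toComp φ (φ.symm y) (g.grad f (φ.symm y)))
    (fun k => differentiableAt_const _)
    (fun k => (g.contDiffAt_toComp_grad hf hφ hx k).differentiableAt_infty) i
  have h2 : (fun y => scalarProd (g.comp φ y) (Pi.single a 1)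
      (toComp φ (φ.symm y) (g.grad f (φ.symm y)))) =ᶠ[𝓝 x]
      partialD a (fun y => f (φ.symm y)) := by
    filter_upwards [φ.open_target.mem_nhds hx] with y hy
    rw [scalarProd_comp_grad hf hφ hy]
    simp [Pi.single_apply]
  rw [h2.partialD_eq, covComp_const, scalarProd_comp_grad hf hφ hx] at h1
  rw [hessian, h1]
  simp [Pi.single_apply]

namespace IsHessianPlane

variable {D : ∀ p : M, Submodule ℝ (TangentSpace (𝓡 4) p)} (hD : g.IsHessianPlane f D)
  (hf : ContMDiff (𝓡 4) 𝓘(ℝ, ℝ) ∞ f) (hφ : IsCoord φ) (hx : x ∈ φ.target)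
include hD hφ hx

omit hφ hx in
theorem scalarProd_eq_zero {v w : Fin 4 → ℝ} (hv : ofComp φ x v ∈ D (φ.symm x))
    (hw : ofComp φ x w ∈ D (φ.symm x)) : scalarProd (g.comp φ x) v w = 0 := by
  rw [scalarProd_eq_sum, ← g.val_ofComp]
  exact hD.isNull _ _ hv _ hw

theorem scalarProd_covComp_add {Y Z : R4 → Fin 4 → ℝ}
    (hY : ∀ k, DifferentiableAt ℝ (fun y => Y y k) x)
    (hZ : ∀ k, DifferentiableAt ℝ (fun y => Z y k) x)
    (hYD : ∀ᶠ y in 𝓝 x, ofComp φ y (Y y) ∈ D (φ.symm y))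
    (hZD : ∀ᶠ y in 𝓝 x, ofComp φ y (Z y) ∈ D (φ.symm y)) (i : Fin 4) :
    scalarProd (g.comp φ x) (covComp (g.comp φ) i Y x) (Z x)
      + scalarProd (g.comp φ x) (Y x) (covComp (g.comp φ) i Z x) = 0 := by
  rw [← partialD_scalarProd (g.contDiffAt_comp hφ hx) (g.det_comp_ne_zero hφ hx)
    (.of_forall (g.comp_transpose φ)) hY hZ]
  have h : (fun y => scalarProd (g.comp φ y) (Y y) (Z y)) =ᶠ[𝓝 x] fun _ => 0 := by
    filter_upwards [φ.open_target.mem_nhds hx, hYD, hZD] with y hy h1 h2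
    exact hD.scalarProd_eq_zero h1 h2
  rw [h.partialD_eq, partialD_const]

include hf

theorem sum_mul_hessian {v : Fin 4 → ℝ} (hv : ofComp φ x v ∈ D (φ.symm x)) (i : Fin 4) :
    ∑ a, v a * _root_.hessian (g.comp φ) (fun y => f (φ.symm y)) i a x = 0 := by
  have h := hD.hessian φ hφ x hx _ hv i
  rw [toComp_ofComp hφ hx] at h
  simpa only [hessian_symm (.of_forall (g.comp_transpose φ)) (contDiffAt_comp_symm hφ hx hf) i]
    using h

/-- From g(Y, ∇f) = 0 one gets g(∇_i Y, ∇f) = -Hes_f(∂_i, Y), and the Hessian annihilates D. -/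
theorem scalarProd_covComp_grad_eq_zero {Y : R4 → Fin 4 → ℝ}
    (hY : ∀ k, DifferentiableAt ℝ (fun y => Y y k) x)
    (hYD : ∀ᶠ y in 𝓝 x, ofComp φ y (Y y) ∈ D (φ.symm y)) (i : Fin 4) :
    scalarProd (g.comp φ x) (covComp (g.comp φ) i Y x)
      (toComp φ (φ.symm x) (g.grad f (φ.symm x))) = 0 := by
  have h := hD.scalarProd_covComp_add hφ hx hY
    (Z := fun y => toComp φ (φ.symm y) (g.grad f (φ.symm y)))
    (fun k => (g.contDiffAt_toComp_grad hf hφ hx k).differentiableAt_infty) hYD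
    (by
      filter_upwards [φ.open_target.mem_nhds hx] with y hy
      rw [ofComp_toComp hφ hy]
      exact hD.grad_mem _) i
  rwa [scalarProd_covComp_grad hf hφ hx, hD.sum_mul_hessian hf hφ hx hYD.self_of_nhds,
    add_zero] at h

/-- The covariant derivatives of a section of `D` are in `D`. -/
theorem ofComp_covComp_mem {Y : R4 → Fin 4 → ℝ}
    (hY : ∀ k, DifferentiableAt ℝ (fun y => Y y k) x)
    (hYD : ∀ᶠ y in 𝓝 x, ofComp φ y (Y y) ∈ D (φ.symm y)) (i : Fin 4) :
    ofComp φ x (covComp (g.comp φ) i Y x) ∈ D (φ.symm x) := by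
  obtain ⟨c, hc⟩ := hD.exists_smooth φ hφ x hx
  have hcs : ∀ k, DifferentiableAt ℝ (fun y => c y k) x := fun k =>
    (hc.self_of_nhds.2.1 k).differentiableAt_infty
  have hcD : ∀ᶠ y in 𝓝 x, ofComp φ y (c y) ∈ D (φ.symm y) := by
    filter_upwards [hc] with y hy
    rw [hy.2.2]
    exact Submodule.subset_span (by simp)
  have hspan := hc.self_of_nhds.2.2
  set u := toComp φ (φ.symm x) (g.grad f (φ.symm x)) with hu
  have huv : ofComp φ x u = g.grad f (φ.symm x) := ofComp_toComp hφ hx _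
  have hval : ∀ v w : Fin 4 → ℝ, g.val (φ.symm x) (ofComp φ x v) (ofComp φ x w)
      = scalarProd (g.comp φ x) v w := fun v w => by rw [scalarProd_eq_sum, g.val_ofComp]
  -- Orthogonality to ∇f is the previous lemma. For the second generator c, g(∇Y, c) = -g(Y, ∇c). As
  -- Y is a combination of ∇f and c, it remains that ∇c is orthogonal to ∇f, again by that lemma,
  -- and to c, since g(c, c) = 0.
  refine hD.mem_of_eq_span hspan ?_ ?_
  · rw [← huv, hval, hD.scalarProd_covComp_grad_eq_zero hf hφ hx hY hYD]
  · have h1 := hD.scalarProd_covComp_add hφ hx hY hcs hYD hcD i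
    have h2 := hD.scalarProd_covComp_add hφ hx hcs hcs hcD hcD i
    have h3 := hD.scalarProd_covComp_grad_eq_zero hf hφ hx hcs hcD i
    have hs := g.comp_transpose φ x
    rw [scalarProd_comm hs] at h2 h3
    obtain ⟨α, β, hαβ⟩ := Submodule.mem_span_pair.1 (hspan ▸ hYD.self_of_nhds)
    have hYx : Y x = α • u + β • c x := by
      rw [← toComp_ofComp hφ hx (Y x), ← hαβ, toComp_add, toComp_smul, toComp_smul,
        toComp_ofComp hφ hx]
    rw [hYx, scalarProd_add_left, scalarProd_smul_left, scalarProd_smul_left, h3,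
      show scalarProd (g.comp φ x) (c x) (covComp (g.comp φ) i c x) = 0 by linarith, mul_zero,
      mul_zero, add_zero, add_zero] at h1
    rw [hval, h1]

omit hφ hx in
theorem isParallel : g.IsParallel D := by
  intro O Y hO hY hYD φ hφ x hx hxO i
  rw [covDeriv_eq]
  refine hD.ofComp_covComp_mem hf hφ hx
    (fun k => (hY.contDiffAt_vecComp hO hφ hx hxO k).differentiableAt_infty) ?_ i
  filter_upwards [φ.open_target.mem_nhds hx,
    (φ.symm.continuousAt hx).preimage_mem_nhds (hO.mem_nhds hxO)] with y hy hyO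
  exact (ofComp_toComp hφ hy _).symm ▸ hYD _ hyO

omit hφ hx in
theorem isWalkerStructure : g.IsWalkerStructure D where
  smooth := by
    refine ⟨hD.finrank, fun p => ?_⟩
    obtain ⟨O, hO, hp, U, hU, hDU⟩ := hD.exists_isSmoothVectorFieldOn p
    have hp' := mem_chart_source R4 p
    exact ⟨O ∩ (chartAt R4 p).source, hO.inter (chartAt R4 p).open_source, ⟨hp, hp'⟩, g.grad f, U,
      (isSmoothVectorFieldOn_grad hf (IsManifold.chart_mem_maximalAtlas p)).mono
        Set.inter_subset_right, hU.mono Set.inter_subset_left, fun q hq => hDU q hq.1⟩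
  null := hD.isNull
  parallel := hD.isParallel hf

omit hx in
/-- In coordinates in which the gradient is constant, the Christoffel symbols vanish on `D`. -/
theorem sum_mul_christoffel {u v : Fin 4 → ℝ}
    (hu : ∀ᶠ y in 𝓝 x, toComp φ (φ.symm y) (g.grad f (φ.symm y)) = u)
    (hx : x ∈ φ.target) (hv : ofComp φ x v ∈ D (φ.symm x)) (k : Fin 4) :
    ∑ i, ∑ j, christoffel (g.comp φ) i j k x * v i * u j = 0 := by
  have h0 : ∀ i, covComp (g.comp φ) i (fun y => toComp φ (φ.symm y) (g.grad f (φ.symm y))) x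
      = fun k => ∑ j, christoffel (g.comp φ) i j k x * u j := by
    intro i
    rw [← covComp_const]
    funext k
    have hk : (fun y => toComp φ (φ.symm y) (g.grad f (φ.symm y)) k) =ᶠ[𝓝 x] fun _ => u k :=
      hu.mono fun y hy => congrFun hy k
    rw [covComp, covComp, hk.partialD_eq, hu.self_of_nhds]
  have h1 : ∀ w, scalarProd (g.comp φ x) w
      (fun k => ∑ i, ∑ j, christoffel (g.comp φ) i j k x * v i * u j) = 0 := by
    intro w
    have : (fun k => ∑ i, ∑ j, christoffel (g.comp φ) i j k x * v i * u j)
        = ∑ i, v i • covComp (g.comp φ) i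
          (fun y => toComp φ (φ.symm y) (g.grad f (φ.symm y))) x := by
      funext k
      rw [Finset.sum_apply]
      refine Finset.sum_congr rfl fun i _ => ?_
      rw [h0, Pi.smul_apply, smul_eq_mul, Finset.mul_sum]
      exact Finset.sum_congr rfl fun j _ => by ring
    rw [this, scalarProd, Matrix.mulVec_sum, dotProduct_sum]
    have h2 : ∀ i, w ⬝ᵥ (g.comp φ x).mulVec (v i • covComp (g.comp φ) i
        (fun y => toComp φ (φ.symm y) (g.grad f (φ.symm y))) x)
        = v i * ∑ a, w a * _root_.hessian (g.comp φ) (fun y => f (φ.symm y)) i a x := fun i => by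
      rw [← scalarProd_covComp_grad hf hφ hx, ← scalarProd_smul_right]
      rfl
    simp only [h2, Finset.mul_sum]
    rw [Finset.sum_comm]
    refine Finset.sum_eq_zero fun a _ => ?_
    calc _ = w a * ∑ i, v i * _root_.hessian (g.comp φ) (fun y => f (φ.symm y)) a i x := by
          rw [Finset.mul_sum]
          refine Finset.sum_congr rfl fun i _ => ?_
          rw [hessian_symm (.of_forall (g.comp_transpose φ)) (contDiffAt_comp_symm hφ hx hf) i a]
          ring
      _ = 0 := by rw [hD.sum_mul_hessian hf hφ hx hv, mul_zero]
  have h2 : (g.comp φ x).mulVec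
      (fun k => ∑ i, ∑ j, christoffel (g.comp φ) i j k x * v i * u j) = 0 := by
    funext a
    have := h1 (Pi.single a 1)
    rwa [scalarProd, single_one_dotProduct] at this
  have h3 := Matrix.eq_zero_of_mulVec_eq_zero (g.det_comp_ne_zero hφ hx) h2
  exact congrFun h3 k

end IsHessianPlane

end PseudoRiemannianMetric

end Parallel

/-! ### Superposition operators on spaces of continuous maps -/

section Superposition

variable {K : Type} [TopologicalSpace K] [CompactSpace K]
  {E F : Type} [NormedAddCommGroup E] [NormedSpace ℝ E] [NormedAddCommGroup F] [NormedSpace ℝ F]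

/-- Pointwise application of a continuous family of operators, as a bilinear map. -/
def pointwiseApplyₗ : C(K, E →L[ℝ] F) →ₗ[ℝ] C(K, E) →ₗ[ℝ] C(K, F) :=
  LinearMap.mk₂ ℝ
    (fun A h => (⟨fun t => A t (h t), A.continuous.clm_apply h.continuous⟩ : C(K, F)))
    (fun _ _ _ => by ext; simp) (fun _ _ _ => by ext; simp) (fun _ _ _ => by ext; simp)
    (fun _ _ _ => by ext; simp)

theorem norm_pointwiseApplyₗ_le (A : C(K, E →L[ℝ] F)) (h : C(K, E)) :
    ‖pointwiseApplyₗ A h‖ ≤ 1 * ‖A‖ * ‖h‖ := by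
  rw [one_mul]
  refine (ContinuousMap.norm_le _ (mul_nonneg (norm_nonneg A) (norm_nonneg h))).2 fun t => ?_
  exact ((A t).le_opNorm _).trans
    (mul_le_mul (A.norm_coe_le_norm t) (h.norm_coe_le_norm t) (norm_nonneg _) (norm_nonneg _))

/-- Pointwise application of a continuous family of operators. -/
def pointwiseApply : C(K, E →L[ℝ] F) →L[ℝ] C(K, E) →L[ℝ] C(K, F) :=
  LinearMap.mkContinuous₂ (E := C(K, E →L[ℝ] F)) (F := C(K, E)) (G := C(K, F)) (σ₁₃ := RingHom.id ℝ)
    (σ₂₃ := RingHom.id ℝ) pointwiseApplyₗ 1 norm_pointwiseApplyₗ_le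

/-- The remainder is estimated uniformly in t because f' is uniformly close to its values on the
compact range of γ. -/
theorem hasFDerivAt_comp_left (f : C(E, F)) (f' : C(E, E →L[ℝ] F))
    (hf : ∀ x, HasFDerivAt f (f' x) x) (γ : C(K, E)) :
    HasFDerivAt (fun γ : C(K, E) => f.comp γ) (pointwiseApply (f'.comp γ)) γ := by
  rw [hasFDerivAt_iff_isLittleO_nhds_zero, Asymptotics.isLittleO_iff]
  intro ε hε
  have hc : IsCompact (Set.range γ) := isCompact_range γ.continuous
  have hu := hc.uniformContinuousAt_of_continuousAt f' (fun x _ => f'.continuous.continuousAt)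
    (Metric.dist_mem_uniformity hε)
  obtain ⟨δ, hδ, hδ'⟩ := Metric.mem_uniformity_dist.1 hu
  filter_upwards [Metric.ball_mem_nhds (0 : C(K, E)) hδ] with h hh
  rw [mem_ball_zero_iff] at hh
  refine (ContinuousMap.norm_le _ (by positivity)).2 fun t => ?_
  have h1 := (convex_ball (γ t) δ).norm_image_sub_le_of_norm_hasFDerivWithin_le' (f := f)
    (f' := f') (φ := f' (γ t)) (C := ε) (x := γ t) (y := γ t + h t)
    (fun y _ => (hf y).hasFDerivWithinAt) (fun y hy => ?_) (Metric.mem_ball_self hδ) ?_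
  · rw [add_sub_cancel_left] at h1
    exact h1.trans (mul_le_mul_of_nonneg_left (h.norm_coe_le_norm t) hε.le)
  · have := hδ' (a := γ t) (b := y) (by rwa [dist_comm]) (Set.mem_range_self t)
    rw [Set.mem_ofPred_eq, dist_comm, dist_eq_norm] at this
    exact this.le
  · rw [mem_ball_iff_norm, add_sub_cancel_left]
    exact (h.norm_coe_le_norm t).trans_lt hh

theorem contDiff_comp_left_nat (n : ℕ) {E F : Type} [NormedAddCommGroup E] [NormedSpace ℝ E]
    [NormedAddCommGroup F] [NormedSpace ℝ F] (f : C(E, F)) (hf : ContDiff ℝ ∞ f) :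
    ContDiff ℝ n (fun γ : C(K, E) => f.comp γ) := by
  -- The derivative is pointwise application composed with superposition by f', whose values lie in
  -- E →L[ℝ] F; the target space changes at each stage.
  induction n generalizing F with
  | zero => exact contDiff_zero.2 (ContinuousMap.continuous_postcomp f)
  | succ n ih =>
    have hf' : ContDiff ℝ ∞ (fderiv ℝ f) := hf.fderiv_right (by simp)
    have hd := hasFDerivAt_comp_left (K := K) f ⟨fderiv ℝ f, hf'.continuous⟩
      fun x => (hf.differentiable (by simp) x).hasFDerivAt
    push_cast
    refine contDiff_succ_iff_fderiv.2 ⟨fun γ => (hd γ).differentiableAt, fun h => ?_, ?_⟩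
    · exact absurd h (by simp)
    rw [funext fun γ => (hd γ).fderiv]
    exact (pointwiseApply (K := K) (E := E) (F := F)).contDiff.comp
      (ih ⟨fderiv ℝ f, hf'.continuous⟩ hf')

/-- Superposition with a smooth map is smooth. -/
theorem contDiff_comp_left (f : C(E, F)) (hf : ContDiff ℝ ∞ f) :
    ContDiff ℝ ∞ (fun γ : C(K, E) => f.comp γ) :=
  contDiff_infty.2 fun n => contDiff_comp_left_nat n f hf

end Superposition

/-! ### Smooth flows -/

section Flow

variable {E : Type} [NormedAddCommGroup E] [NormedSpace ℝ E]

/-- The primitive of a continuous curve that vanishes at zero. -/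
def curvePrimitive [CompleteSpace E] : C(Set.Icc (-1 : ℝ) 1, E) →L[ℝ] C(Set.Icc (-1 : ℝ) 1, E) :=
  let V : C(Set.Icc (-1 : ℝ) 1, E) →ₗ[ℝ] C(Set.Icc (-1 : ℝ) 1, E) :=
    { toFun := fun γ =>
        ⟨fun t => ∫ τ in (0 : ℝ)..t, Set.IccExtend (neg_le_self (zero_le_one' ℝ)) γ τ,
        (intervalIntegral.continuous_primitive (fun a b =>
          (γ.continuous.Icc_extend').intervalIntegrable a b) 0).comp continuous_subtype_val⟩
      map_add' := fun γ η => by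
        ext t
        exact intervalIntegral.integral_add (γ.continuous.Icc_extend'.intervalIntegrable _ _)
          (η.continuous.Icc_extend'.intervalIntegrable _ _)
      map_smul' := fun c γ => by
        ext t
        exact intervalIntegral.integral_smul c _ }
  V.mkContinuous 1 fun (γ : C(Set.Icc (-1 : ℝ) 1, E)) => by
    rw [one_mul]
    refine (ContinuousMap.norm_le _ (norm_nonneg γ)).2 fun t => ?_
    refine (intervalIntegral.norm_integral_le_of_norm_le_const (C := ‖γ‖) fun τ _ =>
      γ.norm_coe_le_norm _).trans ?_
    rw [sub_zero]
    exact mul_le_of_le_one_right (norm_nonneg _) (abs_le.2 t.2)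

theorem curvePrimitive_apply [CompleteSpace E] (γ : C(Set.Icc (-1 : ℝ) 1, E))
    (t : Set.Icc (-1 : ℝ) 1) :
    curvePrimitive γ t = ∫ τ in (0 : ℝ)..t, Set.IccExtend (neg_le_self (zero_le_one' ℝ)) γ τ := rfl

variable [CompleteSpace E]

/-- The map whose zeros in the last component are the rescaled integral curves of `X`. -/
def flowEquation (X : C(E, E)) (p : ℝ × E × C(Set.Icc (-1 : ℝ) 1, E)) :
    ℝ × E × C(Set.Icc (-1 : ℝ) 1, E) :=
  (p.1, p.2.1, p.2.2 - ContinuousMap.const _ p.2.1 - p.1 • curvePrimitive (X.comp p.2.2))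

theorem contDiff_flowEquation (X : C(E, E)) (hX : ContDiff ℝ ∞ X) :
    ContDiff ℝ ∞ (flowEquation X) := by
  have h1 : ContDiff ℝ ∞ fun p : ℝ × E × C(Set.Icc (-1 : ℝ) 1, E) => p.2.2 :=
    contDiff_snd.comp contDiff_snd
  have h2 : ContDiff ℝ ∞ fun p : ℝ × E × C(Set.Icc (-1 : ℝ) 1, E) => p.2.1 :=
    contDiff_fst.comp contDiff_snd
  have h3 : ContDiff ℝ ∞ fun p : ℝ × E × C(Set.Icc (-1 : ℝ) 1, E) =>
      ContinuousMap.const (Set.Icc (-1 : ℝ) 1) p.2.1 :=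
    (ContinuousLinearMap.const ℝ (Set.Icc (-1 : ℝ) 1) : E →L[ℝ] _).contDiff.comp h2
  exact contDiff_fst.prodMk (h2.prodMk ((h1.sub h3).sub
    (contDiff_fst.smul ((curvePrimitive (E := E)).contDiff.comp
      ((contDiff_comp_left X hX).comp h1)))))

/-- The derivative of the flow equation at time zero. -/
def flowEquationDeriv (X : C(E, E)) (γ : C(Set.Icc (-1 : ℝ) 1, E)) :
    (ℝ × E × C(Set.Icc (-1 : ℝ) 1, E)) ≃L[ℝ] ℝ × E × C(Set.Icc (-1 : ℝ) 1, E) where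
  toFun p := (p.1, p.2.1, p.2.2 - ContinuousMap.const _ p.2.1 - p.1 • curvePrimitive (X.comp γ))
  invFun p := (p.1, p.2.1, p.2.2 + ContinuousMap.const _ p.2.1 + p.1 • curvePrimitive (X.comp γ))
  map_add' p q := by
    refine Prod.ext rfl (Prod.ext rfl ?_)
    ext t
    simp [add_smul]
    abel
  map_smul' c p := by
    refine Prod.ext rfl (Prod.ext rfl ?_)
    ext t
    simp [smul_sub, mul_smul]
  left_inv p := Prod.ext rfl (Prod.ext rfl (by ext t; simp; abel))
  right_inv p := Prod.ext rfl (Prod.ext rfl (by ext t; simp; abel))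
  continuous_toFun := by
    have := (ContinuousLinearMap.const ℝ (Set.Icc (-1 : ℝ) 1) : E →L[ℝ] _).continuous
    exact continuous_fst.prodMk (continuous_snd.fst.prodMk
      ((continuous_snd.snd.sub (this.comp continuous_snd.fst)).sub
        (continuous_fst.smul continuous_const)))
  continuous_invFun := by
    have := (ContinuousLinearMap.const ℝ (Set.Icc (-1 : ℝ) 1) : E →L[ℝ] _).continuous
    exact continuous_fst.prodMk (continuous_snd.fst.prodMk
      ((continuous_snd.snd.add (this.comp continuous_snd.fst)).add
        (continuous_fst.smul continuous_const)))

/-- At parameter 0 the nonlinear term contributes only through the derivative of its scalar factor.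
The derivative is triangular with identities on the diagonal, hence invertible. -/
theorem hasFDerivAt_flowEquation (X : C(E, E)) (hX : ContDiff ℝ ∞ X) (x : E)
    (γ : C(Set.Icc (-1 : ℝ) 1, E)) :
    HasFDerivAt (flowEquation X) (flowEquationDeriv X γ : _ →L[ℝ] _) (0, x, γ) := by
  have h1 : HasFDerivAt (fun p : ℝ × E × C(Set.Icc (-1 : ℝ) 1, E) => p.2.2)
      ((ContinuousLinearMap.snd ℝ _ _).comp (ContinuousLinearMap.snd ℝ _ _)) (0, x, γ) :=
    hasFDerivAt_snd.comp _ hasFDerivAt_snd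
  have h2 : HasFDerivAt (fun p : ℝ × E × C(Set.Icc (-1 : ℝ) 1, E) => p.2.1)
      ((ContinuousLinearMap.fst ℝ _ _).comp (ContinuousLinearMap.snd ℝ _ _)) (0, x, γ) :=
    hasFDerivAt_fst.comp _ hasFDerivAt_snd
  have h3 : HasFDerivAt (fun p : ℝ × E × C(Set.Icc (-1 : ℝ) 1, E) =>
      ContinuousMap.const (Set.Icc (-1 : ℝ) 1) p.2.1) _ (0, x, γ) :=
    (ContinuousLinearMap.const ℝ (Set.Icc (-1 : ℝ) 1) : E →L[ℝ] _).hasFDerivAt.comp _ h2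
  have hs : ContDiff ℝ ∞ fun p : ℝ × E × C(Set.Icc (-1 : ℝ) 1, E) =>
      curvePrimitive (X.comp p.2.2) := (curvePrimitive (E := E)).contDiff.comp
    ((contDiff_comp_left X hX).comp (contDiff_snd.comp contDiff_snd))
  have h4 := (hs.differentiable (by simp) (0, x, γ)).hasFDerivAt
  have h5 : HasFDerivAt (fun p : ℝ × E × C(Set.Icc (-1 : ℝ) 1, E) => p.1)
      (ContinuousLinearMap.fst ℝ _ _) (0, x, γ) := hasFDerivAt_fst
  have h := h5.prodMk (h2.prodMk ((h1.sub h3).sub (h5.smul h4)))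
  refine h.congr_fderiv ?_
  refine ContinuousLinearMap.ext fun p => Prod.ext ?_ (Prod.ext ?_ ?_)
  · rfl
  · rfl
  · ext t
    simp [flowEquationDeriv]

/-- Local existence, uniqueness and smooth dependence of integral curves. -/
theorem exists_smooth_flow (X : C(E, E)) (hX : ContDiff ℝ ∞ X) (x₀ : E) :
    ∃ Φ : ℝ × E → E, (∀ᶠ p in 𝓝 ((0 : ℝ), x₀), ContDiffAt ℝ ∞ Φ p ∧
      HasDerivAt (fun σ => Φ (σ, p.2)) (X (Φ p)) p.1) ∧ ∀ᶠ x in 𝓝 x₀, Φ (0, x) = x := by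
  have h01 : (-1 : ℝ) ≤ 1 := neg_le_self zero_le_one
  set c₀ : C(Set.Icc (-1 : ℝ) 1, E) := ContinuousMap.const (Set.Icc (-1 : ℝ) 1) x₀ with hc₀
  have hΨ := contDiff_flowEquation X hX
  have hA := hasFDerivAt_flowEquation X hX x₀ c₀
  -- A curve with γ = x + s∫₀X(γ) is t ↦ Φ(st, x), the integral curve run at speed s. At s = 0 it is
  -- constant, and the inverse function theorem there yields γ(s, x) as the last component of the
  -- preimage of (s, x, 0), smooth in (s, x).
  let h := hΨ.contDiffAt.toOpenPartialHomeomorph (flowEquation X) hA (by simp)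
  have hh : ∀ q, h q = flowEquation X q := fun q => rfl
  have hsrc : ((0 : ℝ), x₀, c₀) ∈ h.source :=
    hΨ.contDiffAt.mem_toOpenPartialHomeomorph_source hA (by simp)
  have hΨ0 : ∀ x,
      flowEquation X (0, x, ContinuousMap.const (Set.Icc (-1 : ℝ) 1) x) = (0, x, 0) := fun x => by
    refine Prod.ext rfl (Prod.ext rfl ?_)
    ext t
    simp [flowEquation]
  have htgt : ((0 : ℝ), x₀, (0 : C(Set.Icc (-1 : ℝ) 1, E))) ∈ h.target := by
    rw [← hΨ0, ← hh]; exact h.map_source hsrc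
  have hsymm0 : h.symm (0, x₀, 0) = (0, x₀, c₀) := by
    rw [← hΨ0, ← hh]; exact h.left_inv hsrc
  let ι : ℝ × E → ℝ × E × C(Set.Icc (-1 : ℝ) 1, E) := fun p => (p.1, p.2, 0)
  have hι : ContDiff ℝ ∞ ι := contDiff_fst.prodMk (contDiff_snd.prodMk contDiff_const)
  let γ : ℝ × E → C(Set.Icc (-1 : ℝ) 1, E) := fun p => (h.symm (ι p)).2.2
  have hγ0 : γ (0, x₀) = c₀ := by simp only [γ, ι, hsymm0]
  -- smoothness of the inverse near the base point
  have hsm : ∀ᶠ p in 𝓝 ((0 : ℝ), x₀), ι p ∈ h.target ∧ ContDiffAt ℝ ∞ γ p := by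
    have hcont : ContinuousAt (fun p => fderiv ℝ (flowEquation X) (h.symm (ι p))) (0, x₀) := by
      refine ((hΨ.fderiv_right (m := ∞) (by simp)).continuous.continuousAt).comp ?_
      exact ContinuousAt.comp (x := ((0 : ℝ), x₀)) (f := ι) (h.continuousAt_symm htgt)
        hι.continuous.continuousAt
    have hinv : ∀ᶠ p in 𝓝 ((0 : ℝ), x₀), fderiv ℝ (flowEquation X) (h.symm (ι p))
        ∈ Set.range ((↑) : ((ℝ × E × C(Set.Icc (-1 : ℝ) 1, E)) ≃L[ℝ]
          ℝ × E × C(Set.Icc (-1 : ℝ) 1, E)) → _) := by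
      have ht : Tendsto (fun p => fderiv ℝ (flowEquation X) (h.symm (ι p))) (𝓝 (0, x₀))
        (𝓝 (fderiv ℝ (flowEquation X) (h.symm (0, x₀, 0)))) := hcont
      rw [hsymm0, hA.fderiv] at ht
      exact ht.eventually (ContinuousLinearEquiv.nhds _)
    filter_upwards [hinv, hι.continuous.continuousAt.preimage_mem_nhds
      (h.open_target.mem_nhds htgt)] with p ⟨B, hB⟩ hp
    refine ⟨hp, ?_⟩
    have h1 : ContDiffAt ℝ ∞ h.symm (ι p) := by
      refine h.contDiffAt_symm (f₀' := B) hp ?_ hΨ.contDiffAt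
      rw [hB]
      exact (hΨ.differentiable (by simp) _).hasFDerivAt
    exact contDiffAt_snd.comp p (contDiffAt_snd.comp p (h1.comp p hι.contDiffAt))
  -- the integral equation
  have heq : ∀ p, ι p ∈ h.target → h.symm (ι p) = (p.1, p.2, γ p) ∧
      γ p = ContinuousMap.const (Set.Icc (-1 : ℝ) 1) p.2 + p.1 • curvePrimitive (X.comp (γ p)) := by
    intro p hp
    have h1 := h.right_inv hp
    rw [hh, flowEquation] at h1
    have e1 := congrArg Prod.fst h1
    have e2 := congrArg (fun q => q.2.1) h1
    have e3 := congrArg (fun q => q.2.2) h1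
    simp only [ι] at e1 e2 e3
    refine ⟨Prod.ext e1 (Prod.ext e2 rfl), ?_⟩
    rw [e1, e2, sub_sub, sub_eq_zero] at e3
    exact e3
  obtain ⟨ε, hε, hεs⟩ := Metric.isOpen_iff.1 h.open_source _ hsrc
  have hγc : ContinuousAt γ (0, x₀) := hsm.self_of_nhds.2.continuousAt
  have hγε : ∀ᶠ p in 𝓝 ((0 : ℝ), x₀), dist (γ p) c₀ < ε := by
    have := hγc.eventually (Metric.ball_mem_nhds _ hε)
    rwa [hγ0] at this
  obtain ⟨δ', hδ', hW⟩ := Metric.eventually_nhds_iff.1 (hsm.and hγε)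
  obtain ⟨δ, hδ, hδδ', hδε⟩ : ∃ δ, 0 < δ ∧ δ ≤ δ' ∧ δ ≤ ε :=
    ⟨min δ' ε, lt_min hδ' hε, min_le_left _ _, min_le_right _ _⟩
  have hmul : ∀ {r t : ℝ}, r ∈ Set.Icc (-1 : ℝ) 1 → t ∈ Set.Icc (-1 : ℝ) 1 →
      r * t ∈ Set.Icc (-1 : ℝ) 1 := fun {r t} hr ht => by
    rw [Set.mem_Icc, ← abs_le] at *
    rw [abs_mul]
    exact mul_le_one₀ hr (abs_nonneg _) ht
  -- rescaling of integral curves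
  have hscale : ∀ s x, |s| < δ → dist x x₀ < δ → ∀ r ∈ Set.Icc (-1 : ℝ) 1,
      γ (s * r, x) ⟨1, by simp⟩ = Set.IccExtend h01 (γ (s, x)) r := by
    intro s x hs hx r hr
    have hp : dist ((s, x) : ℝ × E) (0, x₀) < δ' := by
      rw [Prod.dist_eq]
      exact max_lt (by simpa using hs.trans_le hδδ') (hx.trans_le hδδ')
    obtain ⟨⟨hp1, -⟩, hp2⟩ := hW hp
    obtain ⟨-, hp3⟩ := heq _ hp1
    set c := γ (s, x) with hc
    -- The curve t ↦ c(rt) solves the equation with parameter sr. As it is close to the constant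
    -- curve, injectivity of the local homeomorphism identifies it with γ(sr, x).
    let η : C(Set.Icc (-1 : ℝ) 1, E) := c.comp ⟨fun t => ⟨r * t, hmul hr t.2⟩, by fun_prop⟩
    have hη : flowEquation X (s * r, x, η) = ι (s * r, x) := by
      refine Prod.ext rfl (Prod.ext rfl ?_)
      ext t
      have h1 := congrArg (fun d : C(Set.Icc (-1 : ℝ) 1, E) => d ⟨r * t, hmul hr t.2⟩) hp3
      simp only [ContinuousMap.add_apply, ContinuousMap.const_apply, ContinuousMap.smul_apply,
        curvePrimitive_apply] at h1
      have h2 : ∫ τ in (0 : ℝ)..r * t, Set.IccExtend h01 (X.comp c) τ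
          = r • ∫ τ in (0 : ℝ)..t, Set.IccExtend h01 (X.comp η) τ := by
        have h3 := intervalIntegral.smul_integral_comp_mul_left (a := 0) (b := (t : ℝ))
          (Set.IccExtend h01 (X.comp c)) r
        rw [mul_zero] at h3
        rw [← h3]
        congr 1
        refine intervalIntegral.integral_congr fun τ hτ => ?_
        have hτ' : τ ∈ Set.Icc (-1 : ℝ) 1 :=
          Set.uIcc_subset_Icc (by simp) t.2 hτ
        rw [Set.IccExtend_of_mem _ _ hτ', Set.IccExtend_of_mem _ _ (hmul hr hτ')]
        rfl
      simp only [flowEquation, ContinuousMap.sub_apply, ContinuousMap.const_apply,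
        ContinuousMap.smul_apply, curvePrimitive_apply, ι, ContinuousMap.zero_apply]
      rw [show η t = c ⟨r * t, hmul hr t.2⟩ from rfl, h1, h2, smul_smul]
      abel
    have hηs : (s * r, x, η) ∈ h.source := by
      refine hεs ?_
      rw [Metric.mem_ball, Prod.dist_eq, Prod.dist_eq]
      refine max_lt ?_ (max_lt (hx.trans_le hδε) ?_)
      · rw [dist_zero_right, Real.norm_eq_abs, abs_mul]
        exact (mul_le_of_le_one_right (abs_nonneg _) (abs_le.2 hr)).trans_lt (hs.trans_le hδε)
      · refine (ContinuousMap.dist_lt_iff hε).2 fun t => ?_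
        exact (ContinuousMap.dist_apply_le_dist (f := c) (g := c₀)
          ⟨r * t, hmul hr t.2⟩).trans_lt hp2
    have h3 : γ (s * r, x) = η := by
      change (h.symm (ι (s * r, x))).2.2 = η
      rw [← hη, ← hh, h.left_inv hηs]
    rw [h3, Set.IccExtend_of_mem _ _ hr]
    exact congrArg c (Subtype.ext (mul_one r))
  refine ⟨fun p => γ p ⟨1, by simp⟩, ?_, ?_⟩
  · have hδ2 : 0 < δ / 2 := by positivity
    have hnear : ∀ᶠ p in 𝓝 ((0 : ℝ), x₀), |p.1| < δ / 2 ∧ dist p.2 x₀ < δ := by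
      refine (Metric.eventually_nhds_iff.2 ⟨δ / 2, hδ2, fun p hp => ?_⟩)
      rw [Prod.dist_eq, max_lt_iff, dist_zero_right, Real.norm_eq_abs] at hp
      exact ⟨hp.1, hp.2.trans (by linarith)⟩
    filter_upwards [hnear, hsm] with ⟨σ, x⟩ ⟨hσ, hx⟩ ⟨_, hγs⟩
    refine ⟨(ContinuousMap.evalCLM ℝ (⟨1, by simp⟩ : Set.Icc (-1 : ℝ) 1) :
      C(Set.Icc (-1 : ℝ) 1, E) →L[ℝ] E).contDiff.contDiffAt.comp _ hγs, ?_⟩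
    simp only at hσ hx ⊢
    -- The flow is the endpoint of γ(σ, x) at t = 1. By rescaling it equals c(σ/(δ/2)) for one fixed
    -- curve c, so its time derivative follows from the integral equation of c.
    set c := γ (δ / 2, x) with hc
    have hs : |δ / 2| < δ := by rw [abs_of_pos hδ2]; linarith
    have hquot : ∀ τ, |τ| < δ / 2 → τ / (δ / 2) ∈ Set.Ioo (-1 : ℝ) 1 := fun τ hτ => by
      rw [abs_lt] at hτ
      exact ⟨by rw [lt_div_iff₀ hδ2]; linarith, by rw [div_lt_one hδ2]; exact hτ.2⟩
    have hΦ : ∀ τ, |τ| < δ / 2 →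
        γ (τ, x) ⟨1, by simp⟩ = Set.IccExtend h01 c (τ / (δ / 2)) := fun τ hτ => by
      rw [← hscale _ _ hs hx _ (Set.Ioo_subset_Icc_self (hquot τ hτ))]
      congr 3
      field_simp
    have hp : dist ((δ / 2, x) : ℝ × E) (0, x₀) < δ' := by
      rw [Prod.dist_eq]
      exact max_lt (by rw [dist_zero_right]; exact hs.trans_le hδδ') (hx.trans_le hδδ')
    obtain ⟨-, hp3⟩ := heq _ (hW hp).1.1
    set r := σ / (δ / 2) with hr
    have hcX : Continuous (Set.IccExtend h01 (X.comp c)) := (X.comp c).continuous.Icc_extend'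
    have hder : HasDerivAt (Set.IccExtend h01 c) ((δ / 2) • X (Set.IccExtend h01 c r)) r := by
      have h1 : HasDerivAt (fun t => x + (δ / 2) • ∫ τ in (0 : ℝ)..t,
          Set.IccExtend h01 (X.comp c) τ) ((δ / 2) • Set.IccExtend h01 (X.comp c) r) r :=
        ((intervalIntegral.integral_hasDerivAt_right (hcX.intervalIntegrable _ _)
          (hcX.stronglyMeasurableAtFilter _ _) hcX.continuousAt).const_smul _).const_add _
      refine h1.congr_of_eventuallyEq ?_
      filter_upwards [Ioo_mem_nhds (hquot σ hσ).1 (hquot σ hσ).2] with t ht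
      have ht' := Set.Ioo_subset_Icc_self ht
      rw [Set.IccExtend_of_mem _ _ ht']
      exact congrArg (fun d : C(Set.Icc (-1 : ℝ) 1, E) => d ⟨t, ht'⟩) hp3
    have h2 := hder.scomp σ ((hasDerivAt_id σ).div_const (δ / 2))
    rw [hΦ σ hσ]
    rw [smul_smul, one_div_mul_cancel hδ2.ne', one_smul] at h2
    refine h2.congr_of_eventuallyEq ?_
    filter_upwards [(continuous_abs.tendsto σ).eventually (gt_mem_nhds hσ)] with τ hτ
    exact hΦ τ hτ
  · have hpath : Tendsto (fun x : E => ((0 : ℝ), x)) (𝓝 x₀) (𝓝 (0, x₀)) :=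
      (continuous_const.prodMk continuous_id).tendsto x₀
    filter_upwards [hpath.eventually hsm] with x hx
    have h1 := (heq _ hx.1).2
    rw [zero_smul, add_zero] at h1
    rw [h1]
    rfl

end Flow

/-! ### Straightening vector fields -/

/-- Multiplication by a bump function; it makes a locally defined field global, as
`exists_smooth_flow` requires. -/
theorem exists_contDiff_eventuallyEq {E F : Type} [NormedAddCommGroup E] [NormedSpace ℝ E]
    [FiniteDimensional ℝ E] [NormedAddCommGroup F] [NormedSpace ℝ F] {X : E → F} {x₀ : E}
    (hX : ∀ᶠ x in 𝓝 x₀, ContDiffAt ℝ ∞ X x) :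
    ∃ Y : E → F, ContDiff ℝ ∞ Y ∧ Y =ᶠ[𝓝 x₀] X := by
  obtain ⟨r, hr, hX⟩ := Metric.eventually_nhds_iff_ball.1 hX
  let b : ContDiffBump x₀ := ⟨r / 4, r / 2, by positivity, by linarith⟩
  refine ⟨fun x => b x • X x, contDiff_iff_contDiffAt.2 fun x => ?_, ?_⟩
  · by_cases hx : x ∈ Metric.ball x₀ r
    · exact b.contDiff.contDiffAt.smul (hX x hx)
    · have hx' : x ∉ tsupport b := by
        rw [b.tsupport_eq, Metric.mem_closedBall]
        rw [Metric.mem_ball] at hx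
        change ¬ dist x x₀ ≤ r / 2
        linarith
      refine (contDiffAt_const (c := (0 : F))).congr_of_eventuallyEq ?_
      filter_upwards [notMem_tsupport_iff_eventuallyEq.1 hx'] with y hy
      rw [hy, Pi.zero_apply, zero_smul]
  · filter_upwards [b.eventuallyEq_one] with x hx
    rw [hx, Pi.one_apply, one_smul]

theorem exists_smooth_flow_of_eventually {E : Type} [NormedAddCommGroup E] [NormedSpace ℝ E]
    [FiniteDimensional ℝ E] {X : E → E} {x₀ : E} (hX : ∀ᶠ x in 𝓝 x₀, ContDiffAt ℝ ∞ X x) :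
    ∃ Φ : ℝ × E → E, (∀ᶠ p in 𝓝 ((0 : ℝ), x₀), ContDiffAt ℝ ∞ Φ p ∧
      HasDerivAt (fun σ => Φ (σ, p.2)) (X (Φ p)) p.1) ∧ ∀ᶠ x in 𝓝 x₀, Φ (0, x) = x := by
  have : CompleteSpace E := FiniteDimensional.complete ℝ E
  obtain ⟨Y, hY, hYX⟩ := exists_contDiff_eventuallyEq hX
  obtain ⟨Φ, hΦ, hΦ0⟩ := exists_smooth_flow ⟨Y, hY.continuous⟩ hY x₀
  refine ⟨Φ, ?_, hΦ0⟩
  have hc : Tendsto Φ (𝓝 (0, x₀)) (𝓝 x₀) := by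
    have := hΦ.self_of_nhds.1.continuousAt
    rwa [ContinuousAt, hΦ0.self_of_nhds] at this
  filter_upwards [hΦ, hc.eventually hYX] with p h1 h2
  refine ⟨h1.1, ?_⟩
  rw [← h2]
  exact h1.2

/-- A function whose derivative vanishes in the direction of `v` near `x` is invariant under small
translations in that direction. -/
theorem eq_of_fderiv_eq_zero {E : Type*} [NormedAddCommGroup E] [NormedSpace ℝ E] {u : E → ℝ}
    {s : Set E} (hs : Convex ℝ s) (hu : ∀ x ∈ s, DifferentiableAt ℝ u x) {v z : E}
    (hv : ∀ x ∈ s, fderiv ℝ u x v = 0) (hz : z ∈ s) (hzv : z + v ∈ s) : u (z + v) = u z := by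
  have h1 : ∀ t ∈ Set.Icc (0 : ℝ) 1, HasDerivWithinAt (fun t : ℝ => u (z + t • v)) 0
      (Set.Icc 0 1) t := by
    intro t ht
    have hmem : z + t • v ∈ s := by
      have := hs.add_smul_sub_mem hz hzv ht
      rwa [add_sub_cancel_left] at this
    have h2 : HasDerivAt (fun t : ℝ => z + t • v) v t := by
      simpa using ((hasDerivAt_id t).smul_const v).const_add z
    have h3 := (hu _ hmem).hasFDerivAt.comp_hasDerivAt t h2
    rw [hv _ hmem] at h3
    exact h3.hasDerivWithinAt
  have h4 := (convex_Icc (0 : ℝ) 1).norm_image_sub_le_of_norm_hasDerivWithin_le (C := 0) h1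
    (by simp) (Set.left_mem_Icc.2 zero_le_one) (Set.right_mem_Icc.2 zero_le_one)
  rw [zero_mul, norm_le_zero_iff, sub_eq_zero] at h4
  simpa using h4

/-- The linear map that sends the coordinates in `s` to the coordinate axes given by `σ`. -/
def axisMap (σ : Fin 4 → Fin 4) (s : Finset (Fin 4)) : R4 →L[ℝ] R4 :=
  ∑ j ∈ s, (EuclideanSpace.proj j : R4 →L[ℝ] ℝ).smulRight (EuclideanSpace.single (σ j) (1 : ℝ))

theorem axisMap_apply (σ : Fin 4 → Fin 4) (s : Finset (Fin 4)) (y : R4) :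
    axisMap σ s y = ∑ j ∈ s, y j • EuclideanSpace.single (σ j) (1 : ℝ) := by
  simp [axisMap]

theorem axisMap_single (σ : Fin 4 → Fin 4) (s : Finset (Fin 4)) (i : Fin 4) :
    axisMap σ s (EuclideanSpace.single i 1)
      = if i ∈ s then EuclideanSpace.single (σ i) (1 : ℝ) else 0 := by
  rw [axisMap_apply]
  simp [ite_smul]

theorem axisMap_apply_apply (σ : Equiv.Perm (Fin 4)) (s : Finset (Fin 4)) (y : R4) (i : Fin 4) :
    axisMap σ s y (σ i) = if i ∈ s then y i else 0 := by
  rw [axisMap_apply]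
  simp [Pi.single_apply, σ.injective.eq_iff]

section Straighten

variable {M : Type*} [TopologicalSpace M] [ChartedSpace R4 M] [IsManifold (𝓡 4) ∞ M]
  {φ : OpenPartialHomeomorph M R4} {x : R4}

/-- Coordinates in which a vector field is the coordinate vector `∂_k`, while the coordinate
vectors `∂_j` with `j < k`, along which the components of the field are constant, are kept. -/
theorem exists_coord_of_field (hφ : IsCoord φ) (hx : x ∈ φ.target) {c : R4 → Fin 4 → ℝ}
    (hc : ∀ᶠ y in 𝓝 x, ∀ l, ContDiffAt ℝ ∞ (fun y => c y l) y) {k m : Fin 4} (hkm : k ≤ m)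
    (hm : c x m ≠ 0) (hconst : ∀ᶠ y in 𝓝 x, ∀ j < k, ∀ l, partialD j (fun y => c y l) y = 0)
    {P : R4 → Prop} (hP : ∀ᶠ y in 𝓝 x, P y) :
    ∃ (φ' : OpenPartialHomeomorph M R4) (Θ : R4 → R4), IsCoordChange φ φ' Θ ∧ 0 ∈ φ'.target ∧
      Θ 0 = x ∧ ∀ y ∈ φ'.target, P (Θ y) ∧
        (∀ j < k, toComp φ (φ'.symm y) (coordVec φ' y j) = Pi.single j 1) ∧
        toComp φ (φ'.symm y) (coordVec φ' y k) = c (Θ y) := by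
  let X : R4 → R4 := fun y => WithLp.toLp 2 (c y)
  have hX : ∀ᶠ y in 𝓝 x, ContDiffAt ℝ ∞ X y := hc.mono fun y hy => contDiffAt_euclidean.2 hy
  obtain ⟨Φ, hΦ, hΦ0⟩ := exists_smooth_flow_of_eventually hX
  -- The coordinates other than k are laid along the axes other than m. Since c has a nonzero
  -- m-component, it is transversal to the span of these axes.
  let σ : Equiv.Perm (Fin 4) := Equiv.swap k m
  let L₁ := axisMap σ (Finset.univ.filter (· < k))
  let L₂ := axisMap σ (Finset.univ.filter (k < ·))
  let A : R4 → ℝ × R4 := fun y => (y k, x + L₂ y)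
  have hA : ContDiff ℝ ∞ A := (contDiff_coord k).prodMk (contDiff_const.add L₂.contDiff)
  have hA0 : A 0 = (0, x) := by simp [A]
  -- The coordinates after k choose the starting point of the flow, y_k is the time, and those
  -- before k are added after flowing. The latter makes ∂_j for j < k exactly the old coordinate
  -- vectors. It also makes ∂_k equal to c at the flowed point, hence to c at Θ y by invariance of c
  -- under these translations.
  let Θ : R4 → R4 := fun y => L₁ y + Φ (A y)
  have hΘ0 : Θ 0 = x := by simp [Θ, hA0, hΦ0.self_of_nhds]
  have hσ : ∀ j < k, σ j = j := fun j hj =>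
    Equiv.swap_apply_of_ne_of_ne hj.ne (hj.trans_le hkm).ne
  have htA : Tendsto A (𝓝 0) (𝓝 (0, x)) := hA0 ▸ hA.continuous.tendsto 0
  have hgood := htA.eventually hΦ
  have hfd : ∀ y, ContDiffAt ℝ ∞ Φ (A y) → ∀ v,
      fderiv ℝ Θ y v = L₁ v + fderiv ℝ Φ (A y) (v k, L₂ v) := by
    intro y hy v
    have h1 : HasFDerivAt A ((EuclideanSpace.proj k : R4 →L[ℝ] ℝ).prod L₂) y :=
      (EuclideanSpace.proj k : R4 →L[ℝ] ℝ).hasFDerivAt.prodMk (L₂.hasFDerivAt.const_add x)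
    have h2 := L₁.hasFDerivAt.add (hy.differentiableAt_infty.hasFDerivAt.comp y h1)
    rw [show fderiv ℝ Θ y = _ from h2.fderiv]
    rfl
  have hdt : ∀ p, ContDiffAt ℝ ∞ Φ p → HasDerivAt (fun σ => Φ (σ, p.2)) (X (Φ p)) p.1 →
      fderiv ℝ Φ p (1, 0) = X (Φ p) := by
    intro p hp hd
    have h1 : HasDerivAt (fun t : ℝ => (t, p.2)) ((1 : ℝ), (0 : R4)) p.1 :=
      (hasDerivAt_id p.1).prodMk (hasDerivAt_const _ _)
    exact (hp.differentiableAt_infty.hasFDerivAt.comp_hasDerivAt p.1 h1).unique hd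
  have hΘs : ∀ y, ContDiffAt ℝ ∞ Φ (A y) → ContDiffAt ℝ ∞ Θ y := fun y hy =>
    L₁.contDiff.contDiffAt.add (hy.comp y hA.contDiffAt)
  have hcont : ContinuousAt Θ 0 := (hΘs 0 hgood.self_of_nhds.1).continuousAt
  -- invariance of the field in the first directions
  have hinv : ∀ᶠ y in 𝓝 (0 : R4), c (Φ (A y)) = c (Θ y) := by
    obtain ⟨r, hr, hball⟩ := Metric.eventually_nhds_iff_ball.1 (hc.and hconst)
    have t1 : Tendsto Θ (𝓝 0) (𝓝 x) := by
      have := hcont.tendsto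
      rwa [hΘ0] at this
    have t2 : Tendsto (fun y => Φ (A y)) (𝓝 0) (𝓝 x) := by
      have h1 : ContinuousAt (fun y => Φ (A y)) 0 :=
        (hgood.self_of_nhds.1.comp 0 hA.contDiffAt).continuousAt
      have h2 := h1.tendsto
      rwa [hA0, hΦ0.self_of_nhds] at h2
    filter_upwards [t1.eventually (Metric.ball_mem_nhds x hr),
      t2.eventually (Metric.ball_mem_nhds x hr)] with y h1 h2
    funext l
    have h3 : Θ y = Φ (A y) + L₁ y := add_comm _ _
    rw [h3] at h1 ⊢
    refine (eq_of_fderiv_eq_zero (convex_ball x r)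
      (fun z hz => ((hball z hz).1 l).differentiableAt_infty) (fun z hz => ?_) h2 h1).symm
    rw [axisMap_apply, map_sum]
    refine Finset.sum_eq_zero fun j hj => ?_
    have hj' := (Finset.mem_filter.1 hj).2
    rw [map_smul, hσ j hj']
    exact (congrArg (y j • ·) ((hball z hz).2 j hj' l)).trans (smul_zero _)
  -- the Jacobian at the origin
  have hd0 : ∀ v, fderiv ℝ Θ 0 v = L₁ v + (v k • X x + L₂ v) := by
    intro v
    rw [hfd 0 hgood.self_of_nhds.1, hA0]
    congr 1
    have hΦs := hΦ.self_of_nhds.1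
    have h1 : fderiv ℝ Φ (0, x) (0, L₂ v) = L₂ v := by
      have h2 : HasFDerivAt (fun z : R4 => ((0 : ℝ), z)) (ContinuousLinearMap.inr ℝ ℝ R4) x :=
        hasFDerivAt_prodMk_right 0 x
      have h3 := hΦs.differentiableAt_infty.hasFDerivAt.comp x h2
      have h4 : HasFDerivAt (fun z : R4 => Φ (0, z)) (ContinuousLinearMap.id ℝ R4) x :=
        (hasFDerivAt_id x).congr_of_eventuallyEq hΦ0
      exact congrArg (fun B : R4 →L[ℝ] R4 => B (L₂ v)) (h3.unique h4)
    have h5 := hdt (0, x) hΦs hΦ.self_of_nhds.2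
    rw [hΦ0.self_of_nhds] at h5
    rw [show ((v k, L₂ v) : ℝ × R4) = v k • ((1 : ℝ), (0 : R4)) + (0, L₂ v) by simp, map_add,
      map_smul, h5, h1]
  have hdet : (jacobian Θ 0).det ≠ 0 := by
    rw [← det_fderiv (hΘs 0 hgood.self_of_nhds.1).differentiableAt_infty]
    intro h0
    obtain ⟨v, hv, hv0⟩ := (Submodule.ne_bot_iff _).1
      (bot_lt_iff_ne_bot.1 (LinearMap.bot_lt_ker_of_det_eq_zero h0))
    have hv' : L₁ v + (v k • X x + L₂ v) = 0 := (hd0 v).symm.trans hv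
    have hcomp : ∀ i, L₁ v (σ i) + (v k * c x (σ i) + L₂ v (σ i)) = 0 := fun i =>
      congrArg (fun w : R4 => w (σ i)) hv'
    simp only [L₁, L₂, axisMap_apply_apply, Finset.mem_filter, Finset.mem_univ, true_and] at hcomp
    -- Neither `L₁` nor `L₂` has an m-component, so that component of the equation reads v_k c_m(x)
    -- = 0.
    have hk : v k = 0 := by
      have := hcomp k
      rw [show σ k = m from Equiv.swap_apply_left k m] at this
      simpa [hm] using this
    refine hv0 ?_
    ext i
    rcases lt_trichotomy i k with h | rfl | h
    · simpa [hk, h, h.not_gt] using hcomp i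
    · exact hk
    · simpa [hk, h, h.not_gt] using hcomp i
  obtain ⟨U, hU, hUo, h0U⟩ := eventually_nhds_iff.1 ((hgood.and hinv).and
    (Tendsto.eventually (hΘ0 ▸ hcont.tendsto) hP))
  obtain ⟨φ', hch, h0, hsub, -⟩ := exists_coord hφ hUo h0U (fun y hy => hΘs y (hU y hy).1.1.1)
    (hΘ0 ▸ hx) hdet
  refine ⟨φ', Θ, hch, h0, hΘ0, fun y hy => ?_⟩
  obtain ⟨hg, hPy⟩ := hU y (hsub hy)
  have hsm := (hΘs y hg.1.1).differentiableAt_infty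
  refine ⟨hPy, fun j hj => ?_, ?_⟩
  · rw [hch.toComp_coordVec hy]
    funext a
    rw [← fderiv_single_apply hsm, hfd y hg.1.1]
    have e2 : L₂ (EuclideanSpace.single j 1) = 0 := by simp [L₂, axisMap_single, hj.not_gt]
    have e1 : L₁ (EuclideanSpace.single j 1) = EuclideanSpace.single j 1 := by
      simp [L₁, axisMap_single, hj, hσ j hj]
    rw [e1, e2]
    have : (EuclideanSpace.single j (1 : ℝ) : R4) k = 0 := by simp [hj.ne']
    rw [this, show ((0 : ℝ), (0 : R4)) = 0 from rfl, map_zero, add_zero]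
    simp [Pi.single_apply]
  · rw [hch.toComp_coordVec hy]
    funext a
    rw [← fderiv_single_apply hsm, hfd y hg.1.1, ← hg.2]
    have e2 : L₂ (EuclideanSpace.single k 1) = 0 := by simp [L₂, axisMap_single]
    have e1 : L₁ (EuclideanSpace.single k 1) = 0 := by simp [L₁, axisMap_single]
    have e3 : (EuclideanSpace.single k (1 : ℝ) : R4) k = 1 := by simp
    rw [e1, e2, e3, hdt _ hg.1.1 hg.1.2, zero_add]

end Straighten

/-! ### Walker coordinates -/

theorem exists_local_inverse {Φ : R4 → R4} {y₀ : R4} (hΦ : ∀ᶠ y in 𝓝 y₀, ContDiffAt ℝ ∞ Φ y)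
    (hdet : (jacobian Φ y₀).det ≠ 0) :
    ∃ Θ : R4 → R4, Θ (Φ y₀) = y₀ ∧ ∀ᶠ z in 𝓝 (Φ y₀), ContDiffAt ℝ ∞ Θ z ∧
      jacobian Φ (Θ z) * jacobian Θ z = 1 := by
  have h0 := hΦ.self_of_nhds
  have hd : (fderiv ℝ Φ y₀).det ≠ 0 := by rwa [det_fderiv h0.differentiableAt_infty]
  let A : R4 ≃L[ℝ] R4 := ContinuousLinearMap.toContinuousLinearEquivOfDetNeZero (fderiv ℝ Φ y₀) hd
  have hA : HasFDerivAt Φ (A : R4 →L[ℝ] R4) y₀ := h0.differentiableAt_infty.hasFDerivAt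
  let e := h0.toOpenPartialHomeomorph Φ hA (by simp)
  have he : ∀ y, e y = Φ y := fun y => rfl
  have he₀ : y₀ ∈ e.source := h0.mem_toOpenPartialHomeomorph_source hA (by simp)
  have ht : Φ y₀ ∈ e.target := e.map_source he₀
  have hs0 : e.symm (Φ y₀) = y₀ := e.left_inv he₀
  have hc : ContinuousAt (fun z => (jacobian Φ z).det) y₀ :=
    (ContDiffAt.matrix_det (m := ∞) fun a i =>
      ((EuclideanSpace.proj a : R4 →L[ℝ] ℝ).contDiff.contDiffAt.comp y₀ h0).partialD i).continuousAt
  have htend : Tendsto e.symm (𝓝 (Φ y₀)) (𝓝 y₀) := by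
    have := e.continuousAt_symm ht
    rwa [ContinuousAt, hs0] at this
  refine ⟨e.symm, hs0, ?_⟩
  filter_upwards [e.open_target.mem_nhds ht, htend.eventually hΦ,
    htend.eventually (hc.eventually_ne hdet)] with z hz h1 h2
  rw [← det_fderiv h1.differentiableAt_infty] at h2
  have hsm : ContDiffAt ℝ ∞ e.symm z :=
    e.contDiffAt_symm (f₀' := ContinuousLinearMap.toContinuousLinearEquivOfDetNeZero _ h2)
      hz h1.differentiableAt_infty.hasFDerivAt h1
  refine ⟨hsm, ?_⟩
  rw [← jacobian_comp h1.differentiableAt_infty hsm.differentiableAt_infty]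
  ext a i
  have hid : (fun z => Φ (e.symm z) a) =ᶠ[𝓝 z] fun z => z a := by
    filter_upwards [e.open_target.mem_nhds hz] with w hw
    exact congrArg (fun v : R4 => v a) (e.right_inv hw)
  rw [jacobian, Matrix.of_apply, hid.partialD_eq, partialD_coord, Matrix.one_apply]

section WalkerCoordinates

variable {M : Type*} [TopologicalSpace M] [ChartedSpace R4 M] [IsManifold (𝓡 4) ∞ M]
  {φ φ' : OpenPartialHomeomorph M R4} {Θ : R4 → R4} {x y : R4}

omit [IsManifold (𝓡 4) ∞ M] in
theorem toComp_injective_of_mem (hφ : IsCoord φ) {q : M} (hq : q ∈ φ.source) :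
    Function.Injective (toComp φ q) := by
  obtain ⟨x, hx, rfl⟩ : ∃ x ∈ φ.target, φ.symm x = q := ⟨φ q, φ.map_source hq, φ.left_inv hq⟩
  exact toComp_injective hφ hx

omit [IsManifold (𝓡 4) ∞ M] in
-- Transports membership in D between two expressions for the same point; the base point is
-- generalized because the tangent spaces are types indexed by it.
theorem IsCoordChange.mem_of_toComp_eq (h : IsCoordChange φ φ' Θ) (hy : y ∈ φ'.target)
    {D : ∀ p : M, Submodule ℝ (TangentSpace (𝓡 4) p)} {v : TangentSpace (𝓡 4) (φ'.symm y)}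
    {w : Fin 4 → ℝ} (hv : toComp φ (φ'.symm y) v = w)
    (hw : ofComp φ (Θ y) w ∈ D (φ.symm (Θ y))) : v ∈ D (φ'.symm y) := by
  have e := h.symm_eq y hy
  generalize φ'.symm y = q at *
  subst e
  rwa [← hv, ofComp_toComp h.isCoord (h.mem y hy)] at hw

namespace PseudoRiemannianMetric

variable {g : PseudoRiemannianMetric M} {f : M → ℝ}

theorem exists_coord_grad (hf : ContMDiff (𝓡 4) 𝓘(ℝ, ℝ) ∞ f) {p : M} (hp : g.grad f p ≠ 0) :
    ∃ φ : OpenPartialHomeomorph M R4, IsCoord φ ∧ 0 ∈ φ.target ∧ φ.symm 0 = p ∧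
      ∀ y ∈ φ.target, coordVec φ y 0 = g.grad f (φ.symm y) := by
  set φ := chartAt R4 p
  have hφ : IsCoord φ := IsManifold.chart_mem_maximalAtlas p
  have hps : p ∈ φ.source := mem_chart_source R4 p
  have hx : φ p ∈ φ.target := φ.map_source hps
  have hxp : φ.symm (φ p) = p := φ.left_inv hps
  let c : R4 → Fin 4 → ℝ := fun y => toComp φ (φ.symm y) (g.grad f (φ.symm y))
  obtain ⟨m, hm⟩ : ∃ m, c (φ p) m ≠ 0 := by
    by_contra! h
    refine hp ?_
    have h1 : toComp φ (φ.symm (φ p)) (g.grad f (φ.symm (φ p))) = 0 := funext h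
    rw [hxp] at h1
    exact toComp_injective_of_mem hφ hps (h1.trans (toComp_zero φ p).symm)
  obtain ⟨φ', Θ, hch, h0, hΘ, hcoord⟩ := exists_coord_of_field hφ hx (c := c)
    (Filter.mem_of_superset (φ.open_target.mem_nhds hx)
      fun y hy l => g.contDiffAt_toComp_grad hf hφ hy l) (Fin.zero_le m) hm
    (.of_forall fun y j hj => absurd hj (Fin.not_lt_zero j)) (P := fun _ => True) (by simp)
  refine ⟨φ', hch.isCoord', h0, by rw [hch.symm_eq 0 h0, hΘ, hxp], fun y hy => ?_⟩
  refine toComp_injective_of_mem hφ (hch.symm_mem_source hy) ((hcoord y hy).2.2.trans ?_)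
  rw [hch.symm_eq y hy]

namespace IsHessianPlane

variable {D : ∀ p : M, Submodule ℝ (TangentSpace (𝓡 4) p)} (hD : g.IsHessianPlane f D)
  (hf : ContMDiff (𝓡 4) 𝓘(ℝ, ℝ) ∞ f)
include hD

theorem eq_span_coordVec (hφ : IsCoord φ) (hx : x ∈ φ.target) {i j : Fin 4} (hij : i ≠ j)
    (hi : coordVec φ x i ∈ D (φ.symm x)) (hj : coordVec φ x j ∈ D (φ.symm x)) :
    D (φ.symm x) = Submodule.span ℝ {coordVec φ x i, coordVec φ x j} := by
  have : FiniteDimensional ℝ (TangentSpace (𝓡 4) (φ.symm x)) :=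
    inferInstanceAs (FiniteDimensional ℝ R4)
  have h1 : LinearIndependent ℝ ![coordVec φ x i, coordVec φ x j] := by
    refine LinearIndependent.pair_iff.2 fun s t hst => ?_
    have h2 := congrArg (toComp φ (φ.symm x)) hst
    rw [toComp_add, toComp_smul, toComp_smul, toComp_coordVec hφ hx, toComp_coordVec hφ hx,
      toComp_zero] at h2
    have hi := congrFun h2 i
    have hj := congrFun h2 j
    simp [hij, hij.symm] at hi hj
    exact ⟨hi, hj⟩
  have h2 := finrank_span_eq_card h1
  rw [Matrix.range_cons_cons_empty, Fintype.card_fin] at h2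
  refine (Submodule.eq_of_le_of_finrank_eq (Submodule.span_le.2 ?_) ?_).symm
  · rintro v (rfl | rfl) <;> assumption
  · rw [h2, hD.finrank]

include hf

/-- With ∂₀ = ∇f the connection has no torsion, so ∇_{∂₀}Y = [∂₀, Y] + ∇_Y∇f. The last term vanishes
because the Hessian annihilates Y. -/
theorem covComp_eq_partialD (hφ : IsCoord φ)
    (hgrad : ∀ y ∈ φ.target, toComp φ (φ.symm y) (g.grad f (φ.symm y)) = Pi.single 0 1)
    (hx : x ∈ φ.target) {Y : R4 → Fin 4 → ℝ} (hY : ofComp φ x (Y x) ∈ D (φ.symm x)) :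
    covComp (g.comp φ) 0 Y x = fun l => partialD 0 (fun z => Y z l) x := by
  have hΓ := hD.sum_mul_christoffel hf hφ (u := Pi.single 0 1)
    (Filter.mem_of_superset (φ.open_target.mem_nhds hx) hgrad) hx hY
  funext l
  have := hΓ l
  simp only [Pi.single_apply, mul_ite, mul_one, mul_zero, Finset.sum_ite_eq',
    Finset.mem_univ, if_true] at this
  rw [covComp]
  simp only [christoffel_symm (.of_forall (g.comp_transpose φ)) 0]
  rw [this, add_zero]

/-- Coordinates in which `D` contains the first two coordinate vectors, the first of which is the
gradient. -/
theorem exists_coord_frobenius {p : M} (hp : g.grad f p ≠ 0) :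
    ∃ φ : OpenPartialHomeomorph M R4, IsCoord φ ∧ 0 ∈ φ.target ∧ φ.symm 0 = p ∧
      ∀ y ∈ φ.target, coordVec φ y 0 = g.grad f (φ.symm y) ∧ coordVec φ y 1 ∈ D (φ.symm y) := by
  obtain ⟨φ, hφ, hx, rfl, hgrad⟩ := exists_coord_grad hf hp
  have hgradc : ∀ y ∈ φ.target, toComp φ (φ.symm y) (g.grad f (φ.symm y)) = Pi.single 0 1 :=
    fun y hy => by rw [← hgrad y hy, toComp_coordVec hφ hy]
  obtain ⟨c, hc⟩ := hD.exists_smooth φ hφ 0 hx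
  obtain ⟨m, hm0, hm⟩ : ∃ m, m ≠ 0 ∧ c 0 m ≠ 0 := by
    by_contra! h
    have h1 : ofComp φ 0 (c 0) = c 0 0 • g.grad f (φ.symm 0) := by
      refine toComp_injective hφ hx ?_
      rw [toComp_ofComp hφ hx, toComp_smul, hgradc 0 hx]
      funext l
      by_cases hl : l = 0
      · subst hl; simp
      · simp [hl, h l hl]
    have h2 : D (φ.symm 0) ≤ Submodule.span ℝ {g.grad f (φ.symm 0)} := by
      rw [hc.self_of_nhds.2.2, h1]
      refine Submodule.span_le.2 ?_
      rintro v (rfl | rfl)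
      · exact Submodule.mem_span_singleton_self _
      · exact Submodule.smul_mem _ _ (Submodule.mem_span_singleton_self _)
    have h3 := Submodule.finrank_mono h2
    rw [hD.finrank, finrank_span_singleton hp] at h3
    omega
  -- The section of D normalized to have 0-component 0 and m-component 1. Since D is parallel, [∂₀,
  -- Y] lies in D, thus is a∂₀ + bc. Its components 0 and m vanish, which forces b = 0 and a = 0, so
  -- Y commutes with ∂₀.
  let Y : R4 → Fin 4 → ℝ := fun y l => if l = 0 then 0 else c y l / c y m
  have hcm : ∀ᶠ y in 𝓝 (0 : R4), c y m ≠ 0 :=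
    (hc.self_of_nhds.2.1 m).continuousAt.eventually_ne hm
  have hY : ∀ᶠ y in 𝓝 (0 : R4), (∀ l, ContDiffAt ℝ ∞ (fun z => Y z l) y) ∧
      ofComp φ y (Y y) ∈ D (φ.symm y) := by
    filter_upwards [hc, hcm] with y ⟨h1, h2, h3⟩ h4
    refine ⟨fun l => ?_, ?_⟩
    · by_cases hl : l = 0
      · simp only [Y, hl, if_true]
        exact contDiffAt_const
      · simp only [Y, hl, if_false]
        exact (h2 l).div (h2 m) h4
    · have h5 : ofComp φ y (Y y) = (c y m)⁻¹ • (ofComp φ y (c y)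
          + (-(c y 0)) • g.grad f (φ.symm y)) := by
        refine toComp_injective hφ h1 ?_
        rw [toComp_ofComp hφ h1, toComp_smul, toComp_add, toComp_smul, toComp_ofComp hφ h1,
          hgradc y h1]
        funext l
        by_cases hl : l = 0
        · subst hl; simp [Y]
        · simp [Y, hl]; ring
      rw [h5, h3]
      exact Submodule.smul_mem _ _ (Submodule.add_mem _ (Submodule.subset_span (by simp))
        (Submodule.smul_mem _ _ (Submodule.subset_span (by simp))))
  have hconst : ∀ᶠ y in 𝓝 (0 : R4), ∀ j < (1 : Fin 4), ∀ l, partialD j (fun z => Y z l) y = 0 := by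
    filter_upwards [hc, eventually_eventually_nhds.2 hY, eventually_eventually_nhds.2 hcm]
      with y ⟨h1, h2, h3⟩ h4 h5 j hj
    obtain rfl : j = 0 := by omega
    have hcov := hD.ofComp_covComp_mem hf hφ h1
      (fun l => (h4.self_of_nhds.1 l).differentiableAt_infty) (h4.mono fun z hz => hz.2) 0
    have h6 := hD.covComp_eq_partialD hf hφ hgradc h1 h4.self_of_nhds.2
    rw [h6, h3] at hcov
    obtain ⟨a, b, hab⟩ := Submodule.mem_span_pair.1 hcov
    have h7 := congrArg (toComp φ (φ.symm y)) hab
    rw [toComp_add, toComp_smul, toComp_smul, toComp_ofComp hφ h1, toComp_ofComp hφ h1,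
      hgradc y h1] at h7
    have hYm : partialD 0 (fun z => Y z m) y = 0 := by
      have : (fun z => Y z m) =ᶠ[𝓝 y] fun _ => 1 := by
        filter_upwards [h5] with z hz
        simp only [Y, hm0, if_false]
        exact div_self hz
      rw [this.partialD_eq, partialD_const]
    have hY0 : partialD 0 (fun z => Y z 0) y = 0 := by simp [Y, partialD_const]
    have e0 := congrFun h7 0
    have em := congrFun h7 m
    simp [hYm, hY0, hm0, h5.self_of_nhds] at e0 em
    subst em
    simp at e0
    subst e0
    intro l
    have el := congrFun h7 l
    simpa using el.symm
  obtain ⟨φ', Θ, hch, h0, hΘ, hcoord⟩ := exists_coord_of_field hφ hx (c := Y)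
    (hY.mono fun y hy => hy.1) (k := 1) (m := m) (by omega) (by simp [Y, hm0, hm]) hconst
    (hY.mono fun y hy => hy.2)
  refine ⟨φ', hch.isCoord', h0, by rw [hch.symm_eq 0 h0, hΘ], fun y hy => ?_⟩
  obtain ⟨h1, h2, h3⟩ := hcoord y hy
  refine ⟨toComp_injective_of_mem hφ (hch.symm_mem_source hy) ?_, hch.mem_of_toComp_eq hy h3 h1⟩
  rw [h2 0 (by omega), hch.symm_eq y hy, hgradc _ (hch.mem y hy)]

/-- Coordinates as in `exists_coord_frobenius`, in which moreover the one-form that is dual to the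
second coordinate vector is exact. -/
theorem exists_coord_frobenius_exact {p : M} (hp : g.grad f p ≠ 0) :
    ∃ (φ : OpenPartialHomeomorph M R4) (H : R4 → ℝ), IsCoord φ ∧ 0 ∈ φ.target ∧ φ.symm 0 = p ∧
      ∀ y ∈ φ.target, coordVec φ y 0 = g.grad f (φ.symm y) ∧ coordVec φ y 1 ∈ D (φ.symm y) ∧
        ContDiffAt ℝ ∞ H y ∧ ∀ j, g.comp φ y 1 j = partialD j H y := by
  obtain ⟨φ, hφ, hx, rfl, hcoord⟩ := hD.exists_coord_frobenius hf hp
  have hgradc : ∀ y ∈ φ.target, toComp φ (φ.symm y) (g.grad f (φ.symm y)) = Pi.single 0 1 :=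
    fun y hy => by rw [← (hcoord y hy).1, toComp_coordVec hφ hy]
  have hmem : ∀ y ∈ φ.target, coordVec φ y 0 ∈ D (φ.symm y) :=
    fun y hy => (hcoord y hy).1 ▸ hD.grad_mem _
  have hunit : ∀ y ∈ φ.target, IsUnit (g.comp φ y).det := fun y hy =>
    isUnit_iff_ne_zero.2 (g.det_comp_ne_zero hφ hy)
  -- Some coordinate function y^l with l ≥ 2 has a gradient with nonzero ∂₁-component, so that this
  -- gradient can replace ∂₁. Otherwise the (1, 1) entry of G⁻¹G would be zero, because D is null.
  obtain ⟨l, hl0, hl1, hl⟩ : ∃ l, l ≠ 0 ∧ l ≠ 1 ∧ (g.comp φ 0)⁻¹ 1 l ≠ 0 := by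
    by_contra! h
    have h1 := congrFun (congrFun (Matrix.nonsing_inv_mul _ (hunit 0 hx)) 1) 1
    have h01 : g.comp φ 0 0 1 = 0 := hD.isNull _ _ (hmem 0 hx) _ (hcoord 0 hx).2
    have h11 : g.comp φ 0 1 1 = 0 := hD.isNull _ _ (hcoord 0 hx).2 _ (hcoord 0 hx).2
    rw [Matrix.mul_apply, Fin.sum_univ_four, h01, h11, h 2 (by decide) (by decide),
      h 3 (by decide) (by decide)] at h1
    simp at h1
  -- The gradient of y^l. As y^l is constant along ∂₀ and ∂₁, it is orthogonal to D and therefore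
  -- lies in D.
  let c : R4 → Fin 4 → ℝ := fun y k => (g.comp φ y)⁻¹ k l
  have hcs : ∀ y ∈ φ.target, ∀ k, ContDiffAt ℝ ∞ (fun z => c z k) y := fun y hy k =>
    ContDiffAt.matrix_inv (g.contDiffAt_comp hφ hy) (g.det_comp_ne_zero hφ hy) k l
  have hscal : ∀ y ∈ φ.target, ∀ v, scalarProd (g.comp φ y) v (c y) = v l := by
    intro y hy v
    have h1 : (g.comp φ y).mulVec (c y) = Pi.single l 1 := by
      funext i
      have := congrFun (congrFun (Matrix.mul_nonsing_inv _ (hunit y hy)) i) l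
      rw [Matrix.one_apply] at this
      rw [Pi.single_apply, ← this]
      rfl
    rw [scalarProd, h1, dotProduct_single_one]
  have hcD : ∀ y ∈ φ.target, ofComp φ y (c y) ∈ D (φ.symm y) := by
    intro y hy
    have h1 : ∀ i, i ≠ l → g.val (φ.symm y) (ofComp φ y (c y)) (coordVec φ y i) = 0 := by
      intro i hi
      rw [← scalarProd_comp hφ hy, toComp_ofComp hφ hy, toComp_coordVec hφ hy,
        scalarProd_comm (g.comp_transpose φ y), hscal y hy, Pi.single_apply, if_neg hi.symm]
    exact hD.mem_of_eq_span (hD.eq_span_coordVec hφ hy zero_ne_one (hmem y hy) (hcoord y hy).2)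
      (h1 0 hl0.symm) (h1 1 hl1.symm)
  have hconst : ∀ y ∈ φ.target, ∀ k, partialD 0 (fun z => c z k) y = 0 := by
    intro y hy
    have hn := φ.open_target.mem_nhds hy
    -- Differentiate the constant g(∂_j, c) along ∂₀: the term g(∇_{∂₀}∂_j, c) = g(∇_{∂_j}∇f, c) is
    -- a Hessian component along c in D and vanishes. Hence ∇_{∂₀}c = 0, which is the plain
    -- derivative ∂₀c.
    have h1 : ∀ j, scalarProd (g.comp φ y) (Pi.single j 1) (covComp (g.comp φ) 0 c y) = 0 := by
      intro j
      have h2 := partialD_scalarProd (g.contDiffAt_comp hφ hy) (g.det_comp_ne_zero hφ hy)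
        (.of_forall (g.comp_transpose φ)) (Y := fun _ => Pi.single j 1) (Z := c)
        (fun k => differentiableAt_const _) (fun k => (hcs y hy k).differentiableAt_infty) 0
      have h3 : (fun z => scalarProd (g.comp φ z) (Pi.single j 1) (c z)) =ᶠ[𝓝 y]
          fun _ => (Pi.single j 1 : Fin 4 → ℝ) l :=
        Filter.mem_of_superset hn fun z hz => hscal z hz _
      have h4 : covComp (g.comp φ) 0 (fun _ => Pi.single j 1) y
          = covComp (g.comp φ) j (fun z => toComp φ (φ.symm z) (g.grad f (φ.symm z))) y := by
        funext k
        have hk : (fun z => toComp φ (φ.symm z) (g.grad f (φ.symm z)) k) =ᶠ[𝓝 y]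
            fun _ => (Pi.single 0 1 : Fin 4 → ℝ) k :=
          Filter.mem_of_superset hn fun z hz => congrFun (hgradc z hz) k
        rw [covComp_const, covComp, hk.partialD_eq, partialD_const, hgradc y hy]
        simp [Pi.single_apply, christoffel_symm (.of_forall (g.comp_transpose φ)) 0 j]
      rw [h3.partialD_eq, partialD_const, h4, scalarProd_comm (g.comp_transpose φ y),
        scalarProd_covComp_grad hf hφ hy, hD.sum_mul_hessian hf hφ hy (hcD y hy), zero_add] at h2
      exact h2.symm
    rw [hD.covComp_eq_partialD hf hφ hgradc hy (hcD y hy)] at h1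
    exact congrFun (Matrix.eq_zero_of_mulVec_eq_zero (g.det_comp_ne_zero hφ hy)
      (funext fun j => (single_one_dotProduct _ _).symm.trans (h1 j)))
  obtain ⟨φ', Θ, hch, h0, hΘ, hc'⟩ := exists_coord_of_field hφ hx (c := c)
    (Filter.mem_of_superset (φ.open_target.mem_nhds hx) hcs) le_rfl hl
    (Filter.mem_of_superset (φ.open_target.mem_nhds hx) fun y hy j hj => by
      obtain rfl : j = 0 := by omega
      exact hconst y hy) (φ.open_target.eventually_mem hx)
  -- H is the old coordinate y^l, and the new ∂₁ is its gradient.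
  refine ⟨φ', fun y => Θ y l, hch.isCoord', h0, by rw [hch.symm_eq 0 h0, hΘ], fun y hy => ?_⟩
  obtain ⟨h1, h2, h3⟩ := hc' y hy
  refine ⟨toComp_injective_of_mem hφ (hch.symm_mem_source hy) ?_,
    hch.mem_of_toComp_eq hy h3 (hcD _ h1), contDiffAt_euclidean.1 (hch.smooth y hy) l,
    fun j => ?_⟩
  · rw [h2 0 (by omega), hch.symm_eq y hy, hgradc _ h1]
  · rw [hch.toComp_coordVec hy] at h3
    rw [hch.comp_eq hy, transpose_mul_mul_apply, h3, scalarProd_comm (g.comp_transpose φ _),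
      hscal _ h1]
    rfl

/-- The one-forms dual to ∂₀ and ∂₁ are dF and dH. Using F and H as x¹, x² and the old y⁰, y¹ as
x_{1'}, x_{2'}, the fields ∂₀, ∂₁ become the last two coordinate vectors, and their products with
the coordinate frame are constant. -/
theorem exists_isWalkerCoord {p : M} (hp : g.grad f p ≠ 0) :
    ∃ φ : OpenPartialHomeomorph M R4, p ∈ φ.source ∧ g.IsWalkerCoord D φ := by
  obtain ⟨φ, H, hφ, hx, rfl, hcoord⟩ := hD.exists_coord_frobenius_exact hf hp
  let F : R4 → ℝ := fun y => f (φ.symm y)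
  let Φ : R4 → R4 := fun y => WithLp.toLp 2 ![F y, H y, y 0, y 1]
  have hmem : ∀ y ∈ φ.target, coordVec φ y 0 ∈ D (φ.symm y) :=
    fun y hy => (hcoord y hy).1 ▸ hD.grad_mem _
  have hspan := fun y hy => hD.eq_span_coordVec hφ hy zero_ne_one (hmem y hy) (hcoord y hy).2.1
  have hΦ : ∀ y ∈ φ.target, ContDiffAt ℝ ∞ Φ y := by
    intro y hy
    refine contDiffAt_euclidean.2 fun i => ?_
    fin_cases i
    · exact contDiffAt_comp_symm hφ hy hf
    · exact (hcoord y hy).2.2.1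
    · exact (contDiff_coord 0).contDiffAt
    · exact (contDiff_coord 1).contDiffAt
  have hK0 : ∀ y ∈ φ.target, ∀ j, jacobian Φ y 0 j = g.comp φ y 0 j := by
    intro y hy j
    have h1 := g.sum_comp_mul_grad hφ hy hf j
    rw [← (hcoord y hy).1, toComp_coordVec hφ hy] at h1
    simp only [Pi.single_apply, ite_mul, one_mul, zero_mul, Finset.sum_ite_eq',
      Finset.mem_univ, if_true] at h1
    exact h1.symm
  have hK1 : ∀ y ∈ φ.target, ∀ j, jacobian Φ y 1 j = g.comp φ y 1 j := fun y hy j =>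
    ((hcoord y hy).2.2.2 j).symm
  have hK2 : ∀ y j, jacobian Φ y 2 j = if 0 = j then 1 else 0 := fun y j => partialD_coord 0 j y
  have hK3 : ∀ y j, jacobian Φ y 3 j = if 1 = j then 1 else 0 := fun y j => partialD_coord 1 j y
  -- A kernel vector is orthogonal to ∂₀ and ∂₁ by the rows of F and H, so it lies in D; by the
  -- other two rows its components along ∂₀ and ∂₁ are zero.
  have hdet : (jacobian Φ 0).det ≠ 0 := by
    intro h0
    obtain ⟨v, hv, hv0⟩ := Matrix.exists_mulVec_eq_zero_iff.2 h0
    have hrow : ∀ a, ∑ j, jacobian Φ 0 a j * v j = 0 := fun a => congrFun hv0 a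
    have e0 := hrow 2
    have e1 := hrow 3
    simp only [hK2, hK3, ite_mul, one_mul, zero_mul, Finset.sum_ite_eq, Finset.mem_univ,
      if_true] at e0 e1
    have hg : ∀ i, (∀ j, jacobian Φ 0 i j = g.comp φ 0 i j) →
        g.val (φ.symm 0) (ofComp φ 0 v) (coordVec φ 0 i) = 0 := by
      intro i hi
      rw [← scalarProd_comp hφ hx, toComp_ofComp hφ hx, toComp_coordVec hφ hx,
        scalarProd_comm (g.comp_transpose φ 0), scalarProd, single_one_dotProduct, ← hrow i]
      simp only [hi]
      rfl
    have h1 := hD.mem_of_eq_span (hspan 0 hx) (hg 0 (hK0 0 hx)) (hg 1 (hK1 0 hx))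
    rw [hspan 0 hx] at h1
    obtain ⟨α, β, hαβ⟩ := Submodule.mem_span_pair.1 h1
    have h2 := congrArg (toComp φ (φ.symm 0)) hαβ
    rw [toComp_add, toComp_smul, toComp_smul, toComp_ofComp hφ hx, toComp_coordVec hφ hx,
      toComp_coordVec hφ hx] at h2
    have h20 := congrFun h2 0
    have h21 := congrFun h2 1
    simp [e0, e1] at h20 h21
    subst h20 h21
    exact hv (by simpa using h2.symm)
  obtain ⟨Θ, hΘ0, hΘ⟩ := exists_local_inverse
    (Filter.mem_of_superset (φ.open_target.mem_nhds hx) hΦ) hdet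
  obtain ⟨U, hU, hUo, h0U⟩ := eventually_nhds_iff.1 hΘ
  obtain ⟨φ', hch, h0, hsub, -⟩ := exists_coord hφ hUo h0U (fun y hy => (hU y hy).1)
    (by rwa [hΘ0]) (fun h => by
      have h1 := congrArg Matrix.det (hU _ h0U).2
      rw [Matrix.det_mul, h, mul_zero, Matrix.det_one] at h1
      exact zero_ne_one h1)
  have hp' : φ'.symm (Φ 0) = φ.symm 0 := by rw [hch.symm_eq _ h0, hΘ0]
  -- F and H are constant along the null plane D, so dΦ maps ∂₀, ∂₁ to the third and fourth basis
  -- vectors, and the inverse maps these back.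
  have hcol : ∀ y ∈ φ'.target, (∀ a, jacobian Θ y a 2 = (Pi.single 0 1 : Fin 4 → ℝ) a) ∧
      ∀ a, jacobian Θ y a 3 = (Pi.single 1 1 : Fin 4 → ℝ) a := by
    intro y hy
    have hz := hch.mem y hy
    have hJK : jacobian Θ y * jacobian Φ (Θ y) = 1 := mul_eq_one_comm.1 (hU y (hsub hy)).2
    have n00 : g.comp φ (Θ y) 0 0 = 0 := hD.isNull _ _ (hmem _ hz) _ (hmem _ hz)
    have n01 : g.comp φ (Θ y) 0 1 = 0 := hD.isNull _ _ (hmem _ hz) _ (hcoord _ hz).2.1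
    have n11 : g.comp φ (Θ y) 1 1 = 0 := hD.isNull _ _ (hcoord _ hz).2.1 _ (hcoord _ hz).2.1
    refine ⟨fun a => ?_, fun a => ?_⟩
    · have h := congrFun (congrFun hJK a) 0
      rw [Matrix.mul_apply, Fin.sum_univ_four, hK0 _ hz, hK1 _ hz, hK2, hK3, n00,
        g.comp_symm φ _ 1 0, n01] at h
      simpa [Matrix.one_apply, Pi.single_apply] using h
    · have h := congrFun (congrFun hJK a) 1
      rw [Matrix.mul_apply, Fin.sum_univ_four, hK0 _ hz, hK1 _ hz, hK2, hK3, n01, n11] at h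
      simpa [Matrix.one_apply, Pi.single_apply] using h
  -- Since g(∂₀, ·) = dF and F is the first new coordinate, the row of this coordinate vector is (1,
  -- 0, 0, 0); likewise H gives (0, 1, 0, 0).
  have hrow : ∀ y ∈ φ'.target, (∀ j, g.comp φ' y 2 j = if j = 0 then 1 else 0) ∧
      ∀ j, g.comp φ' y 3 j = if j = 1 then 1 else 0 := by
    intro y hy
    have hz := hch.mem y hy
    have hKJ := (hU y (hsub hy)).2
    refine ⟨fun j => ?_, fun j => ?_⟩
    · have h := congrFun (congrFun hKJ 0) j
      simp only [Matrix.mul_apply, hK0 _ hz, Matrix.one_apply, eq_comm (a := (0 : Fin 4))] at h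
      rw [hch.comp_eq hy, transpose_mul_mul_apply, funext (hcol y hy).1, scalarProd,
        single_one_dotProduct, ← h]
      rfl
    · have h := congrFun (congrFun hKJ 1) j
      simp only [Matrix.mul_apply, hK1 _ hz, Matrix.one_apply, eq_comm (a := (1 : Fin 4))] at h
      rw [hch.comp_eq hy, transpose_mul_mul_apply, funext (hcol y hy).2, scalarProd,
        single_one_dotProduct, ← h]
      rfl
  refine ⟨φ', hp' ▸ φ'.map_target h0, hch.isCoord',
    ⟨Matrix.of fun i j y => g.comp φ' y (Fin.castAdd 2 i) (Fin.castAdd 2 j),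
      ?_, fun i j y hy => (g.contDiffAt_comp hch.isCoord' hy (Fin.castAdd 2 i)
        (Fin.castAdd 2 j)).contDiffWithinAt,
      fun y hy => ?_⟩, fun y hy => ?_⟩
  · ext i j y
    exact g.comp_symm φ' y _ _
  · obtain ⟨h2, h3⟩ := hrow y hy
    ext i j
    fin_cases i <;> fin_cases j <;>
      simp [h2, h3, g.comp_symm φ' y 0 2, g.comp_symm φ' y 1 2, g.comp_symm φ' y 0 3,
        g.comp_symm φ' y 1 3]
  · have hz := hch.mem y hy
    refine hD.eq_span_coordVec hch.isCoord' hy (by decide) ?_ ?_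
    · refine hch.mem_of_toComp_eq hy ((hch.toComp_coordVec hy 2).trans
        (funext (hcol y hy).1)) ?_
      rw [← toComp_coordVec hφ hz, ofComp_toComp hφ hz]
      exact hmem _ hz
    · refine hch.mem_of_toComp_eq hy ((hch.toComp_coordVec hy 3).trans
        (funext (hcol y hy).2)) ?_
      rw [← toComp_coordVec hφ hz, ofComp_toComp hφ hz]
      exact (hcoord _ hz).2.1

end IsHessianPlane

end PseudoRiemannianMetric

end WalkerCoordinates

end

/-! ### The theorem, for both signs of the duality condition -/

theorem theorem1p2 {M : Type*} [TopologicalSpace M] [ChartedSpace R4 M]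
    [IsManifold (𝓡 4) ∞ M] (g : PseudoRiemannianMetric M) (f : M → ℝ) (μ : ℝ)
    (hsig : g.HasSignatureTwoTwo)
    (hQE : g.IsGeneralizedQuasiEinstein f μ)
    (hW : g.IsHalfConformallyFlat)
    (hμ : μ ≠ -1 / 2)
    (hgrad : ∀ p, g.grad f p ≠ 0)
    (hnull : ∀ p, g.val p (g.grad f p) (g.grad f p) = 0) :
    ∃ D : ∀ p : M, Submodule ℝ (TangentSpace (𝓡 4) p),
      g.IsWalkerStructure D ∧
      (∀ p : M, ∃ O : Set M, IsOpen O ∧ p ∈ O ∧ ∃ U : ∀ q : M, TangentSpace (𝓡 4) q,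
        IsSmoothVectorFieldOn U O ∧ ∀ q ∈ O, D q = Submodule.span ℝ {g.grad f q, U q}) ∧
      ∀ p : M, ∃ φ : OpenPartialHomeomorph M R4, p ∈ φ.source ∧ g.IsWalkerCoord D φ := by
  obtain ⟨A, κ, hκ, hA⟩ : ∃ (A : OrientedAtlas M) (κ : ℝ), κ * κ = 1 ∧ g.WeylVanishesOn A κ := by
    obtain ⟨A, hA | hA⟩ := hW
    · exact ⟨A, -1, by norm_num, hA⟩
    · exact ⟨A, 1, by norm_num, hA⟩
  have hD := g.isHessianPlane_adaptedPlane hμ hκ hsig hQE hA hgrad hnull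
  exact ⟨_, hD.isWalkerStructure hQE.1, hD.exists_isSmoothVectorFieldOn,
    fun p => hD.exists_isWalkerCoord hQE.1 (hgrad p)⟩
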